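/- **Setting.** Consider a Runge–Kutta method with finitely many (at least one) stages, real coefficient matrix $\mathbf A$ and weights $\mathbf b$, and stability function $r(z)=1+z\,\mathbf b^T(\mathbf I-z\mathbf A)^{-1}\mathbb 1$, $\mathbb 1=(1,\dots,1)^T$. Assume: $\mathbf I-z\mathbf A$ is invertible and $|r(z)|\le 1$ for $\operatorname{Re}z\le 0$ ($A$-stability); $\sum_i b_i=1$ (order at least one); $|r(\mathrm iy)|<1$ for real $y\neq0$; $r(z)\to0$ as $|z|\to\infty$; $\mathbf A$ is invertible. For $\xi>0$ let $$\gamma(\xi)=\inf\Big\{\frac{\log|r(z)|}{\operatorname{Re}z}:\ -\xi\le\operatorname{Re}z<0,\ r(z)\ne0\Big\}.$$ Let $\boldsymbol\Delta(\zeta)=\big(\mathbf A+\frac{\zeta}{1-\zeta}\mathbb 1\mathbf b^T\big)^{-1}$. For $h>0$ and a kernel $K(\cdot,d)$ the weight $\boldsymbol\omega_n(d)$ is the last row of $\mathbf W_n(d)$, where $\sum_n\mathbf W_n(d)\zeta^n=K(\boldsymbol\Delta(\zeta)/h,d)$, and $\mathbf e_n(z)$ is the last row of $\mathbf E_n(z)$,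 where $\sum_n\mathbf E_n(z)\zeta^n=(\boldsymbol\Delta(\zeta)-z\mathbf I)^{-1}$. Let $\varphi(x)=1-\sin(\alpha-\mathrm ix)$, and for $L\ge1$, $\tau=a/L$, $\nu>0$ let $$\mathbf f(x)=\frac{\nu h}{2\pi\mathrm i}K(\nu\varphi(x),d)\,\mathbf e_n(\nu\varphi(x)h)\,\varphi'(x),\qquad \mathbf I_L=\frac aL\sum_{k=-L}^{L}\mathbf f(k\tau).$$ Norms of row vectors are maximum norms. **Statement.** There is $\rho>0$ such that, for all $z$ with $0\le\operatorname{Re}z\le\rho$, $\mathbf I-z\mathbf A$ is invertible and $|r(z)|\le|e^{2z}|$. Fix any such $\rho$ and any $\mu\in\mathbb R$, and let $m$ be the smallest non-negative integer with $m>\mu$. Put $\kappa=m$ if $\mathbf b^T$ is the last row of $\mathbf A$, and $\kappa=\max\{m,1\}$ otherwise. Then there are constants $C_0(\sigma)>0$, $\sigma\in\mathbb R$, depending only on the method, $\rho$, $\mu$ and $\sigma$, such that the following holds. Let $\delta\in(0,\pi/2)$, $\alpha\in(0,\pi/2-\delta)$, $0<b<\min\{\alpha,\pi/2-(\delta+\alpha)\}$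 and $d>0$. Let $K(\cdot,d)$ be analytic in the sector $U_\delta=\{\lambda\neq0:|\operatorname{Arg}\lambda|<\pi-\delta\}$ with $|e^{\lambda d}K(\lambda,d)|\le C(d)|\lambda|^\mu$ there. Let $t_0>0$, $\Lambda\ge1$, $0<D<1$, $\theta\in(0,1)$, let $h,\nu_0>0$ satisfy $h\nu_0(1-\sin(\alpha-b))<\rho$, and let $n\ge m$ and $L\ge1$ be integers with $t_n=nh\in[t_0,\Lambda t_0]$. Suppose that the parameters are chosen such that $$\tau=\frac{a}{L},\qquad \nu=\frac{\pi bL\theta}{\Lambda t_0a},\qquad a=a(\theta)=\operatorname{arccosh}\left(\frac{\gamma(\xi)(1-D)\theta+2\Lambda(1-\theta)}{\gamma(\xi)(1-D)\theta\sin(\alpha-b)}\right),$$ where $\xi=h\nu_0\sup_{|y|\le b}|\operatorname{Re}\varphi(a+\tau/2+\mathrm iy)|$, and that $\nu\le\nu_0$ and $d\le D\gamma(\xi)t_0$. Then $$\|\boldsymbol\omega_n(d)-\mathbf I_L\|\le C\exp\left(-\frac{2\pi bL(1-\theta)}{a(\theta)}\right),$$ where $$C=C_0(\sin(\alpha+b))\,C(d)\,\nu^{1+\mu}\max\{1,(\cosh(a+\tau/2))^{1+\mu}\}\left(\frac{h(2a+\tau)}{1-e^{-2\pi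 b/\tau}}+\Big(h\tau+\frac1\nu\Big)(h\nu\cosh a)^{-m}\right)e^{\kappa\gamma(\xi)\xi}.$$ -/

import Mathlib

open Filter Topology

noncomputable section

/-- The Butcher coefficients `A`, `b` of a Runge-Kutta method with `s + 1` stages.  (The nodes `c`
enter neither the stability function nor the convolution quadrature weights.) -/
structure RKMethod (s : ℕ) where
  A : Matrix (Fin (s + 1)) (Fin (s + 1)) ℝ
  b : Fin (s + 1) → ℝ

namespace RKMethod

variable {s : ℕ} (M : RKMethod s)

/-- The coefficient matrix, as a complex matrix. -/
def Ac : Matrix (Fin (s + 1)) (Fin (s + 1)) ℂ := M.A.map Complex.ofReal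

/-- The weight vector, as a complex vector. -/
def bc : Fin (s + 1) → ℂ := fun i => (M.b i : ℂ)

/-- The stability function `r(z) = 1 + z bᵀ (I - z A)⁻¹ 𝟙`. -/
def r (z : ℂ) : ℂ :=
  1 + z * dotProduct M.bc (Matrix.mulVec (1 - z • M.Ac)⁻¹ (fun _ => 1))

/-- The standing assumptions on the method.  A-stability is the bound `|r(z)| ≤ 1` on the closed
left half-plane, and it includes that the resolvent `(I - z A)⁻¹` in the formula for `r` exists
there.  Classical order at least one is the single order condition `∑ bᵢ = 1`. -/
structure Admissible : Prop where
  det_ne_zero : ∀ z : ℂ, z.re ≤ 0 → (1 - z • M.Ac).det ≠ 0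
  aStable : ∀ z : ℂ, z.re ≤ 0 → ‖M.r z‖ ≤ 1
  order_pos : ∑ i, M.b i = 1
  norm_lt_one : ∀ y : ℝ, y ≠ 0 → ‖M.r (y * Complex.I)‖ < 1
  tendsto_zero : Tendsto M.r (cocompact ℂ) (𝓝 0)
  invertible : M.A.det ≠ 0

/-- The method is stiffly accurate: `b` is the last row of `A`. -/
def StifflyAccurate : Prop := ∀ j, M.b j = M.A (Fin.last s) j

/-- `γ(ξ)`, the infimum of `log |r(z)| / Re z` over the strip `-ξ ≤ Re z ≤ 0`.  The points with
`Re z = 0`, where the quotient is undefined, and those with `r(z) = 0`, where it equals `+∞`, are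
left out. -/
def gam (ξ : ℝ) : ℝ :=
  sInf {x : ℝ | ∃ z : ℂ, -ξ ≤ z.re ∧ z.re < 0 ∧ M.r z ≠ 0 ∧ x = Real.log ‖M.r z‖ / z.re}

/-- `ρ > 0` is such that `|r(z)| ≤ |e^{2z}|` in the strip `0 ≤ Re z ≤ ρ`, which contains no
singularity of `(I - z A)⁻¹`. -/
def IsStripWidth (ρ : ℝ) : Prop :=
  0 < ρ ∧ ∀ z : ℂ, 0 ≤ z.re → z.re ≤ ρ →
    (1 - z • M.Ac).det ≠ 0 ∧ ‖M.r z‖ ≤ ‖Complex.exp (2 * z)‖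

/-- `Δ(ζ) = (A + ζ / (1 - ζ) 𝟙 bᵀ)⁻¹`. -/
def Delta (ζ : ℂ) : Matrix (Fin (s + 1)) (Fin (s + 1)) ℂ :=
  (M.Ac + (ζ / (1 - ζ)) • Matrix.vecMulVec (fun _ => 1) M.bc)⁻¹

end RKMethod

/-- `p` interpolates `f` on the spectrum of `B` in the sense of Hermite: at each eigenvalue, the
derivatives of `p` and `f` agree up to one less than the algebraic multiplicity. -/
def IsHermiteInterpolant {n : ℕ} (f : ℂ → ℂ) (B : Matrix (Fin n) (Fin n) ℂ)
    (p : Polynomial ℂ) : Prop :=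
  ∀ l : ℂ, ∀ j < B.charpoly.rootMultiplicity l,
    (Polynomial.derivative^[j] p).eval l = iteratedDeriv j f l

open Classical in
/-- The primary matrix function `f(B)` of a function `f` holomorphic near the spectrum of `B`:
`f(B) = p(B)` for any Hermite interpolating polynomial `p`. -/
def matrixFunction {n : ℕ} (f : ℂ → ℂ) (B : Matrix (Fin n) (Fin n) ℂ) :
    Matrix (Fin n) (Fin n) ℂ :=
  if hp : ∃ p : Polynomial ℂ, IsHermiteInterpolant f B p then
    Polynomial.aeval B (Classical.choose hp)
  else 0

/-- The `k`-th coefficient of the power series at `0` of a matrix-valued analytic function. -/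
def matrixCoeff {n : ℕ} (F : ℂ → Matrix (Fin n) (Fin n) ℂ) (k : ℕ) :
    Matrix (Fin n) (Fin n) ℂ :=
  Matrix.of fun i j => iteratedDeriv k (fun ζ => F ζ i j) 0 / (k.factorial : ℂ)

namespace RKMethod

variable {s : ℕ} (M : RKMethod s)

/-- The convolution weight matrices: `∑ Wₙ(d) ζⁿ = K(Δ(ζ)/h, d)`. -/
def weightMatrix (K : ℂ → ℝ → ℂ) (d h : ℝ) (n : ℕ) : Matrix (Fin (s + 1)) (Fin (s + 1)) ℂ :=
  matrixCoeff (fun ζ => matrixFunction (fun l => K l d) ((h : ℂ)⁻¹ • M.Delta ζ)) n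

/-- The convolution weights `ωₙ(d)`, the last row of `Wₙ(d)`. -/
def weight (K : ℂ → ℝ → ℂ) (d h : ℝ) (n : ℕ) : Fin (s + 1) → ℂ :=
  M.weightMatrix K d h n (Fin.last s)

/-- The matrices `Eₙ(z)`: `(Δ(ζ) - z I)⁻¹ = ∑ Eₙ(z) ζⁿ`. -/
def E (n : ℕ) (z : ℂ) : Matrix (Fin (s + 1)) (Fin (s + 1)) ℂ :=
  matrixCoeff (fun ζ => (M.Delta ζ - z • 1)⁻¹) n

/-- The row vector `eₙ(z)`, the last row of `Eₙ(z)`. -/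
def e (n : ℕ) (z : ℂ) : Fin (s + 1) → ℂ := M.E n z (Fin.last s)

open Classical in
/-- The number of factors of `r` that are not available for exponential decay: `m` of them are
spent on algebraic decay, and at least one is missing in `eₙ` if the method is not stiffly
accurate. -/
def loss (m : ℕ) : ℕ := if M.StifflyAccurate then m else max m 1

end RKMethod

/-- The sector `|Arg λ| < π - δ` (without the origin, which has no argument). -/
def sector (δ : ℝ) : Set ℂ := {l | l ≠ 0 ∧ |l.arg| < Real.pi - δ}

/-- `φ(x) = 1 - sin (α - i x)`, parametrizing the left branch of a hyperbola. -/
def hyperbola (α : ℝ) (x : ℂ) : ℂ := 1 - Complex.sin (α - Complex.I * x)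

namespace RKMethod

variable {s : ℕ} (M : RKMethod s)

/-- The integrand `f(x) = ν h / (2 π i) K(ν φ(x), d) eₙ(ν φ(x) h) φ'(x)`. -/
def integrand (K : ℂ → ℝ → ℂ) (d h : ℝ) (n : ℕ) (α ν : ℝ) (x : ℂ) : Fin (s + 1) → ℂ :=
  ((ν * h : ℂ) / (2 * Real.pi * Complex.I) * K (ν * hyperbola α x) d *
    deriv (hyperbola α) x) • M.e n (ν * hyperbola α x * h)

/-- The quadrature `I_L = (a / L) ∑_{k = -L}^{L} f(k a / L)`. -/
def quadrature (K : ℂ → ℝ → ℂ) (d h : ℝ) (n : ℕ) (α ν a : ℝ) (L : ℕ) : Fin (s + 1) → ℂ :=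
  ((a / L : ℝ) : ℂ) • ∑ k ∈ Finset.Icc (-(L : ℤ)) L,
    M.integrand K d h n α ν ((k * (a / L) : ℝ) : ℂ)

/-- `ξ = h ν₀ sup_{|y| ≤ b} |Re φ(a + τ/2 + i y)|`. -/
def stripParam (h ν₀ α b a τ : ℝ) : ℝ :=
  h * ν₀ * sSup ((fun y : ℝ =>
    |(hyperbola α ((a + τ / 2 : ℝ) + y * Complex.I)).re|) '' Set.Icc (-b) b)

end RKMethod

end

/-!
The weights are contour integrals, and the quadrature is the trapezoidal rule for such an integral.

Since `A + ζ / (1 - ζ) 𝟙 bᵀ` is a rank-one perturbation of `A`, the resolvent of `Δ(ζ)` is explicit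
(`Delta_sub_inv`): `Eₙ(z) = r(z)ⁿ⁻¹ (I - z A)⁻¹ 𝟙 bᵀ (I - z A)⁻¹` for `n ≥ 1`. As `r` and the two
resolvent factors are `O(1 / (1 + |z|))` to the left of `Re z = ρ`, the vector `eₙ(z)` decays like
`(1 + |z|)⁻ᵐ⁻¹` even if `|r(z)|` to the power `n - κ` is split off (`exists_norm_e_le`). For stiffly
accurate methods the last entry of `(I - z A)⁻¹ 𝟙` is itself `r(z)`, which makes `κ = 0` possible.

For small `ζ` the spectrum of `Δ(ζ) / h` lies to the right of `Re z = ρ / h`. Cauchy's formula for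
primary matrix functions (`Encloses.integral_mul_resolvent`) over a contour around it, expanded in
powers of `ζ`, gives `ωₙ = h / (2 π i) ∫ K(λ) eₙ(h λ) dλ` (`weight_eq_chainIntegral`). Cauchy's
formula is proved by Newton interpolation at the eigenvalues, which needs only the integrals of
reciprocals of products `∏ (z - q)` and no Jordan form. The contour consists of the hyperbola
`λ = ν φ(x)`, `|x| ≤ X = a + τ / 2`, two vertical segments at its ends, and the remaining sides of a
large box; as the box grows, the latter contribute nothing, and the vertical rays contribute a
truncation error (`norm_weight_sub_arc_integral_le`).

On the hyperbola, up to constants, `|K(λ) eₙ(h λ)|` is at most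
`|λ| ^ μ exp (κ γ ξ) exp (γ (1 - D) t₀ Re λ)` times the algebraic decay where `-ξ ≤ h Re λ ≤ 0`, by
the definition of `γ(ξ)` and `d ≤ D γ t₀`, and it is at most `|λ| ^ μ exp (2 n h Re λ)` where
`0 ≤ h Re λ ≤ ρ`. The trapezoidal rule is compared with the integral by the residue theorem on the
rectangle `|Re x| ≤ X`, `|Im x| ≤ b` (`norm_integral_sub_trapezoid_le`): the horizontal sides give
`exp (2 Λ t₀ ν - 2 π b L / a)`, and the vertical sides, like the rays, a value of
`exp (γ (1 - D) t₀ Re λ)` with `Re λ ≤ ν (1 - sin (α - b) cosh a)`. The choice of `ν` and `a` makes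
both exponents at most `-2 π b L (1 - θ) / a`.

A strip width `ρ` exists (`exists_isStripWidth`) because `r'(0) = 1`, `|r| ≤ 1` on the imaginary
axis with equality only at the origin, and `r` vanishes at infinity.
-/

/-! ### The resolvent of `Δ(ζ)` and the matrices `Eₙ(z)` -/

noncomputable section

namespace RKMethod

open Matrix

variable {s : ℕ} (M : RKMethod s)

/-- The matrix `(I - z A)⁻¹` (the zero matrix where `I - z A` is singular). -/
def res (z : ℂ) : Matrix (Fin (s + 1)) (Fin (s + 1)) ℂ := (1 - z • M.Ac)⁻¹

/-- The vector `(I - z A)⁻¹ 𝟙`. -/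
def resOne (z : ℂ) : Fin (s + 1) → ℂ := M.res z *ᵥ (fun _ => 1)

/-- The row vector `bᵀ (I - z A)⁻¹`. -/
def bRes (z : ℂ) : Fin (s + 1) → ℂ := M.bc ᵥ* M.res z

variable {M}

lemma r_eq (z : ℂ) : M.r z = 1 + z * (M.bc ⬝ᵥ M.resOne z) := rfl

lemma mul_res {z : ℂ} (hz : (1 - z • M.Ac).det ≠ 0) : (1 - z • M.Ac) * M.res z = 1 :=
  Matrix.mul_nonsing_inv _ (isUnit_iff_ne_zero.2 hz)

lemma smul_Ac_mul_res {z : ℂ} (hz : (1 - z • M.Ac).det ≠ 0) :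
    z • (M.Ac * M.res z) = M.res z - 1 := by
  have h := mul_res hz
  rw [sub_mul, one_mul, smul_mul] at h
  rw [← h]; abel

/-- The matrix `A + ζ / (1 - ζ) 𝟙 bᵀ` whose inverse is `Δ(ζ)`. -/
def deltaInv (M : RKMethod s) (ζ : ℂ) : Matrix (Fin (s + 1)) (Fin (s + 1)) ℂ :=
  M.Ac + (ζ / (1 - ζ)) • vecMulVec (fun _ => 1) M.bc

/-- The rank-one update formula for the inverse of `I - z A - z ζ / (1 - ζ) 𝟙 bᵀ`, written without
the inverse. -/
lemma one_sub_smul_deltaInv_mul {z ζ : ℂ} (hz : (1 - z • M.Ac).det ≠ 0) (hζ : ζ ≠ 1)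
    (hr : ζ * M.r z ≠ 1) :
    (1 - z • M.deltaInv ζ) *
      (M.Ac * M.res z + (ζ / (1 - ζ * M.r z)) • vecMulVec (M.resOne z) (M.bRes z)) =
      M.deltaInv ζ := by
  set c : ℂ := ζ / (1 - ζ) with hc
  set q : ℂ := ζ / (1 - ζ * M.r z) with hq
  have h1 : (1 - z • M.deltaInv ζ) =
      (1 - z • M.Ac) - (z * c) • vecMulVec (fun _ => 1) M.bc := by
    rw [deltaInv, smul_add, smul_smul, sub_sub]
  have h2 : (1 - z • M.Ac) * (M.Ac * M.res z) = M.Ac := by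
    have : (1 - z • M.Ac) * M.Ac = M.Ac * (1 - z • M.Ac) := by
      simp [sub_mul, mul_sub]
    rw [← mul_assoc, this, mul_assoc, mul_res hz, mul_one]
  have h3 : (1 - z • M.Ac) * vecMulVec (M.resOne z) (M.bRes z) =
      vecMulVec (fun _ => 1) (M.bRes z) := by
    rw [mul_vecMulVec, resOne, mulVec_mulVec, mul_res hz, one_mulVec]
  have h4 : z • (vecMulVec (fun _ : Fin (s+1) => (1:ℂ)) M.bc * (M.Ac * M.res z)) =
      vecMulVec (fun _ => 1) (M.bRes z) - vecMulVec (fun _ => 1) M.bc := by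
    rw [← Matrix.mul_smul, smul_Ac_mul_res hz, mul_sub, mul_one, vecMulVec_mul]
    rfl
  have h5 : z • (vecMulVec (fun _ : Fin (s+1) => (1:ℂ)) M.bc *
      vecMulVec (M.resOne z) (M.bRes z)) =
      (M.r z - 1) • vecMulVec (fun _ => 1) (M.bRes z) := by
    rw [vecMulVec_mul_vecMulVec, r_eq, vecMulVec_smul, smul_smul]
    congr 1; ring
  have h1ζ : (1 - ζ) ≠ 0 := sub_ne_zero.2 hζ.symm
  have h1r : (1 - ζ * M.r z) ≠ 0 := sub_ne_zero.2 hr.symm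
  -- the scalar identity behind the update: `1 - ζ r(z) = (1 - ζ) (1 - c (r(z) - 1))`
  have key : q - c - c * q * (M.r z - 1) = 0 := by
    rw [hq, hc]; field_simp; ring
  have h6 : (z * c) • vecMulVec (fun _ : Fin (s+1) => (1:ℂ)) M.bc * (M.Ac * M.res z) =
      c • (vecMulVec (fun _ => 1) (M.bRes z) - vecMulVec (fun _ => 1) M.bc) := by
    rw [← h4, smul_mul, smul_smul, mul_comm]
  have h7 : (z * c) • vecMulVec (fun _ : Fin (s+1) => (1:ℂ)) M.bc *
      (q • vecMulVec (M.resOne z) (M.bRes z)) =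
      (c * q * (M.r z - 1)) • vecMulVec (fun _ => 1) (M.bRes z) := by
    rw [mul_smul (c * q), ← h5, smul_mul, Matrix.mul_smul, smul_smul, smul_smul]
    congr 1; ring
  rw [h1, mul_add, sub_mul (1 - z • M.Ac), sub_mul (1 - z • M.Ac), h2, h6, h7,
    Matrix.mul_smul, h3, deltaInv, ← hc]
  have : q = c + c * q * (M.r z - 1) := by linear_combination key
  conv_lhs => enter [2,1,1]; rw [this]
  rw [add_smul, smul_sub]
  abel

lemma Delta_eq (ζ : ℂ) : M.Delta ζ = (M.deltaInv ζ)⁻¹ := rfl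

lemma Delta_sub_mul {z ζ : ℂ} (hz : (1 - z • M.Ac).det ≠ 0) (hζ : ζ ≠ 1)
    (hr : ζ * M.r z ≠ 1) (hX : (M.deltaInv ζ).det ≠ 0) :
    (M.Delta ζ - z • 1) *
      (M.Ac * M.res z + (ζ / (1 - ζ * M.r z)) • vecMulVec (M.resOne z) (M.bRes z)) = 1 := by
  have hu := isUnit_iff_ne_zero.2 hX
  have h : M.Delta ζ - z • 1 = M.Delta ζ * (1 - z • M.deltaInv ζ) := by
    rw [mul_sub, mul_one, Matrix.mul_smul, Delta_eq, nonsing_inv_mul _ hu]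
  rw [h, mul_assoc, one_sub_smul_deltaInv_mul hz hζ hr, Delta_eq, nonsing_inv_mul _ hu]

lemma Delta_sub_inv {z ζ : ℂ} (hz : (1 - z • M.Ac).det ≠ 0) (hζ : ζ ≠ 1)
    (hr : ζ * M.r z ≠ 1) (hX : (M.deltaInv ζ).det ≠ 0) :
    (M.Delta ζ - z • 1)⁻¹ =
      M.Ac * M.res z + (ζ / (1 - ζ * M.r z)) • vecMulVec (M.resOne z) (M.bRes z) :=
  inv_eq_right_inv (Delta_sub_mul hz hζ hr hX)

lemma det_Delta_sub_ne_zero {z ζ : ℂ} (hz : (1 - z • M.Ac).det ≠ 0) (hζ : ζ ≠ 1)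
    (hr : ζ * M.r z ≠ 1) (hX : (M.deltaInv ζ).det ≠ 0) : (M.Delta ζ - z • 1).det ≠ 0 := by
  intro h
  have := congrArg det (Delta_sub_mul hz hζ hr hX)
  rw [det_mul, h, zero_mul, det_one] at this
  exact zero_ne_one this

lemma det_Ac_ne_zero (hM : M.Admissible) : M.Ac.det ≠ 0 := by
  have : M.Ac.det = ((M.A.det : ℝ) : ℂ) := by
    rw [Ac]; exact (RingHom.map_det Complex.ofRealHom M.A).symm
  rw [this]; exact_mod_cast hM.invertible

lemma eventually_det_deltaInv_ne_zero (hM : M.Admissible) :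
    ∀ᶠ ζ in 𝓝 (0 : ℂ), (M.deltaInv ζ).det ≠ 0 := by
  have hc : ContinuousAt (fun ζ : ℂ => (M.deltaInv ζ).det) 0 := by
    have : ContinuousAt (fun ζ : ℂ => M.deltaInv ζ) 0 := by
      unfold deltaInv
      have h : ContinuousAt (fun ζ : ℂ => ζ / (1 - ζ)) 0 :=
        continuousAt_id.div (by fun_prop) (by simp)
      exact continuousAt_const.add (h.smul continuousAt_const)
    exact (Continuous.matrix_det continuous_id).continuousAt.comp this
  apply hc.eventually_ne
  simpa [deltaInv] using det_Ac_ne_zero hM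

end RKMethod

/-- The coefficients of a convergent power series are recovered by the iterated derivatives. -/
lemma iteratedDeriv_div_factorial_of_hasSum {f : ℂ → ℂ} {c : ℕ → ℂ}
    {ε : ℝ} (hε : 0 < ε) (h : ∀ ζ : ℂ, ‖ζ‖ < ε → HasSum (fun k => c k * ζ ^ k) (f ζ)) (n : ℕ) :
    iteratedDeriv n f 0 / (n.factorial : ℂ) = c n := by
  have h1 : HasFPowerSeriesAt f (FormalMultilinearSeries.ofScalars ℂ c) 0 := by
    rw [hasFPowerSeriesAt_iff]
    filter_upwards [Metric.ball_mem_nhds (0:ℂ) hε] with ζ hζ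
    simpa [mul_comm] using h ζ (by simpa using hζ)
  have h2 := h1.analyticAt.hasFPowerSeriesAt
  have h3 := h1.eq_formalMultilinearSeries h2
  have h4 := congrArg (fun p => p.coeff n) h3
  simpa using h4.symm

namespace RKMethod
open Matrix
variable {s : ℕ} {M : RKMethod s}

/-- The coefficients of the power series of `(Δ(ζ) - z I)⁻¹` in closed form: `A (I - z A)⁻¹`, and
for `ζⁿ⁺¹` the rank-one matrix `r(z)ⁿ (I - z A)⁻¹ 𝟙 bᵀ (I - z A)⁻¹`. -/
def Ecoeff (M : RKMethod s) (z : ℂ) (i j : Fin (s + 1)) : ℕ → ℂ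
  | 0 => (M.Ac * M.res z) i j
  | n + 1 => M.r z ^ n * (M.resOne z i * M.bRes z j)

lemma hasSum_Delta_sub_inv {z ζ : ℂ} (hz : (1 - z • M.Ac).det ≠ 0) (hζ : ζ ≠ 1)
    (hr : ‖ζ * M.r z‖ < 1) (hX : (M.deltaInv ζ).det ≠ 0) (i j : Fin (s + 1)) :
    HasSum (fun k => M.Ecoeff z i j k * ζ ^ k) ((M.Delta ζ - z • 1)⁻¹ i j) := by
  have hr1 : ζ * M.r z ≠ 1 := by
    intro h; rw [h] at hr; simp at hr
  rw [← hasSum_nat_add_iff' 1]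
  have hg := (hasSum_geometric_of_norm_lt_one hr).mul_left (ζ * (M.resOne z i * M.bRes z j))
  have e1 : (fun k => M.Ecoeff z i j (k + 1) * ζ ^ (k + 1)) =
      fun k => ζ * (M.resOne z i * M.bRes z j) * (ζ * M.r z) ^ k := by
    ext k; simp only [Ecoeff]; ring
  have e2 : (M.Delta ζ - z • 1)⁻¹ i j - ∑ k ∈ Finset.range 1, M.Ecoeff z i j k * ζ ^ k =
      ζ * (M.resOne z i * M.bRes z j) * (1 - ζ * M.r z)⁻¹ := by
    rw [Delta_sub_inv hz hζ hr1 hX]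
    simp [Ecoeff, vecMulVec_apply]; ring
  rw [e1, e2]
  exact hg

lemma E_apply (hM : M.Admissible) {z : ℂ} (hz : (1 - z • M.Ac).det ≠ 0) (n : ℕ)
    (i j : Fin (s + 1)) : M.E n z i j = M.Ecoeff z i j n := by
  obtain ⟨ε, hε, hE⟩ := Metric.eventually_nhds_iff.1 (eventually_det_deltaInv_ne_zero hM)
  have hpos : 0 < 1 / (1 + ‖M.r z‖) := by positivity
  refine iteratedDeriv_div_factorial_of_hasSum (ε := min ε (1 / (1 + ‖M.r z‖)))
    (lt_min hε hpos) (fun ζ hζ => ?_) n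
  have h1 : ‖ζ‖ * (1 + ‖M.r z‖) < 1 := by
    rw [← lt_div_iff₀ (by positivity)]; exact hζ.trans_le (min_le_right _ _)
  refine hasSum_Delta_sub_inv hz ?_ ?_ (hE (by simpa using hζ.trans_le (min_le_left _ _))) i j
  · rintro rfl
    have := norm_nonneg (M.r z)
    simp at h1; linarith
  · rw [norm_mul]; nlinarith [norm_nonneg ζ]

end RKMethod
end

/-! ### Decay of the resolvent and of `eₙ(z)` -/

noncomputable section

namespace RKMethod

open Matrix

variable {s : ℕ} {M : RKMethod s}

lemma continuous_one_sub_smul_Ac : Continuous (fun z : ℂ => 1 - z • M.Ac) := by fun_prop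

lemma continuous_det_one_sub : Continuous (fun z : ℂ => (1 - z • M.Ac).det) :=
  continuous_one_sub_smul_Ac.matrix_det

lemma continuousAt_res {z : ℂ} (hz : (1 - z • M.Ac).det ≠ 0) (i j : Fin (s + 1)) :
    ContinuousAt (fun z => M.res z i j) z := by
  have h : (fun z => M.res z i j) =
      fun z => ((1 - z • M.Ac).det)⁻¹ * (1 - z • M.Ac).adjugate i j := by
    ext z; simp [res, Matrix.inv_def]
  rw [h]
  refine (continuous_det_one_sub.continuousAt.inv₀ hz).mul ?_
  exact (continuous_one_sub_smul_Ac.matrix_adjugate.matrix_elem i j).continuousAt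

lemma differentiableAt_res {z : ℂ} (hz : (1 - z • M.Ac).det ≠ 0) (i j : Fin (s + 1)) :
    DifferentiableAt ℂ (fun z => M.res z i j) z := by
  have h : (fun z => M.res z i j) =
      fun z => ((1 - z • M.Ac).det)⁻¹ * ((1 - z • M.Ac).updateRow j (Pi.single i 1)).det := by
    ext z; simp [res, Matrix.inv_def, adjugate_apply]
  have hd : ∀ B : ℂ → Matrix (Fin (s + 1)) (Fin (s + 1)) ℂ,
      (∀ i j, Differentiable ℂ (fun z => B z i j)) → Differentiable ℂ (fun z => (B z).det) := by
    intro B hB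
    simp only [det_apply]
    refine Differentiable.fun_sum fun σ _ => Differentiable.const_smul ?_ _
    exact Differentiable.fun_finsetProd fun k _ => hB _ _
  have h0 : ∀ k l, Differentiable ℂ (fun z : ℂ => (1 - z • M.Ac) k l) := by
    intro k l
    simp only [Matrix.sub_apply, Matrix.smul_apply, smul_eq_mul]
    fun_prop
  rw [h]
  refine ((hd _ h0 z).inv hz).mul (hd _ (fun k l => ?_) z)
  by_cases hk : k = j
  · subst hk; simp
  · simp [updateRow_ne hk]

lemma differentiableAt_r {z : ℂ} (hz : (1 - z • M.Ac).det ≠ 0) : DifferentiableAt ℂ M.r z := by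
  have : M.r = fun z => 1 + z * ∑ i, M.bc i * ∑ j, M.res z i j := by
    ext z; simp [r_eq, dotProduct, resOne, mulVec]
  rw [this]
  refine (differentiableAt_const _).add (differentiableAt_id.mul ?_)
  refine DifferentiableAt.fun_sum fun i _ => (differentiableAt_const _).mul ?_
  exact DifferentiableAt.fun_sum fun j _ => differentiableAt_res hz i j

/-- At infinity, `I - z A` is invertible and `(I - z A)⁻¹` decays like `1 / z`. -/
lemma res_cocompact (hM : M.Admissible) :
    (∀ᶠ z in cocompact ℂ, (1 - z • M.Ac).det ≠ 0) ∧
    ∀ i j, Tendsto (fun z => z * M.res z i j) (cocompact ℂ) (𝓝 (-(M.Ac⁻¹) i j)) := by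
  have hA := det_Ac_ne_zero hM
  have hA' : (-M.Ac).det ≠ 0 := by
    rw [det_neg]; exact mul_ne_zero (pow_ne_zero _ (by norm_num)) hA
  have hcont : Continuous (fun w : ℂ => w • (1 : Matrix (Fin (s+1)) (Fin (s+1)) ℂ) - M.Ac) := by
    fun_prop
  have hdet : ∀ᶠ w in 𝓝 (0:ℂ), (w • (1 : Matrix (Fin (s+1)) (Fin (s+1)) ℂ) - M.Ac).det ≠ 0 := by
    apply hcont.matrix_det.continuousAt.eventually_ne
    simpa using hA'
  have hinv : Tendsto (fun z : ℂ => z⁻¹) (cocompact ℂ) (𝓝 0) := by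
    rw [← Metric.cobounded_eq_cocompact]; exact tendsto_inv₀_cobounded
  have hdet' : ∀ᶠ z in cocompact ℂ,
      (z⁻¹ • (1 : Matrix (Fin (s+1)) (Fin (s+1)) ℂ) - M.Ac).det ≠ 0 :=
    hinv.eventually hdet
  have hne : ∀ᶠ z in cocompact ℂ, z ≠ (0:ℂ) := by
    have := (isCompact_singleton (x := (0:ℂ))).compl_mem_cocompact
    filter_upwards [this] with z hz using hz
  have hfac : ∀ z : ℂ, z ≠ 0 → (1 - z • M.Ac) =
      z • (z⁻¹ • (1 : Matrix (Fin (s+1)) (Fin (s+1)) ℂ) - M.Ac) := by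
    intro z hz
    rw [smul_sub, smul_smul, mul_inv_cancel₀ hz, one_smul]
  refine ⟨?_, fun i j => ?_⟩
  · filter_upwards [hdet', hne] with z h1 h2
    rw [hfac z h2, det_smul]
    exact mul_ne_zero (pow_ne_zero _ h2) h1
  · have hlim : Tendsto (fun w : ℂ =>
        ((w • (1 : Matrix (Fin (s+1)) (Fin (s+1)) ℂ) - M.Ac).det)⁻¹ *
          (w • (1 : Matrix (Fin (s+1)) (Fin (s+1)) ℂ) - M.Ac).adjugate i j) (𝓝 0)
        (𝓝 (((0:ℂ) • (1 : Matrix (Fin (s+1)) (Fin (s+1)) ℂ) - M.Ac).det⁻¹ *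
          ((0:ℂ) • (1 : Matrix (Fin (s+1)) (Fin (s+1)) ℂ) - M.Ac).adjugate i j)) :=
      (hcont.matrix_det.continuousAt.inv₀ (by simpa using hA')).mul
        (hcont.matrix_adjugate.matrix_elem i j).continuousAt
    have hval : ((0:ℂ) • (1 : Matrix (Fin (s+1)) (Fin (s+1)) ℂ) - M.Ac).det⁻¹ *
          ((0:ℂ) • (1 : Matrix (Fin (s+1)) (Fin (s+1)) ℂ) - M.Ac).adjugate i j =
          -(M.Ac⁻¹) i j := by
      have h1 : (-M.Ac)⁻¹ = -(M.Ac⁻¹) := by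
        apply inv_eq_right_inv
        rw [neg_mul_neg, mul_nonsing_inv _ (isUnit_iff_ne_zero.2 hA)]
      have h2 := congrFun (congrFun h1 i) j
      rw [← Matrix.neg_apply, ← h1, Matrix.inv_def]
      simp
    rw [hval] at hlim
    have hlim2 := hlim.comp hinv
    refine hlim2.congr' ?_
    filter_upwards [hdet', hne] with z h1 h2
    have : M.res z = z⁻¹ • (z⁻¹ • (1 : Matrix (Fin (s+1)) (Fin (s+1)) ℂ) - M.Ac)⁻¹ := by
      apply inv_eq_right_inv
      rw [hfac z h2, Matrix.mul_smul, smul_mul, smul_smul,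
        mul_nonsing_inv _ (isUnit_iff_ne_zero.2 h1), inv_mul_cancel₀ h2, one_smul]
    rw [this, Matrix.smul_apply, smul_eq_mul, mul_inv_cancel_left₀ h2, Matrix.inv_def]
    simp

lemma tendsto_res (hM : M.Admissible) (i j : Fin (s + 1)) :
    Tendsto (fun z => M.res z i j) (cocompact ℂ) (𝓝 0) := by
  have h1 := (res_cocompact hM).2 i j
  have h2 : Tendsto (fun z : ℂ => z⁻¹) (cocompact ℂ) (𝓝 0) := by
    rw [← Metric.cobounded_eq_cocompact]; exact tendsto_inv₀_cobounded
  have h3 := h2.mul h1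
  rw [zero_mul] at h3
  refine h3.congr' ?_
  have := (isCompact_singleton (x := (0:ℂ))).compl_mem_cocompact
  filter_upwards [this] with z hz
  exact inv_mul_cancel_left₀ hz _

/-- The row vector `bᵀ A⁻¹`. -/
def bAinv (M : RKMethod s) : Fin (s + 1) → ℂ := M.bc ᵥ* M.Ac⁻¹

/-- From `z (I - z A)⁻¹ = A⁻¹ ((I - z A)⁻¹ - I)`; the constant is the value of `r` at infinity. -/
lemma r_eq_aux (hM : M.Admissible) {z : ℂ} (hz : (1 - z • M.Ac).det ≠ 0) :
    M.r z = (1 - M.bAinv ⬝ᵥ (fun _ => 1)) + M.bAinv ⬝ᵥ M.resOne z := by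
  have hA := isUnit_iff_ne_zero.2 (det_Ac_ne_zero hM)
  have h1 : z • M.res z = M.Ac⁻¹ * (M.res z - 1) := by
    rw [← smul_Ac_mul_res hz, Matrix.mul_smul, ← mul_assoc, nonsing_inv_mul _ hA, one_mul]
  have h2 : z * (M.bc ⬝ᵥ M.resOne z) = M.bc ⬝ᵥ ((z • M.res z) *ᵥ (fun _ => 1)) := by
    rw [smul_mulVec, dotProduct_smul, smul_eq_mul]; rfl
  rw [r_eq, h2, h1, ← mulVec_mulVec, sub_mulVec, one_mulVec, dotProduct_mulVec, dotProduct_sub]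
  change 1 + (M.bAinv ⬝ᵥ M.resOne z - M.bAinv ⬝ᵥ fun _ => 1) = _
  ring

/-- Since `r` vanishes at infinity, `r(z) = bᵀ A⁻¹ (I - z A)⁻¹ 𝟙`. -/
lemma r_eq_bAinv (hM : M.Admissible) {z : ℂ} (hz : (1 - z • M.Ac).det ≠ 0) :
    M.r z = M.bAinv ⬝ᵥ M.resOne z := by
  have h1 : Tendsto (fun z => M.bAinv ⬝ᵥ M.resOne z) (cocompact ℂ) (𝓝 0) := by
    have : (0:ℂ) = ∑ i, M.bAinv i * ∑ j : Fin (s + 1), 0 := by simp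
    rw [this]
    simp only [dotProduct, resOne, mulVec, mul_one]
    exact tendsto_finsetSum _ fun i _ => (tendsto_finsetSum _ fun j _ =>
      tendsto_res hM i j).const_mul _
  have h2 := (tendsto_const_nhds (x := 1 - M.bAinv ⬝ᵥ (fun _ => (1:ℂ)))).add h1
  have h3 := h2.congr' (by
    filter_upwards [(res_cocompact hM).1] with z hz using (r_eq_aux hM hz).symm)
  have h4 := tendsto_nhds_unique h3 hM.tendsto_zero
  rw [add_zero] at h4
  rw [r_eq_aux hM hz, h4, zero_add]

/-- For a stiffly accurate method the last stage is the step itself, so that `eₙ` has one more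
factor `r(z)`. -/
lemma resOne_last_of_stifflyAccurate (hs : M.StifflyAccurate) {z : ℂ}
    (hz : (1 - z • M.Ac).det ≠ 0) : M.resOne z (Fin.last s) = M.r z := by
  have h1 : M.bc = fun j => M.Ac (Fin.last s) j := by
    ext j; simp [bc, Ac, hs j]
  have h2 : z * (M.bc ⬝ᵥ M.resOne z) = ((z • (M.Ac * M.res z)) *ᵥ (fun _ => 1)) (Fin.last s) := by
    rw [smul_mulVec, Pi.smul_apply, smul_eq_mul, ← mulVec_mulVec, h1]; rfl
  rw [r_eq, h2, smul_Ac_mul_res hz, sub_mulVec, one_mulVec]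
  simp [resOne]

/-- The entries of `(I - z A)⁻¹` are `O(1 / (1 + |z|))` on a closed set without singularities. -/
lemma exists_norm_res_le (hM : M.Admissible) {S : Set ℂ} (hS : IsClosed S)
    (hdet : ∀ z ∈ S, (1 - z • M.Ac).det ≠ 0) :
    ∃ C : ℝ, 0 < C ∧ ∀ z ∈ S, ∀ i j, ‖M.res z i j‖ ≤ C * (1 + ‖z‖)⁻¹ := by
  have key : ∀ i j, ∃ C : ℝ, ∀ z ∈ S, (1 + ‖z‖) * ‖M.res z i j‖ ≤ C := by
    intro i j
    have h1 : Tendsto (fun z => ‖M.res z i j‖ + ‖z * M.res z i j‖) (cocompact ℂ)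
        (𝓝 (‖(0:ℂ)‖ + ‖-(M.Ac⁻¹) i j‖)) :=
      (tendsto_res hM i j).norm.add ((res_cocompact hM).2 i j).norm
    have h2 := h1.eventually_le_const (lt_add_one _)
    obtain ⟨Kc, hKc, hKs⟩ := mem_cocompact.1 h2
    have h3 : IsCompact (Kc ∩ S) := hKc.inter_right hS
    have h4 : ContinuousOn (fun z => (1 + ‖z‖) * ‖M.res z i j‖) (Kc ∩ S) := fun z hz =>
      ((continuousAt_const.add continuousAt_id.norm).mul
        (continuousAt_res (hdet z hz.2) i j).norm).continuousWithinAt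
    obtain ⟨C, hC⟩ := h3.bddAbove_image h4
    refine ⟨max C (‖(0:ℂ)‖ + ‖-(M.Ac⁻¹) i j‖ + 1), fun z hz => ?_⟩
    by_cases hk : z ∈ Kc
    · exact le_max_of_le_left (hC ⟨z, ⟨hk, hz⟩, rfl⟩)
    · refine le_max_of_le_right (le_trans (le_of_eq ?_) (hKs hk))
      rw [norm_mul]; ring
  choose C hC using key
  refine ⟨1 + ∑ i, ∑ j, |C i j|, by positivity, fun z hz i j => ?_⟩
  have hp : 0 < 1 + ‖z‖ := by positivity
  rw [← div_eq_mul_inv, le_div_iff₀ hp, mul_comm]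
  refine (hC i j z hz).trans ((le_abs_self _).trans ?_)
  have h5 := Finset.single_le_sum (f := fun j => |C i j|) (fun j _ => abs_nonneg _)
    (Finset.mem_univ j)
  have h6 := Finset.single_le_sum (f := fun i => ∑ j, |C i j|)
    (fun i _ => Finset.sum_nonneg fun j _ => abs_nonneg _) (Finset.mem_univ i)
  linarith

/-- All vector and scalar functions built from the resolvent are `O(1 / (1 + |z|))` too. -/
lemma exists_norm_le (hM : M.Admissible) {S : Set ℂ} (hS : IsClosed S)
    (hdet : ∀ z ∈ S, (1 - z • M.Ac).det ≠ 0) :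
    ∃ C : ℝ, 1 ≤ C ∧ ∀ z ∈ S, ‖M.r z‖ ≤ C * (1 + ‖z‖)⁻¹ ∧
      ∀ i, ‖M.resOne z i‖ ≤ C * (1 + ‖z‖)⁻¹ ∧ ‖M.bRes z i‖ ≤ C * (1 + ‖z‖)⁻¹ := by
  obtain ⟨C, hC, h⟩ := exists_norm_res_le hM hS hdet
  have hone : ∀ z ∈ S, ∀ i, ‖M.resOne z i‖ ≤ ((s + 1) * C) * (1 + ‖z‖)⁻¹ := by
    intro z hz i
    simp only [resOne, mulVec, dotProduct, mul_one]
    refine (norm_sum_le _ _).trans ((Finset.sum_le_sum fun j _ => h z hz i j).trans ?_)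
    simp; ring_nf; rfl
  have hb : ∀ z ∈ S, ∀ i, ‖M.bRes z i‖ ≤ ((∑ k, ‖M.bc k‖) * C) * (1 + ‖z‖)⁻¹ := by
    intro z hz i
    simp only [bRes, vecMul, dotProduct]
    rw [Finset.sum_mul, Finset.sum_mul]
    refine (norm_sum_le _ _).trans (Finset.sum_le_sum fun j _ => ?_)
    rw [norm_mul, mul_assoc]
    exact mul_le_mul_of_nonneg_left (h z hz j i) (norm_nonneg _)
  have hr : ∀ z ∈ S, ‖M.r z‖ ≤ ((∑ k, ‖M.bAinv k‖) * ((s + 1) * C)) * (1 + ‖z‖)⁻¹ := by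
    intro z hz
    rw [r_eq_bAinv hM (hdet z hz), dotProduct, Finset.sum_mul, Finset.sum_mul]
    refine (norm_sum_le _ _).trans (Finset.sum_le_sum fun j _ => ?_)
    rw [norm_mul, mul_assoc]
    exact mul_le_mul_of_nonneg_left (hone z hz j) (norm_nonneg _)
  have p1 : 0 ≤ (s + 1) * C := by positivity
  have p2 : 0 ≤ (∑ k, ‖M.bc k‖) * C := by positivity
  have p3 : 0 ≤ (∑ k, ‖M.bAinv k‖) * ((s + 1) * C) := by positivity
  refine ⟨1 + (s + 1) * C + (∑ k, ‖M.bc k‖) * C + (∑ k, ‖M.bAinv k‖) * ((s + 1) * C),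
    by linarith, fun z hz => ⟨(hr z hz).trans ?_, fun i => ⟨(hone z hz i).trans ?_,
      (hb z hz i).trans ?_⟩⟩⟩ <;>
  refine mul_le_mul_of_nonneg_right (by linarith) (by positivity)

lemma det_ne_zero_of_re_le (hM : M.Admissible) {ρ : ℝ} (hρ : M.IsStripWidth ρ) {z : ℂ}
    (hz : z.re ≤ ρ) : (1 - z • M.Ac).det ≠ 0 := by
  rcases le_total z.re 0 with h | h
  · exact hM.det_ne_zero z h
  · exact (hρ.2 z h hz).1

lemma isClosed_re_le (ρ : ℝ) : IsClosed {z : ℂ | z.re ≤ ρ} :=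
  isClosed_le Complex.continuous_re continuous_const

/-- The decay of `eₙ(z)` to the left of `Re z = ρ`: all but `loss m` factors `r(z)` are kept, and
the remaining ones, together with the two resolvent factors, supply the algebraic decay. -/
lemma exists_norm_e_le (hM : M.Admissible) {ρ : ℝ} (hρ : M.IsStripWidth ρ) (m : ℕ) :
    ∃ C : ℝ, 0 < C ∧ ∀ z : ℂ, z.re ≤ ρ → ∀ n : ℕ, m ≤ n → 1 ≤ n → ∀ j,
      ‖M.e n z j‖ ≤ C * ‖M.r z‖ ^ (n - M.loss m) * ((1 + ‖z‖)⁻¹) ^ (m + 1) := by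
  obtain ⟨C, hC, h⟩ := exists_norm_le hM (isClosed_re_le ρ)
    (fun z hz => det_ne_zero_of_re_le hM hρ hz)
  refine ⟨C ^ (m + 2), by positivity, fun z hz n hmn hn j => ?_⟩
  have hdet := det_ne_zero_of_re_le hM hρ hz
  obtain ⟨hr, h1⟩ := h z hz
  have hq := (h1 j).2
  have hp := (h1 (Fin.last s)).1
  set y : ℝ := (1 + ‖z‖)⁻¹ with hy
  have hy0 : 0 < y := by positivity
  have hy1 : y ≤ 1 := inv_le_one_of_one_le₀ (by linarith [norm_nonneg z])
  have hC0 : 0 < C := by linarith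
  obtain ⟨k, rfl⟩ : ∃ k, n = k + 1 := ⟨n - 1, by omega⟩
  have he : M.e (k + 1) z j = M.r z ^ k * (M.resOne z (Fin.last s) * M.bRes z j) :=
    E_apply hM hdet (k + 1) (Fin.last s) j
  rw [he, norm_mul, norm_mul, norm_pow]
  set R := ‖M.r z‖
  have hR : 0 ≤ R := norm_nonneg _
  have hCC : C ^ (m + 1) ≤ C ^ (m + 2) := pow_le_pow_right₀ hC (by omega)
  by_cases hs : M.StifflyAccurate
  · have hl : M.loss m = m := by simp [loss, hs]
    rw [hl, resOne_last_of_stifflyAccurate hs hdet]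
    have : R ^ k * (R * ‖M.bRes z j‖) = R ^ (k + 1 - m) * (R ^ m * ‖M.bRes z j‖) := by
      rw [← mul_assoc, ← mul_assoc, ← pow_succ, ← pow_add, Nat.sub_add_cancel hmn]
    change R ^ k * (R * ‖M.bRes z j‖) ≤ _
    rw [this]
    calc R ^ (k + 1 - m) * (R ^ m * ‖M.bRes z j‖)
        ≤ R ^ (k + 1 - m) * ((C * y) ^ m * (C * y)) := by gcongr
      _ = C ^ (m + 1) * R ^ (k + 1 - m) * y ^ (m + 1) := by ring
      _ ≤ _ := by gcongr
  · have hl : M.loss m = max m 1 := by simp [loss, hs]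
    rw [hl]
    rcases Nat.eq_zero_or_pos m with rfl | hm
    · simp only [zero_le, sup_of_le_right, Nat.add_sub_cancel]
      calc R ^ k * (‖M.resOne z (Fin.last s)‖ * ‖M.bRes z j‖)
          ≤ R ^ k * ((C * y) * (C * y)) := by gcongr
        _ = C ^ 2 * R ^ k * y * y := by ring
        _ ≤ C ^ 2 * R ^ k * y * 1 := by gcongr
        _ = _ := by ring
    · rw [max_eq_left hm]
      obtain ⟨m, rfl⟩ : ∃ l, m = l + 1 := ⟨m - 1, by omega⟩
      have : R ^ k = R ^ (k + 1 - (m + 1)) * R ^ m := by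
        rw [← pow_add]; congr 1; omega
      rw [this]
      calc R ^ (k + 1 - (m + 1)) * R ^ m * (‖M.resOne z (Fin.last s)‖ * ‖M.bRes z j‖)
          ≤ R ^ (k + 1 - (m + 1)) * (C * y) ^ m * ((C * y) * (C * y)) := by gcongr
        _ = C ^ (m + 2) * R ^ (k + 1 - (m + 1)) * y ^ (m + 1 + 1) := by ring
        _ ≤ _ := by
          have : C ^ (m + 2) ≤ C ^ (m + 1 + 2) := pow_le_pow_right₀ hC (by omega)
          gcongr

lemma bddBelow_gam (hM : M.Admissible) (ξ : ℝ) :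
    BddBelow {x : ℝ | ∃ z : ℂ, -ξ ≤ z.re ∧ z.re < 0 ∧ M.r z ≠ 0 ∧
      x = Real.log ‖M.r z‖ / z.re} := by
  refine ⟨0, ?_⟩
  rintro x ⟨z, -, h2, h3, rfl⟩
  exact div_nonneg_of_nonpos (Real.log_nonpos (norm_nonneg _) (hM.aStable z h2.le)) h2.le

/-- The defining property of `γ(ξ)`: `|r(z)| ≤ exp (γ Re z)` in the strip `-ξ ≤ Re z ≤ 0`. -/
lemma norm_r_le_exp_gam (hM : M.Admissible) {ξ : ℝ} {z : ℂ} (h1 : -ξ ≤ z.re) (h2 : z.re ≤ 0) :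
    ‖M.r z‖ ≤ Real.exp (M.gam ξ * z.re) := by
  rcases eq_or_lt_of_le h2 with h2 | h2
  · rw [h2, mul_zero, Real.exp_zero]; exact hM.aStable z h2.le
  by_cases h3 : M.r z = 0
  · rw [h3, norm_zero]; positivity
  · have h4 : M.gam ξ ≤ Real.log ‖M.r z‖ / z.re :=
      csInf_le (bddBelow_gam hM ξ) ⟨z, h1, h2, h3, rfl⟩
    rw [← Real.log_le_iff_le_exp (norm_pos_iff.2 h3)]
    rwa [le_div_iff_of_neg h2] at h4

end RKMethod
end

/-! ### Existence of the strip width -/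

noncomputable section

namespace RKMethod

open Matrix

variable {s : ℕ} {M : RKMethod s}

lemma deriv_r_zero (hM : M.Admissible) : deriv M.r 0 = 1 := by
  have hdet : (1 - (0:ℂ) • M.Ac).det ≠ 0 := by simp
  have h1 : DifferentiableAt ℂ (fun z => M.bc ⬝ᵥ M.resOne z) 0 := by
    simp only [dotProduct, resOne, mulVec, mul_one]
    refine DifferentiableAt.fun_sum fun i _ => (differentiableAt_const _).mul ?_
    exact DifferentiableAt.fun_sum fun j _ => differentiableAt_res hdet i j
  have h2 := ((hasDerivAt_id (0:ℂ)).mul h1.hasDerivAt).const_add 1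
  have h3 : M.bc ⬝ᵥ M.resOne 0 = 1 := by
    have : M.resOne 0 = fun _ => 1 := by simp [resOne, res]
    rw [this]
    simp only [dotProduct, bc, mul_one]
    exact_mod_cast hM.order_pos
  have h4 : deriv M.r 0 = 1 * (M.bc ⬝ᵥ M.resOne 0) + id 0 * deriv (fun z => M.bc ⬝ᵥ M.resOne z) 0 :=
    h2.deriv
  rw [h4, h3]; simp

/-- Near the origin, `|r'| ≤ 2` and the bound `|r| ≤ 1` on the imaginary axis give
`|r(z)| ≤ 1 + 2 Re z ≤ |exp (2 z)|`. -/
lemma eventually_norm_r_le_zero (hM : M.Admissible) :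
    ∀ᶠ p : ℝ × ℝ in 𝓝 (0, 0), 0 ≤ p.1 →
      ‖M.r (p.1 + p.2 * Complex.I)‖ ≤ Real.exp (2 * p.1) := by
  have hdet : ∀ᶠ z in 𝓝 (0:ℂ), (1 - z • M.Ac).det ≠ 0 :=
    continuous_det_one_sub.continuousAt.eventually_ne (by simp)
  have hd : ∀ᶠ z in 𝓝 (0:ℂ), DifferentiableAt ℂ M.r z :=
    hdet.mono fun z hz => differentiableAt_r hz
  have han : AnalyticAt ℂ M.r 0 := Complex.analyticAt_iff_eventually_differentiableAt.2 hd
  have h1 : ∀ᶠ z in 𝓝 (0:ℂ), ‖deriv M.r z‖ < 2 := by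
    have := han.deriv.continuousAt.norm
    refine this.eventually_lt_const ?_
    simp [deriv_r_zero hM]
  obtain ⟨ε, hε, hball⟩ := Metric.eventually_nhds_iff_ball.1 (hd.and h1)
  have hc1 : ContinuousAt (fun p : ℝ × ℝ => (p.1 : ℂ) + p.2 * Complex.I) (0, 0) := by fun_prop
  have hc2 : ContinuousAt (fun p : ℝ × ℝ => (p.2 : ℂ) * Complex.I) (0, 0) := by fun_prop
  have e1 := hc1.eventually_mem (Metric.ball_mem_nhds _ hε)
  have e2 := hc2.eventually_mem (Metric.ball_mem_nhds _ hε)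
  filter_upwards [e1, e2] with p hp1 hp2 hp
  have hp1' : (p.1 : ℂ) + p.2 * Complex.I ∈ Metric.ball (0:ℂ) ε := by simpa using hp1
  have hp2' : (p.2 : ℂ) * Complex.I ∈ Metric.ball (0:ℂ) ε := by simpa using hp2
  have h := (convex_ball (0:ℂ) ε).norm_image_sub_le_of_norm_deriv_le
    (fun z hz => (hball z hz).1) (fun z hz => (hball z hz).2.le) hp2' hp1'
  have h3 : ‖(p.1 : ℂ) + p.2 * Complex.I - p.2 * Complex.I‖ = p.1 := by
    rw [add_sub_cancel_right, Complex.norm_real, Real.norm_of_nonneg hp]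
  rw [h3] at h
  have h4 := hM.aStable (p.2 * Complex.I) (by simp)
  have h5 := norm_sub_norm_le (M.r ((p.1 : ℂ) + p.2 * Complex.I)) (M.r (p.2 * Complex.I))
  have h6 := Real.add_one_le_exp (2 * p.1)
  linarith

/-- Strip widths exist.  The bound is local near each point of the imaginary axis: by
`eventually_norm_r_le_zero` at the origin, and because `|r| < 1` elsewhere.  Compactness of a
segment makes it uniform, and far away `|r| ≤ 1`. -/
theorem exists_isStripWidth (hM : M.Admissible) : ∃ ρ : ℝ, M.IsStripWidth ρ := by
  have hfar : ∀ᶠ z in cocompact ℂ, (1 - z • M.Ac).det ≠ 0 ∧ ‖M.r z‖ ≤ 1 := by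
    have h1 := hM.tendsto_zero.norm
    rw [norm_zero] at h1
    exact (res_cocompact hM).1.and (h1.eventually_le_const one_pos)
  rw [← Metric.cobounded_eq_cocompact] at hfar
  obtain ⟨R, -, hR⟩ := (Filter.hasBasis_cobounded_norm (E := ℂ)).eventually_iff.1 hfar
  have hnear : ∀ y ∈ Set.Icc (-R) R, ∀ᶠ p : ℝ × ℝ in 𝓝 (0, y),
      0 ≤ p.1 → (1 - ((p.1 : ℂ) + p.2 * Complex.I) • M.Ac).det ≠ 0 ∧
        ‖M.r (p.1 + p.2 * Complex.I)‖ ≤ Real.exp (2 * p.1) := by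
    intro y _
    have hc : ContinuousAt (fun p : ℝ × ℝ => (p.1 : ℂ) + p.2 * Complex.I) (0, y) := by fun_prop
    have hdy : (1 - (((0:ℝ) : ℂ) + y * Complex.I) • M.Ac).det ≠ 0 :=
      hM.det_ne_zero _ (by simp)
    have hdet : ∀ᶠ p : ℝ × ℝ in 𝓝 (0, y),
        (1 - ((p.1 : ℂ) + p.2 * Complex.I) • M.Ac).det ≠ 0 :=
      (continuous_det_one_sub.continuousAt.comp hc).eventually_ne hdy
    rcases eq_or_ne y 0 with rfl | hy
    · filter_upwards [hdet, eventually_norm_r_le_zero hM] with p h1 h2 h3 using ⟨h1, h2 h3⟩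
    · have hrc : ContinuousAt (fun p : ℝ × ℝ => ‖M.r ((p.1 : ℂ) + p.2 * Complex.I)‖) (0, y) :=
        (ContinuousAt.comp (f := fun p : ℝ × ℝ => (p.1 : ℂ) + p.2 * Complex.I) (x := (0, y))
          (differentiableAt_r hdy).continuousAt hc).norm
      have hlt : ‖M.r (((0:ℝ) : ℂ) + y * Complex.I)‖ < 1 := by
        simpa using hM.norm_lt_one y hy
      filter_upwards [hdet, hrc.eventually_lt_const hlt] with p h1 h2 h3
      exact ⟨h1, h2.le.trans (Real.one_le_exp (by linarith))⟩
  have hunif := isCompact_Icc.eventually_forall_of_forall_eventually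
    (P := fun x y : ℝ => 0 ≤ x → (1 - ((x : ℂ) + y * Complex.I) • M.Ac).det ≠ 0 ∧
        ‖M.r (x + y * Complex.I)‖ ≤ Real.exp (2 * x)) hnear
  obtain ⟨ε, hε, hball⟩ := Metric.eventually_nhds_iff.1 hunif
  refine ⟨ε / 2, by positivity, fun z h0 h1 => ?_⟩
  have hexp : ‖Complex.exp (2 * z)‖ = Real.exp (2 * z.re) := by
    rw [Complex.norm_exp]; simp
  rw [hexp]
  by_cases hy : z.im ∈ Set.Icc (-R) R
  · have := hball (y := z.re) (by rw [Real.dist_eq, sub_zero, abs_of_nonneg h0]; linarith)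
      z.im hy h0
    simpa only [Complex.re_add_im] using this
  · have hzR : R ≤ ‖z‖ := by
      refine le_trans ?_ (Complex.abs_im_le_norm z)
      by_contra hlt
      exact hy (abs_le.1 (not_le.1 hlt).le)
    have := hR hzR
    exact ⟨this.1, this.2.trans (Real.one_le_exp (by linarith))⟩

end RKMethod
end

/-! ### Contours and primitives -/

noncomputable section

/-- A continuously differentiable parametrized arc in the complex plane.  The parametrization is
defined and differentiable on the whole line, so that no one-sided derivatives are needed at the
ends of the parameter interval. -/
structure Arc where
  /-- The parametrization. -/
  toFun : ℝ → ℂ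
  /-- Its derivative. -/
  vel : ℝ → ℂ
  /-- The left end of the parameter interval. -/
  lo : ℝ
  /-- The right end of the parameter interval. -/
  hi : ℝ
  le : lo ≤ hi
  hasDerivAt : ∀ t, HasDerivAt toFun (vel t) t
  continuous_vel : Continuous vel

namespace Arc

/-- The set of points of an arc. -/
def trace (γ : Arc) : Set ℂ := γ.toFun '' Set.Icc γ.lo γ.hi

/-- The initial point. -/
def source (γ : Arc) : ℂ := γ.toFun γ.lo

/-- The end point. -/
def target (γ : Arc) : ℂ := γ.toFun γ.hi

/-- The integral of a function along an arc. -/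
def integral (γ : Arc) (f : ℂ → ℂ) : ℂ := ∫ t in γ.lo..γ.hi, f (γ.toFun t) * γ.vel t

variable (γ : Arc)

lemma continuous_toFun : Continuous γ.toFun :=
  continuous_iff_continuousAt.2 fun t => (γ.hasDerivAt t).continuousAt

lemma isCompact_trace : IsCompact γ.trace := isCompact_Icc.image γ.continuous_toFun

variable {γ}

lemma mem_trace {t : ℝ} (ht : t ∈ Set.Icc γ.lo γ.hi) : γ.toFun t ∈ γ.trace := ⟨t, ht, rfl⟩

lemma continuousOn_comp {f : ℂ → ℂ} (hf : ContinuousOn f γ.trace) :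
    ContinuousOn (fun t => f (γ.toFun t)) (Set.Icc γ.lo γ.hi) :=
  hf.comp γ.continuous_toFun.continuousOn fun _ ht => mem_trace ht

lemma intervalIntegrable {f : ℂ → ℂ} (hf : ContinuousOn f γ.trace) :
    IntervalIntegrable (fun t => f (γ.toFun t) * γ.vel t) MeasureTheory.volume γ.lo γ.hi := by
  apply ContinuousOn.intervalIntegrable
  rw [Set.uIcc_of_le γ.le]
  exact (continuousOn_comp hf).mul γ.continuous_vel.continuousOn

lemma integral_add {f g : ℂ → ℂ} (hf : ContinuousOn f γ.trace) (hg : ContinuousOn g γ.trace) :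
    γ.integral (fun z => f z + g z) = γ.integral f + γ.integral g := by
  unfold integral
  rw [← intervalIntegral.integral_add (intervalIntegrable hf) (intervalIntegrable hg)]
  simp only [add_mul]

lemma integral_const_mul (c : ℂ) (f : ℂ → ℂ) :
    γ.integral (fun z => c * f z) = c * γ.integral f := by
  unfold integral
  rw [← intervalIntegral.integral_const_mul]
  simp only [mul_assoc]

lemma integral_congr {f g : ℂ → ℂ} (h : ∀ z ∈ γ.trace, f z = g z) :
    γ.integral f = γ.integral g := by
  refine intervalIntegral.integral_congr fun t ht => ?_
  rw [Set.uIcc_of_le γ.le] at ht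
  simp only [h _ (mem_trace ht)]

lemma integral_eq_sub {F f : ℂ → ℂ} (hF : ∀ z ∈ γ.trace, HasDerivAt F (f z) z)
    (hf : ContinuousOn f γ.trace) : γ.integral f = F γ.target - F γ.source := by
  refine intervalIntegral.integral_eq_sub_of_hasDerivAt (f := fun t => F (γ.toFun t))
    (fun t ht => ?_) (intervalIntegrable hf)
  rw [Set.uIcc_of_le γ.le] at ht
  exact (hF _ (mem_trace ht)).comp t (γ.hasDerivAt t)

/-- Termwise integration of a series that is dominated by a convergent one along the arc. -/
lemma hasSum_integral {F : ℕ → ℂ → ℂ} {f : ℂ → ℂ} {u : ℕ → ℝ}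
    (hF : ∀ k, ContinuousOn (F k) γ.trace) (hu : Summable u)
    (hb : ∀ k, ∀ z ∈ γ.trace, ‖F k z‖ ≤ u k) (hs : ∀ z ∈ γ.trace, HasSum (fun k => F k z) (f z)) :
    HasSum (fun k => γ.integral (F k)) (γ.integral f) := by
  refine intervalIntegral.hasSum_integral_of_dominated_convergence
    (fun k t => u k * ‖γ.vel t‖) (fun k => ?_) (fun k => ?_) ?_ ?_ ?_
  · exact (intervalIntegrable_iff.1 (intervalIntegrable (hF k))).aestronglyMeasurable
  · refine Eventually.of_forall fun t ht => ?_
    rw [Set.uIoc_of_le γ.le] at ht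
    rw [norm_mul]
    exact mul_le_mul_of_nonneg_right (hb k _ (mem_trace (Set.Ioc_subset_Icc_self ht)))
      (norm_nonneg _)
  · exact Eventually.of_forall fun t _ => hu.mul_right _
  · simp only [tsum_mul_right]
    exact (continuous_const.mul γ.continuous_vel.norm).intervalIntegrable _ _
  · refine Eventually.of_forall fun t ht => ?_
    rw [Set.uIoc_of_le γ.le] at ht
    exact (hs _ (mem_trace (Set.Ioc_subset_Icc_self ht))).mul_right _

/-- The straight segment from `p` to `q`. -/
@[simps] def segment (p q : ℂ) : Arc where
  toFun t := p + t * (q - p)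
  vel _ := q - p
  lo := 0
  hi := 1
  le := zero_le_one
  hasDerivAt t := by
    simpa using ((Complex.ofRealCLM.hasDerivAt (x := t)).mul_const (q - p)).const_add p
  continuous_vel := continuous_const

@[simp] lemma segment_source (p q : ℂ) : (segment p q).source = p := by simp [source]

@[simp] lemma segment_target (p q : ℂ) : (segment p q).target = q := by simp [target]

lemma norm_integral_segment_le {p q : ℂ} {f : ℂ → ℂ} {B : ℝ}
    (hB : ∀ t ∈ Set.Icc (0:ℝ) 1, ‖f (p + t * (q - p))‖ ≤ B) :
    ‖(segment p q).integral f‖ ≤ B * ‖q - p‖ := by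
  have := intervalIntegral.norm_integral_le_of_norm_le_const (a := 0) (b := 1)
    (f := fun t : ℝ => f (p + t * (q - p)) * (q - p)) (C := B * ‖q - p‖) (fun t ht => by
      rw [Set.uIoc_of_le zero_le_one] at ht
      rw [norm_mul]
      exact mul_le_mul_of_nonneg_right (hB t (Set.Ioc_subset_Icc_self ht)) (norm_nonneg _))
  simpa [integral] using this

end Arc

/-- The integral of a function along a finite family of arcs. -/
def chainIntegral {N : ℕ} (C : Fin N → Arc) (f : ℂ → ℂ) : ℂ := ∑ i, (C i).integral f

/-- The set of points of a finite family of arcs. -/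
def chainTrace {N : ℕ} (C : Fin N → Arc) : Set ℂ := ⋃ i, (C i).trace

section Chain

variable {N : ℕ} {C : Fin N → Arc}

lemma trace_subset_chainTrace (i : Fin N) : (C i).trace ⊆ chainTrace C :=
  Set.subset_iUnion (fun i => (C i).trace) i

lemma isCompact_chainTrace : IsCompact (chainTrace C) :=
  isCompact_iUnion fun i => (C i).isCompact_trace

lemma chainIntegral_add {f g : ℂ → ℂ} (hf : ContinuousOn f (chainTrace C))
    (hg : ContinuousOn g (chainTrace C)) :
    chainIntegral C (fun z => f z + g z) = chainIntegral C f + chainIntegral C g := by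
  unfold chainIntegral
  rw [← Finset.sum_add_distrib]
  exact Finset.sum_congr rfl fun i _ => Arc.integral_add (hf.mono (trace_subset_chainTrace i))
    (hg.mono (trace_subset_chainTrace i))

lemma chainIntegral_const_mul (c : ℂ) (f : ℂ → ℂ) :
    chainIntegral C (fun z => c * f z) = c * chainIntegral C f := by
  unfold chainIntegral
  rw [Finset.mul_sum]
  exact Finset.sum_congr rfl fun i _ => Arc.integral_const_mul c f

lemma chainIntegral_congr {f g : ℂ → ℂ} (h : ∀ z ∈ chainTrace C, f z = g z) :
    chainIntegral C f = chainIntegral C g :=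
  Finset.sum_congr rfl fun i _ =>
    Arc.integral_congr fun z hz => h z (trace_subset_chainTrace i hz)

lemma chainIntegral_zero : chainIntegral C (fun _ => 0) = 0 := by
  simp [chainIntegral, Arc.integral]

lemma hasSum_chainIntegral {F : ℕ → ℂ → ℂ} {f : ℂ → ℂ} {u : ℕ → ℝ}
    (hF : ∀ k, ContinuousOn (F k) (chainTrace C)) (hu : Summable u)
    (hb : ∀ k, ∀ z ∈ chainTrace C, ‖F k z‖ ≤ u k)
    (hs : ∀ z ∈ chainTrace C, HasSum (fun k => F k z) (f z)) :
    HasSum (fun k => chainIntegral C (F k)) (chainIntegral C f) :=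
  hasSum_sum fun i _ => Arc.hasSum_integral
    (fun k => (hF k).mono (trace_subset_chainTrace i)) hu
    (fun k z hz => hb k z (trace_subset_chainTrace i hz))
    (fun z hz => hs z (trace_subset_chainTrace i hz))

end Chain

/-- The chain `C` is a closed contour in the domain `U` that winds once, clockwise, around every
point of `V`.  The winding number is expressed by the integral of `1 / (z - w)`, closedness by the
vanishing of the integrals of all functions with a primitive along the contour, and simple
connectedness of `U` by the existence of primitives there. -/
structure Encloses {N : ℕ} (C : Fin N → Arc) (U V : Set ℂ) : Prop where
  isOpen : IsOpen U
  subset : V ⊆ U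
  trace_subset : chainTrace C ⊆ U
  disjoint : ∀ z ∈ chainTrace C, z ∉ V
  closed : ∀ F f : ℂ → ℂ, (∀ z ∈ chainTrace C, HasDerivAt F (f z) z) →
    ContinuousOn f (chainTrace C) → chainIntegral C f = 0
  exists_primitive : ∀ f : ℂ → ℂ, DifferentiableOn ℂ f U → ∃ F : ℂ → ℂ,
    ∀ z ∈ U, HasDerivAt F (f z) z
  winding : ∀ w ∈ V, chainIntegral C (fun z => (z - w)⁻¹) = -(2 * Real.pi * Complex.I)

/-- A holomorphic function on an open set that is star-shaped about `c` has a primitive there,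
namely the integral along the segment from `c`. -/
theorem StarConvex.exists_primitive {U : Set ℂ} (hU : IsOpen U) {c : ℂ}
    (hs : ∀ z ∈ U, ∀ t ∈ Set.Icc (0:ℝ) 1, c + t * (z - c) ∈ U) {f : ℂ → ℂ}
    (hf : DifferentiableOn ℂ f U) : ∃ F : ℂ → ℂ, ∀ z ∈ U, HasDerivAt F (f z) z := by
  have hf' : ContinuousOn (deriv f) U := (hf.deriv hU).continuousOn
  refine ⟨fun z => ∫ t in (0:ℝ)..1, (z - c) * f (c + t * (z - c)), fun z hz => ?_⟩
  set F' : ℂ → ℝ → ℂ := fun w t =>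
    f (c + t * (w - c)) + (w - c) * (deriv f (c + t * (w - c)) * t) with hF'
  -- a ball whose points are joined to `c` inside a fixed compact subset of `U`
  obtain ⟨ε, hε, hball⟩ := Metric.isOpen_iff.1 hU z hz
  have hcb : Metric.closedBall z (ε / 2) ⊆ U :=
    (Metric.closedBall_subset_ball (by linarith)).trans hball
  have hK : IsCompact (Metric.closedBall z (ε / 2) ×ˢ Set.Icc (0:ℝ) 1) :=
    (isCompact_closedBall z (ε / 2)).prod isCompact_Icc
  have hmaps : Set.MapsTo (fun p : ℂ × ℝ => c + p.2 * (p.1 - c))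
      (Metric.closedBall z (ε / 2) ×ˢ Set.Icc (0:ℝ) 1) U := fun p hp =>
    hs p.1 (hcb hp.1) p.2 hp.2
  have hpath : ContinuousOn (fun p : ℂ × ℝ => c + p.2 * (p.1 - c))
      (Metric.closedBall z (ε / 2) ×ˢ Set.Icc (0:ℝ) 1) := by fun_prop
  have hF'cont : ContinuousOn (fun p : ℂ × ℝ => F' p.1 p.2)
      (Metric.closedBall z (ε / 2) ×ˢ Set.Icc (0:ℝ) 1) := by
    refine (hf.continuousOn.comp hpath hmaps).add (ContinuousOn.mul (by fun_prop)
      ((hf'.comp hpath hmaps).mul (by fun_prop)))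
  obtain ⟨B, hB⟩ := hK.exists_bound_of_continuousOn hF'cont
  have hslice : ∀ w ∈ Metric.closedBall z (ε / 2),
      ContinuousOn (fun t : ℝ => (w, t)) (Set.Icc (0:ℝ) 1) := fun w _ => by fun_prop
  have hfc : ∀ w ∈ Metric.closedBall z (ε / 2),
      ContinuousOn (fun t : ℝ => (w - c) * f (c + t * (w - c))) (Set.Icc (0:ℝ) 1) := fun w hw =>
    continuousOn_const.mul ((hf.continuousOn.comp hpath hmaps).comp (hslice w hw)
      fun t ht => ⟨hw, ht⟩)
  have hzmem : z ∈ Metric.closedBall z (ε / 2) := Metric.mem_closedBall_self (by linarith)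
  have hFz : ContinuousOn (F' z) (Set.Icc (0:ℝ) 1) :=
    hF'cont.comp (hslice z hzmem) fun t ht => ⟨hzmem, ht⟩
  have hfd : ∀ w ∈ U, HasDerivAt f (deriv f w) w := fun w hw =>
    (hf.differentiableAt (hU.mem_nhds hw)).hasDerivAt
  have key := (intervalIntegral.hasDerivAt_integral_of_dominated_loc_of_deriv_le
    (μ := MeasureTheory.volume) (a := 0) (b := 1) (bound := fun _ => B)
    (F := fun w t => (w - c) * f (c + t * (w - c))) (F' := F') (x₀ := z)
    (Metric.closedBall_mem_nhds z (half_pos hε)) ?_ ?_ ?_ ?_ ?_ ?_).2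
  · -- `F' z t` is the derivative of `t f (c + t (z - c))` with respect to `t`
    have hint : ∫ t in (0:ℝ)..1, F' z t = f z := by
      have h1 : ∀ t ∈ Set.uIcc (0:ℝ) 1,
          HasDerivAt (fun t : ℝ => (t : ℂ) * f (c + t * (z - c))) (F' z t) t := by
        intro t ht
        rw [Set.uIcc_of_le zero_le_one] at ht
        have hid : HasDerivAt (fun t : ℝ => (t : ℂ)) 1 t := Complex.ofRealCLM.hasDerivAt
        have h2 : HasDerivAt (fun t : ℝ => c + t * (z - c)) (z - c) t := by
          simpa using (hid.mul_const (z - c)).const_add c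
        have h3 := hid.mul ((hfd _ (hs z hz t ht)).comp t h2)
        refine h3.congr_deriv ?_
        simp only [hF', Function.comp_apply]; ring
      rw [intervalIntegral.integral_eq_sub_of_hasDerivAt h1
        (ContinuousOn.intervalIntegrable (by rwa [Set.uIcc_of_le zero_le_one]))]
      simp
    rwa [hint] at key
  · filter_upwards [Metric.closedBall_mem_nhds z (half_pos hε)] with w hw
    refine (intervalIntegrable_iff.1 (ContinuousOn.intervalIntegrable ?_)).aestronglyMeasurable
    rw [Set.uIcc_of_le zero_le_one]; exact hfc w hw
  · refine ContinuousOn.intervalIntegrable ?_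
    rw [Set.uIcc_of_le zero_le_one]; exact hfc z hzmem
  · refine (intervalIntegrable_iff.1 (ContinuousOn.intervalIntegrable ?_)).aestronglyMeasurable
    rw [Set.uIcc_of_le zero_le_one]; exact hFz
  · refine Eventually.of_forall fun t ht w hw => hB (w, t) ⟨hw, ?_⟩
    rw [Set.uIoc_of_le zero_le_one] at ht
    exact Set.Ioc_subset_Icc_self ht
  · exact intervalIntegrable_const
  · refine Eventually.of_forall fun t ht w hw => ?_
    rw [Set.uIoc_of_le zero_le_one] at ht
    have hid : HasDerivAt (fun w : ℂ => w - c) 1 w := (hasDerivAt_id w).sub_const c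
    have h2 : HasDerivAt (fun w : ℂ => c + t * (w - c)) t w := by
      simpa using (hid.const_mul (t : ℂ)).const_add c
    have h3 := hid.mul ((hfd _ (hs w (hcb hw) t (Set.Ioc_subset_Icc_self ht))).comp w h2)
    refine h3.congr_deriv ?_
    simp only [hF', Function.comp_apply]; ring

end

/-! ### Newton interpolation and Cauchy's formula for matrix functions -/

noncomputable section

open Polynomial in
/-- Newton's interpolation polynomial of a holomorphic function at a list of nodes; repeated nodes
are allowed, the divided differences being iterated `dslope`s. -/
def newtonPoly : (ℂ → ℂ) → List ℂ → ℂ[X]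
  | _, [] => 0
  | f, l :: t => C (f l) + (X - C l) * newtonPoly (dslope f l) t

/-- The remainder factor of Newton interpolation, that is, the divided difference of `f` at the
nodes and one further point. -/
def newtonRem : (ℂ → ℂ) → List ℂ → ℂ → ℂ
  | f, [] => f
  | f, l :: t => newtonRem (dslope f l) t

open Polynomial in
/-- The polynomial `∏ (X - l)` over a list of nodes. -/
def nodePoly (L : List ℂ) : ℂ[X] := (L.map fun l => X - C l).prod

section Newton

open Polynomial

lemma eval_newtonPoly_add (f : ℂ → ℂ) (L : List ℂ) (z : ℂ) :
    f z = (newtonPoly f L).eval z + (nodePoly L).eval z * newtonRem f L z := by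
  induction L generalizing f with
  | nil => simp [newtonPoly, newtonRem, nodePoly]
  | cons l t ih =>
    have h1 := sub_smul_dslope f l z
    have h2 := ih (dslope f l)
    simp only [newtonPoly, newtonRem, nodePoly, List.map_cons, List.prod_cons, eval_add, eval_mul,
      eval_sub, eval_X, eval_C, smul_eq_mul] at h1 h2 ⊢
    linear_combination -h1 + (z - l) * h2

lemma differentiableOn_newtonRem {U : Set ℂ} (hU : IsOpen U) {f : ℂ → ℂ} {L : List ℂ}
    (hL : ∀ l ∈ L, l ∈ U) (hf : DifferentiableOn ℂ f U) : DifferentiableOn ℂ (newtonRem f L) U := by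
  induction L generalizing f with
  | nil => exact hf
  | cons l t ih =>
    exact ih (fun k hk => hL k (List.mem_cons_of_mem _ hk))
      ((Complex.differentiableOn_dslope (hU.mem_nhds (hL l List.mem_cons_self))).2 hf)

lemma iteratedDeriv_polynomial_eval (p : ℂ[X]) (j : ℕ) :
    iteratedDeriv j (fun z => p.eval z) = fun z => (derivative^[j] p).eval z := by
  induction j generalizing p with
  | zero => simp
  | succ j ih =>
    have h : deriv (fun z => p.eval z) = fun z => p.derivative.eval z := by
      ext z; simp
    rw [iteratedDeriv_succ', h, ih, Function.iterate_succ_apply]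

/-- Newton's polynomial at the roots of the characteristic polynomial is a Hermite interpolant. -/
lemma isHermiteInterpolant_newtonPoly {n : ℕ} {B : Matrix (Fin n) (Fin n) ℂ} {U : Set ℂ}
    (hU : IsOpen U) {f : ℂ → ℂ} (hf : DifferentiableOn ℂ f U)
    (hB : ∀ l ∈ B.charpoly.roots, l ∈ U) :
    IsHermiteInterpolant f B (newtonPoly f B.charpoly.roots.toList) := by
  intro l j hj
  set L := B.charpoly.roots.toList with hL
  have hmon : B.charpoly.Monic := Matrix.charpoly_monic B
  have hroot : l ∈ B.charpoly.roots := by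
    rw [← Multiset.count_pos, count_roots]; omega
  have hlU : l ∈ U := hB l hroot
  have hnode : nodePoly L = B.charpoly := by
    have h := (IsAlgClosed.splits B.charpoly).eq_prod_roots_of_monic hmon
    conv_rhs => rw [h]
    rw [nodePoly, hL, ← Multiset.prod_coe, ← Multiset.map_coe, Multiset.coe_toList]
  have hrem : AnalyticAt ℂ (newtonRem f L) l :=
    (differentiableOn_newtonRem hU (fun k hk => hB k (by simpa [hL] using hk)) hf).analyticAt
      (hU.mem_nhds hlU)
  have hfan : AnalyticAt ℂ f l := hf.analyticAt (hU.mem_nhds hlU)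
  have hpan : AnalyticAt ℂ (fun z => (newtonPoly f L).eval z) l :=
    (Polynomial.differentiable _).analyticAt l
  obtain ⟨q, hq⟩ := pow_rootMultiplicity_dvd B.charpoly l
  have hqan : AnalyticAt ℂ (fun z => q.eval z) l := (Polynomial.differentiable _).analyticAt l
  have hdiff : AnalyticAt ℂ (fun z => f z - (newtonPoly f L).eval z) l := hfan.sub hpan
  have hord : (B.charpoly.rootMultiplicity l : ℕ∞) ≤
      analyticOrderAt (fun z => f z - (newtonPoly f L).eval z) l := by
    rw [natCast_le_analyticOrderAt hdiff]
    refine ⟨fun z => q.eval z * newtonRem f L z, hqan.mul hrem, Eventually.of_forall fun z => ?_⟩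
    have h1 := eval_newtonPoly_add f L z
    rw [hnode, hq] at h1
    simp only [eval_mul, eval_pow, eval_sub, eval_X, eval_C] at h1
    simp only [smul_eq_mul]
    linear_combination h1
  have h0 := (natCast_le_analyticOrderAt_iff_iteratedDeriv_eq_zero hdiff).1 hord j hj
  have h2 : iteratedDeriv j (fun z => f z - (newtonPoly f L).eval z) l =
      iteratedDeriv j f l - iteratedDeriv j (fun z => (newtonPoly f L).eval z) l :=
    iteratedDeriv_fun_sub hfan.contDiffAt hpan.contDiffAt
  rw [h2, iteratedDeriv_polynomial_eval, sub_eq_zero] at h0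
  exact h0.symm

/-- All Hermite interpolants define the same matrix, by the Cayley-Hamilton theorem. -/
lemma IsHermiteInterpolant.aeval_eq {n : ℕ} {B : Matrix (Fin n) (Fin n) ℂ} {f : ℂ → ℂ}
    {p q : ℂ[X]} (hp : IsHermiteInterpolant f B p) (hq : IsHermiteInterpolant f B q) :
    aeval B p = aeval B q := by
  rw [← sub_eq_zero, ← map_sub]
  by_cases h0 : p - q = 0
  · rw [h0, map_zero]
  have hdvd : B.charpoly ∣ p - q := by
    refine (IsAlgClosed.splits B.charpoly).dvd_of_roots_le_roots
      (Matrix.charpoly_monic B).ne_zero ?_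
    rw [Multiset.le_iff_count]
    intro l
    rw [count_roots, count_roots]
    rcases Nat.eq_zero_or_pos (B.charpoly.rootMultiplicity l) with h | h
    · omega
    have := lt_rootMultiplicity_of_isRoot_iterate_derivative (t := l)
      (n := B.charpoly.rootMultiplicity l - 1) h0 (fun j hj => by
        rw [IsRoot, iterate_derivative_sub, eval_sub, hp l j (by omega), hq l j (by omega),
          sub_self])
    omega
  obtain ⟨c, hc⟩ := hdvd
  rw [hc, map_mul, Matrix.aeval_self_charpoly, zero_mul]

lemma matrixFunction_eq_aeval_newtonPoly {n : ℕ} {B : Matrix (Fin n) (Fin n) ℂ} {U : Set ℂ}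
    (hU : IsOpen U) {f : ℂ → ℂ} (hf : DifferentiableOn ℂ f U)
    (hB : ∀ l ∈ B.charpoly.roots, l ∈ U) :
    matrixFunction f B = aeval B (newtonPoly f B.charpoly.roots.toList) := by
  have h := isHermiteInterpolant_newtonPoly hU hf hB
  have hex : ∃ p : ℂ[X], IsHermiteInterpolant f B p := ⟨_, h⟩
  rw [matrixFunction, dif_pos hex]
  exact (Classical.choose_spec hex).aeval_eq h

end Newton

namespace Encloses

variable {N : ℕ} {C : Fin N → Arc} {U V : Set ℂ}

lemma ne_of_mem (h : Encloses C U V) {z w : ℂ} (hz : z ∈ chainTrace C) (hw : w ∈ V) :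
    z - w ≠ 0 := by
  intro h0
  exact h.disjoint z hz (by rwa [sub_eq_zero.1 h0])

lemma integral_eq_zero (h : Encloses C U V) {f : ℂ → ℂ} (hf : DifferentiableOn ℂ f U) :
    chainIntegral C f = 0 := by
  obtain ⟨F, hF⟩ := h.exists_primitive f hf
  exact h.closed F f (fun z hz => hF z (h.trace_subset hz)) (hf.continuousOn.mono h.trace_subset)

lemma integral_inv_pow (h : Encloses C U V) {w : ℂ} (hw : w ∈ V) (k : ℕ) :
    chainIntegral C (fun z => ((z - w) ^ (k + 2))⁻¹) = 0 := by
  have hk : ((k : ℂ) + 1) ≠ 0 := by exact_mod_cast Nat.succ_ne_zero k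
  refine h.closed (fun z => -((k : ℂ) + 1)⁻¹ * ((z - w) ^ (k + 1))⁻¹) _ (fun z hz => ?_) ?_
  · have hne := h.ne_of_mem hz hw
    have h1 := (((hasDerivAt_id z).sub_const w).pow (k + 1)).inv (pow_ne_zero _ hne)
    refine (h1.const_mul (-((k : ℂ) + 1)⁻¹)).congr_deriv ?_
    simp only [id, Nat.add_sub_cancel, Pi.pow_apply]
    push_cast
    field_simp
    ring
  · intro z hz
    have hne := h.ne_of_mem hz hw
    exact ContinuousAt.continuousWithinAt (ContinuousAt.inv₀ (by fun_prop) (pow_ne_zero _ hne))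

lemma prod_ne_zero (h : Encloses C U V) {z : ℂ} (hz : z ∈ chainTrace C) {Q : Multiset ℂ}
    (hQ : ∀ q ∈ Q, q ∈ V) : (Q.map fun q => z - q).prod ≠ 0 := by
  refine Multiset.prod_ne_zero fun h0 => ?_
  obtain ⟨q, hq, h1⟩ := Multiset.mem_map.1 h0
  exact h.ne_of_mem hz (hQ q hq) h1

lemma continuousOn_inv_prod (h : Encloses C U V) {Q : Multiset ℂ} (hQ : ∀ q ∈ Q, q ∈ V) :
    ContinuousOn (fun z => ((Q.map fun q => z - q).prod)⁻¹) (chainTrace C) := by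
  refine ContinuousOn.inv₀ ?_ fun z hz => h.prod_ne_zero hz hQ
  exact (continuous_multiset_prod Q fun q _ => by fun_prop).continuousOn

/-- The reciprocal of a polynomial of degree at least two with all its roots inside the contour has
integral zero: split off partial fractions while there are two different roots. -/
lemma integral_inv_prod (h : Encloses C U V) (k : ℕ) {Q : Multiset ℂ} (hk : Q.card = k + 2)
    (hQ : ∀ q ∈ Q, q ∈ V) : chainIntegral C (fun z => ((Q.map fun q => z - q).prod)⁻¹) = 0 := by
  induction k generalizing Q with
  | zero =>
    obtain ⟨a, b, rfl⟩ := Multiset.card_eq_two.1 hk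
    have ha : a ∈ V := hQ a (by simp)
    have hb : b ∈ V := hQ b (by simp)
    by_cases hab : a = b
    · subst hab
      rw [← h.integral_inv_pow ha 0]
      refine chainIntegral_congr fun z _ => ?_
      simp [pow_two]
    · have hab' : a - b ≠ 0 := sub_ne_zero.2 hab
      have hca : ContinuousOn (fun z => (z - a)⁻¹) (chainTrace C) :=
        ContinuousOn.inv₀ (by fun_prop) fun z hz => h.ne_of_mem hz ha
      have hcb : ContinuousOn (fun z => (z - b)⁻¹) (chainTrace C) :=
        ContinuousOn.inv₀ (by fun_prop) fun z hz => h.ne_of_mem hz hb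
      have : chainIntegral C (fun z => (((({a, b} : Multiset ℂ)).map fun q => z - q).prod)⁻¹) =
          chainIntegral C (fun z => (a - b)⁻¹ * (z - a)⁻¹ + (-(a - b)⁻¹) * (z - b)⁻¹) := by
        refine chainIntegral_congr fun z hz => ?_
        have h1 := h.ne_of_mem hz ha
        have h2 := h.ne_of_mem hz hb
        simp only [Multiset.insert_eq_cons, Multiset.map_cons, Multiset.map_singleton,
          Multiset.prod_cons, Multiset.prod_singleton]
        field_simp
        ring
      rw [this, chainIntegral_add (continuousOn_const.fun_mul hca) (continuousOn_const.fun_mul hcb),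
        chainIntegral_const_mul, chainIntegral_const_mul, h.winding a ha, h.winding b hb]
      ring
  | succ k ih =>
    obtain ⟨a, T, rfl⟩ : ∃ a T, Q = a ::ₘ T := by
      obtain ⟨a, ha⟩ := Multiset.card_pos_iff_exists_mem.1 (by omega : 0 < Q.card)
      obtain ⟨T, hT⟩ := Multiset.exists_cons_of_mem ha
      exact ⟨a, T, hT⟩
    have ha : a ∈ V := hQ a (by simp)
    by_cases hall : ∀ b ∈ T, b = a
    · have hT := Multiset.eq_replicate_of_mem hall
      have hcard : T.card = k + 2 := by simpa using hk
      rw [← h.integral_inv_pow ha (k + 1)]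
      refine chainIntegral_congr fun z _ => ?_
      rw [hT, hcard]
      simp only [Multiset.map_cons, Multiset.map_replicate, Multiset.prod_cons,
        Multiset.prod_replicate]
      congr 1; ring
    · push Not at hall
      obtain ⟨b, hbT, hba⟩ := hall
      obtain ⟨S, rfl⟩ := Multiset.exists_cons_of_mem hbT
      have hb : b ∈ V := hQ b (by simp)
      have hab' : a - b ≠ 0 := sub_ne_zero.2 hba.symm
      have hS : ∀ q ∈ S, q ∈ V := fun q hq => hQ q (by simp [hq])
      have haS : ∀ q ∈ a ::ₘ S, q ∈ V := by
        intro q hq; rcases Multiset.mem_cons.1 hq with rfl | hq; exacts [ha, hS q hq]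
      have hbS : ∀ q ∈ b ::ₘ S, q ∈ V := by
        intro q hq; rcases Multiset.mem_cons.1 hq with rfl | hq; exacts [hb, hS q hq]
      have : chainIntegral C (fun z => (((a ::ₘ b ::ₘ S).map fun q => z - q).prod)⁻¹) =
          chainIntegral C (fun z => (a - b)⁻¹ * (((a ::ₘ S).map fun q => z - q).prod)⁻¹ +
            (-(a - b)⁻¹) * (((b ::ₘ S).map fun q => z - q).prod)⁻¹) := by
        refine chainIntegral_congr fun z hz => ?_
        have h1 := h.ne_of_mem hz ha
        have h2 := h.ne_of_mem hz hb
        have h3 := h.prod_ne_zero hz hS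
        simp only [Multiset.map_cons, Multiset.prod_cons]
        field_simp
        ring
      rw [this, chainIntegral_add (continuousOn_const.fun_mul (h.continuousOn_inv_prod haS))
        (continuousOn_const.fun_mul (h.continuousOn_inv_prod hbS)),
        chainIntegral_const_mul, chainIntegral_const_mul,
        ih (by simpa using hk) haS, ih (by simpa using hk) hbS]
      ring

section Resolvent

open Polynomial Matrix

variable {n : ℕ} {B : Matrix (Fin n) (Fin n) ℂ}

lemma continuousOn_resolvent
    (hB : ∀ z ∈ chainTrace C, (z • (1 : Matrix (Fin n) (Fin n) ℂ) - B).det ≠ 0)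
    (P : Matrix (Fin n) (Fin n) ℂ) (i j : Fin n) :
    ContinuousOn (fun z : ℂ => ((z • (1 : Matrix (Fin n) (Fin n) ℂ) - B)⁻¹ * P) i j)
      (chainTrace C) := by
  have hc : Continuous (fun z : ℂ => z • (1 : Matrix (Fin n) (Fin n) ℂ) - B) := by fun_prop
  have h1 : ∀ k, ContinuousOn (fun z : ℂ => (z • (1 : Matrix (Fin n) (Fin n) ℂ) - B)⁻¹ i k)
      (chainTrace C) := by
    intro k
    have : (fun z : ℂ => (z • (1 : Matrix (Fin n) (Fin n) ℂ) - B)⁻¹ i k) = fun z =>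
        ((z • (1 : Matrix (Fin n) (Fin n) ℂ) - B).det)⁻¹ *
          (z • (1 : Matrix (Fin n) (Fin n) ℂ) - B).adjugate i k := by
      ext z; simp [Matrix.inv_def]
    rw [this]
    exact (hc.matrix_det.continuousOn.inv₀ hB).mul
      (hc.matrix_adjugate.matrix_elem i k).continuousOn
  simp only [mul_apply]
  exact continuousOn_finsetSum _ fun k _ => (h1 k).mul continuousOn_const

/-- One step of Newton interpolation for the resolvent. -/
lemma sub_smul_resolvent_mul {z : ℂ} (hz : (z • (1 : Matrix (Fin n) (Fin n) ℂ) - B).det ≠ 0)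
    (l : ℂ) (P : Matrix (Fin n) (Fin n) ℂ) :
    (z - l) • ((z • (1 : Matrix (Fin n) (Fin n) ℂ) - B)⁻¹ * P) =
      P + (z • (1 : Matrix (Fin n) (Fin n) ℂ) - B)⁻¹ * ((aeval B (X - Polynomial.C l)) * P) := by
  have h1 : aeval B (X - Polynomial.C l) = (z - l) • (1 : Matrix (Fin n) (Fin n) ℂ) -
      (z • (1 : Matrix (Fin n) (Fin n) ℂ) - B) := by
    rw [map_sub, aeval_X, aeval_C, Algebra.algebraMap_eq_smul_one, sub_smul]
    abel
  have h2 : (z • (1 : Matrix (Fin n) (Fin n) ℂ) - B)⁻¹ *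
      ((z • (1 : Matrix (Fin n) (Fin n) ℂ) - B) * P) = P := by
    rw [← Matrix.mul_assoc, nonsing_inv_mul _ (isUnit_iff_ne_zero.2 hz), Matrix.one_mul]
  rw [h1, Matrix.sub_mul, Matrix.mul_sub, h2, Matrix.smul_mul, Matrix.one_mul, Matrix.mul_smul]
  abel

lemma aeval_nodePoly_cons (l : ℂ) (t : List ℂ) (P : Matrix (Fin n) (Fin n) ℂ) :
    aeval B (nodePoly (l :: t)) * P =
      aeval B (nodePoly t) * (aeval B (X - Polynomial.C l) * P) := by
  rw [nodePoly, List.map_cons, List.prod_cons, mul_comm, map_mul, Matrix.mul_assoc]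
  rfl

/-- The integral of `(z - B)⁻¹ P / ∏ (z - q)` vanishes, by induction on the number of factors of a
polynomial that annihilates `P`: each step trades one of them for a factor of the denominator. -/
lemma integral_inv_prod_mul_resolvent (h : Encloses C U V)
    (hB : ∀ z ∈ chainTrace C, (z • (1 : Matrix (Fin n) (Fin n) ℂ) - B).det ≠ 0)
    {L : List ℂ} (hL : ∀ l ∈ L, l ∈ V) {Q : Multiset ℂ} (hQ0 : 0 < Q.card) (hQ : ∀ q ∈ Q, q ∈ V)
    {P : Matrix (Fin n) (Fin n) ℂ} (hP : aeval B (nodePoly L) * P = 0) (i j : Fin n) :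
    chainIntegral C (fun z => ((Q.map fun q => z - q).prod)⁻¹ *
      ((z • (1 : Matrix (Fin n) (Fin n) ℂ) - B)⁻¹ * P) i j) = 0 := by
  induction L generalizing Q P with
  | nil =>
    have : P = 0 := by simpa [nodePoly] using hP
    subst this
    simp [chainIntegral_zero]
  | cons l t ih =>
    have hl : l ∈ V := hL l List.mem_cons_self
    have hlQ : ∀ q ∈ l ::ₘ Q, q ∈ V := by
      intro q hq; rcases Multiset.mem_cons.1 hq with rfl | hq; exacts [hl, hQ q hq]
    rw [aeval_nodePoly_cons] at hP
    have h1 := ih (fun k hk => hL k (List.mem_cons_of_mem _ hk))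
      (Q := l ::ₘ Q) (by simp) hlQ hP
    have h2 : chainIntegral C (fun z => (((l ::ₘ Q).map fun q => z - q).prod)⁻¹) = 0 :=
      h.integral_inv_prod (Q.card - 1) (by simp; omega) hlQ
    have hc := h.continuousOn_inv_prod hlQ
    have h3 : chainIntegral C (fun z => ((Q.map fun q => z - q).prod)⁻¹ *
        ((z • (1 : Matrix (Fin n) (Fin n) ℂ) - B)⁻¹ * P) i j) =
      chainIntegral C (fun z => P i j * (((l ::ₘ Q).map fun q => z - q).prod)⁻¹ +
        (((l ::ₘ Q).map fun q => z - q).prod)⁻¹ *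
          ((z • (1 : Matrix (Fin n) (Fin n) ℂ) - B)⁻¹ *
            (aeval B (X - Polynomial.C l) * P)) i j) := by
      refine chainIntegral_congr fun z hz => ?_
      have h4 := congrFun (congrFun (sub_smul_resolvent_mul (hB z hz) l P) i) j
      rw [Matrix.smul_apply, Matrix.add_apply, smul_eq_mul] at h4
      have h5 := h.ne_of_mem hz hl
      have h6 := h.prod_ne_zero hz hQ
      simp only [Multiset.map_cons, Multiset.prod_cons]
      field_simp
      linear_combination h4
    rw [h3, chainIntegral_add (continuousOn_const.fun_mul hc)
      (hc.fun_mul (continuousOn_resolvent hB _ i j)), chainIntegral_const_mul, h1, h2]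
    ring

lemma integral_resolvent (h : Encloses C U V)
    (hB : ∀ z ∈ chainTrace C, (z • (1 : Matrix (Fin n) (Fin n) ℂ) - B).det ≠ 0)
    {L : List ℂ} (hL : ∀ l ∈ L, l ∈ V)
    {P : Matrix (Fin n) (Fin n) ℂ} (hP : aeval B (nodePoly L) * P = 0) (i j : Fin n) :
    chainIntegral C (fun z => ((z • (1 : Matrix (Fin n) (Fin n) ℂ) - B)⁻¹ * P) i j) =
      -(2 * Real.pi * Complex.I) * P i j := by
  cases L with
  | nil =>
    have : P = 0 := by simpa [nodePoly] using hP
    subst this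
    simp [chainIntegral_zero]
  | cons l t =>
    have hl : l ∈ V := hL l List.mem_cons_self
    have hlQ : ∀ q ∈ ({l} : Multiset ℂ), q ∈ V := by simpa using hl
    rw [aeval_nodePoly_cons] at hP
    have h1 := h.integral_inv_prod_mul_resolvent hB (fun k hk => hL k (List.mem_cons_of_mem _ hk))
      (Q := {l}) (by simp) hlQ hP i j
    simp only [Multiset.map_singleton, Multiset.prod_singleton] at h1
    have hc : ContinuousOn (fun z => (z - l)⁻¹) (chainTrace C) :=
      ContinuousOn.inv₀ (by fun_prop) fun z hz => h.ne_of_mem hz hl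
    have h3 : chainIntegral C (fun z => ((z • (1 : Matrix (Fin n) (Fin n) ℂ) - B)⁻¹ * P) i j) =
      chainIntegral C (fun z => P i j * (z - l)⁻¹ + (z - l)⁻¹ *
          ((z • (1 : Matrix (Fin n) (Fin n) ℂ) - B)⁻¹ *
            (aeval B (X - Polynomial.C l) * P)) i j) := by
      refine chainIntegral_congr fun z hz => ?_
      have h4 := congrFun (congrFun (sub_smul_resolvent_mul (hB z hz) l P) i) j
      rw [Matrix.smul_apply, Matrix.add_apply, smul_eq_mul] at h4
      have h5 := h.ne_of_mem hz hl
      field_simp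
      linear_combination h4
    rw [h3, chainIntegral_add (continuousOn_const.fun_mul hc)
      (hc.fun_mul (continuousOn_resolvent hB _ i j)), chainIntegral_const_mul, h1, h.winding l hl]
    ring

/-- Newton interpolation under the integral sign.  The factor `P`, annihilated by the node
polynomial at `B`, is what makes the induction on the nodes work. -/
lemma integral_mul_resolvent_newtonPoly (h : Encloses C U V)
    (hB : ∀ z ∈ chainTrace C, (z • (1 : Matrix (Fin n) (Fin n) ℂ) - B).det ≠ 0)
    {L : List ℂ} (hL : ∀ l ∈ L, l ∈ V) {f : ℂ → ℂ} (hf : DifferentiableOn ℂ f U)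
    {P : Matrix (Fin n) (Fin n) ℂ} (hP : aeval B (nodePoly L) * P = 0) (i j : Fin n) :
    chainIntegral C (fun z => f z * ((z • (1 : Matrix (Fin n) (Fin n) ℂ) - B)⁻¹ * P) i j) =
      -(2 * Real.pi * Complex.I) * (aeval B (newtonPoly f L) * P) i j := by
  induction L generalizing f P with
  | nil =>
    have : P = 0 := by simpa [nodePoly] using hP
    subst this
    simp [chainIntegral_zero]
  | cons l t ih =>
    have hl : l ∈ V := hL l List.mem_cons_self
    have hP' := hP
    rw [aeval_nodePoly_cons] at hP'
    have hg : DifferentiableOn ℂ (dslope f l) U :=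
      (Complex.differentiableOn_dslope (h.isOpen.mem_nhds (h.subset hl))).2 hf
    have hgc := hg.continuousOn.mono h.trace_subset
    have h1 := ih (fun k hk => hL k (List.mem_cons_of_mem _ hk)) hg hP'
    have h2 := h.integral_resolvent hB hL hP i j
    have hR := continuousOn_resolvent hB P i j
    have h3 : chainIntegral C (fun z =>
        f z * ((z • (1 : Matrix (Fin n) (Fin n) ℂ) - B)⁻¹ * P) i j) =
      chainIntegral C (fun z =>
        (f l * ((z • (1 : Matrix (Fin n) (Fin n) ℂ) - B)⁻¹ * P) i j + P i j * dslope f l z) +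
        dslope f l z *
          ((z • (1 : Matrix (Fin n) (Fin n) ℂ) - B)⁻¹ *
            (aeval B (X - Polynomial.C l) * P)) i j) := by
      refine chainIntegral_congr fun z hz => ?_
      have h4 := congrFun (congrFun (sub_smul_resolvent_mul (hB z hz) l P) i) j
      rw [Matrix.smul_apply, Matrix.add_apply, smul_eq_mul] at h4
      have h5 := sub_smul_dslope f l z
      rw [smul_eq_mul] at h5
      linear_combination dslope f l z * h4 -
        ((z • (1 : Matrix (Fin n) (Fin n) ℂ) - B)⁻¹ * P) i j * h5
    rw [h3, chainIntegral_add
      ((continuousOn_const.fun_mul hR).fun_add (continuousOn_const.fun_mul hgc))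
      (hgc.fun_mul (continuousOn_resolvent hB _ i j)),
      chainIntegral_add (continuousOn_const.fun_mul hR) (continuousOn_const.fun_mul hgc),
      chainIntegral_const_mul, chainIntegral_const_mul, h1, h2, h.integral_eq_zero hg]
    have h6 : aeval B (newtonPoly f (l :: t)) * P =
        f l • P + aeval B (newtonPoly (dslope f l) t) * (aeval B (X - Polynomial.C l) * P) := by
      rw [newtonPoly, map_add, aeval_C, Algebra.algebraMap_eq_smul_one, add_mul, smul_mul,
        one_mul, mul_comm (X - Polynomial.C l), map_mul, Matrix.mul_assoc]
    rw [h6, Matrix.add_apply, Matrix.smul_apply, smul_eq_mul]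
    ring

/-- **Cauchy's integral formula for matrix functions**: a contour enclosing the spectrum of `B`
represents the primary matrix function `f(B)`. -/
theorem integral_mul_resolvent (h : Encloses C U V) (hB : ∀ l ∈ B.charpoly.roots, l ∈ V)
    {f : ℂ → ℂ} (hf : DifferentiableOn ℂ f U) (i j : Fin n) :
    chainIntegral C (fun z => f z * (z • (1 : Matrix (Fin n) (Fin n) ℂ) - B)⁻¹ i j) =
      -(2 * Real.pi * Complex.I) * matrixFunction f B i j := by
  have hmon : B.charpoly.Monic := Matrix.charpoly_monic B
  have hdet : ∀ z ∈ chainTrace C, (z • (1 : Matrix (Fin n) (Fin n) ℂ) - B).det ≠ 0 := by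
    intro z hz h0
    refine h.disjoint z hz (hB z ?_)
    rw [mem_roots hmon.ne_zero, IsRoot, eval_charpoly]
    rwa [Matrix.scalar_apply, ← Matrix.smul_one_eq_diagonal]
  have hP : aeval B (nodePoly B.charpoly.roots.toList) * 1 = 0 := by
    have hs := (IsAlgClosed.splits B.charpoly).eq_prod_roots_of_monic hmon
    have hnode : nodePoly B.charpoly.roots.toList = B.charpoly := by
      conv_rhs => rw [hs]
      rw [nodePoly, ← Multiset.prod_coe, ← Multiset.map_coe, Multiset.coe_toList]
    rw [hnode, aeval_self_charpoly, zero_mul]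
  have := h.integral_mul_resolvent_newtonPoly hdet (fun l hl => hB l (by simpa using hl)) hf hP i j
  rw [matrixFunction_eq_aeval_newtonPoly h.isOpen hf fun l hl => h.subset (hB l hl)]
  simpa using this

end Resolvent

end Encloses

end

/-! ### The kernel of the trapezoidal rule -/

noncomputable section

section Trapezoid

open Complex MeasureTheory

/-- The kernel `1 / (exp (2 π i z / τ) - 1)`, with simple poles of residue `τ / (2 π i)` at the
nodes `k τ`. -/
def trapKernel (τ : ℝ) (z : ℂ) : ℂ := (exp (2 * Real.pi * I * z / τ) - 1)⁻¹

variable {τ : ℝ}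

lemma exp_node_eq_one_iff (hτ : 0 < τ) (z : ℂ) :
    exp (2 * Real.pi * I * z / τ) = 1 ↔ ∃ k : ℤ, z = k * τ := by
  have hτ' : (τ : ℂ) ≠ 0 := ofReal_ne_zero.2 hτ.ne'
  rw [exp_eq_one_iff]
  refine exists_congr fun k => ?_
  have h2 := two_pi_I_ne_zero
  rw [div_eq_iff hτ']
  constructor
  · intro h
    apply mul_left_cancel₀ h2
    linear_combination h
  · rintro rfl; ring

lemma exp_add_period (hτ : 0 < τ) (z : ℂ) :
    exp (2 * Real.pi * I * (z + τ) / τ) = exp (2 * Real.pi * I * z / τ) := by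
  have hτ' : (τ : ℂ) ≠ 0 := ofReal_ne_zero.2 hτ.ne'
  have : 2 * Real.pi * I * (z + τ) / τ = 2 * Real.pi * I * z / τ + 2 * Real.pi * I := by
    field_simp
  rw [this, exp_periodic]

lemma norm_exp_node (x y : ℝ) :
    ‖exp (2 * Real.pi * I * (x + y * I) / τ)‖ = Real.exp (-(2 * Real.pi * y / τ)) := by
  rw [norm_exp]
  congr 1
  have : 2 * Real.pi * I * (x + y * I) / τ =
      ((-(2 * Real.pi * y / τ) : ℝ) : ℂ) + ((2 * Real.pi * x / τ : ℝ) : ℂ) * I := by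
    push_cast
    linear_combination (2 * Real.pi * y / τ : ℂ) * I_sq
  rw [this]; simp

lemma hasDerivAt_exp_node (z : ℂ) : HasDerivAt (fun z : ℂ => exp (2 * Real.pi * I * z / τ))
    (2 * Real.pi * I / τ * exp (2 * Real.pi * I * z / τ)) z := by
  have h1 : HasDerivAt (fun z : ℂ => 2 * Real.pi * I * z / τ) (2 * Real.pi * I / τ) z := by
    simpa using ((hasDerivAt_id z).const_mul (2 * Real.pi * I)).div_const (τ : ℂ)
  exact h1.cexp.congr_deriv (mul_comm _ _)

lemma continuousAt_trapKernel {z : ℂ} (hz : exp (2 * Real.pi * I * z / τ) ≠ 1) :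
    ContinuousAt (trapKernel τ) z :=
  ContinuousAt.inv₀ ((hasDerivAt_exp_node z).continuousAt.sub continuousAt_const)
    (sub_ne_zero.2 hz)

/-- With `E = exp (± 2 π i z / τ)` of modulus less than one, `1 / (E⁻¹ - 1) = E / (1 - E)` has the
primitive `log (1 - E)`, up to a factor.  It is periodic, so that the integral over a period
vanishes. -/
lemma integral_period_eq_zero (hτ : 0 < τ) {y : ℝ} (c : ℝ) (s : ℂ)
    (hs : s = 1 ∨ s = -1) (hsy : ∀ x : ℝ, ‖exp (s * (2 * Real.pi * I * (x + y * I) / τ))‖ < 1) :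
    ∫ x in (c - τ / 2)..(c + τ / 2), (exp (-(s * (2 * Real.pi * I * (x + y * I) / τ))) - 1)⁻¹ =
      0 := by
  have hτ' : (τ : ℂ) ≠ 0 := ofReal_ne_zero.2 hτ.ne'
  have hs0 : s ≠ 0 := by rcases hs with rfl | rfl <;> simp
  have hk : s * (2 * Real.pi * I / τ) ≠ 0 :=
    mul_ne_zero hs0 (div_ne_zero two_pi_I_ne_zero hτ')
  have hne : ∀ x : ℝ, 1 - exp (s * (2 * Real.pi * I * (x + y * I) / τ)) ≠ 0 := by
    intro x h
    have := hsy x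
    rw [← sub_eq_zero.1 h] at this
    simp at this
  have hinv : ∀ x : ℝ, (exp (-(s * (2 * Real.pi * I * (x + y * I) / τ))) - 1)⁻¹ =
      exp (s * (2 * Real.pi * I * (x + y * I) / τ)) *
        (1 - exp (s * (2 * Real.pi * I * (x + y * I) / τ)))⁻¹ := by
    intro x
    have h1 := exp_ne_zero (s * (2 * Real.pi * I * (x + y * I) / τ))
    rw [exp_neg]
    have h2 : (exp (s * (2 * Real.pi * I * (x + y * I) / τ)))⁻¹ - 1 =
      (1 - exp (s * (2 * Real.pi * I * (x + y * I) / τ))) *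
        (exp (s * (2 * Real.pi * I * (x + y * I) / τ)))⁻¹ := by
      rw [sub_mul, mul_inv_cancel₀ h1, one_mul]
    rw [h2, mul_inv, inv_inv, mul_comm]
  have hlin : ∀ x : ℝ, HasDerivAt (fun x : ℝ => s * (2 * Real.pi * I * (x + y * I) / τ))
      (s * (2 * Real.pi * I / τ)) x := by
    intro x
    have h0 : HasDerivAt (fun x : ℝ => (x : ℂ)) 1 x := ofRealCLM.hasDerivAt
    simpa using
      ((((h0.add_const (y * I)).const_mul (2 * Real.pi * I)).div_const (τ : ℂ)).const_mul s)
  have hderiv : ∀ x ∈ Set.uIcc (c - τ / 2) (c + τ / 2), HasDerivAt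
      (fun x : ℝ => -(s * (2 * Real.pi * I / τ))⁻¹ *
        log (1 - exp (s * (2 * Real.pi * I * (x + y * I) / τ))))
      ((exp (-(s * (2 * Real.pi * I * (x + y * I) / τ))) - 1)⁻¹) x := by
    intro x _
    have hslit : 1 - exp (s * (2 * Real.pi * I * (x + y * I) / τ)) ∈ slitPlane := by
      left
      have h1 := (abs_le.1 (abs_re_le_norm (exp (s * (2 * Real.pi * I * (x + y * I) / τ))))).2
      have h2 := hsy x
      simp only [sub_re, one_re]
      linarith
    have h1 := ((((hlin x).cexp.const_sub 1).clog_real hslit).const_mul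
      (-(s * (2 * Real.pi * I / τ))⁻¹))
    refine h1.congr_deriv ?_
    rw [hinv]
    have h3 := hne x
    field_simp
  have hcont : Continuous (fun x : ℝ =>
      (exp (-(s * (2 * Real.pi * I * (x + y * I) / τ))) - 1)⁻¹) := by
    simp only [hinv]
    exact (by fun_prop : Continuous fun x : ℝ => exp (s * (2 * Real.pi * I * (x + y * I) / τ))).mul
      (Continuous.inv₀ (by fun_prop) hne)
  rw [intervalIntegral.integral_eq_sub_of_hasDerivAt hderiv (hcont.intervalIntegrable _ _)]
  have hper : exp (s * (2 * Real.pi * I * (((c + τ / 2 : ℝ) : ℂ) + y * I) / τ)) =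
      exp (s * (2 * Real.pi * I * (((c - τ / 2 : ℝ) : ℂ) + y * I) / τ)) := by
    have : s * (2 * Real.pi * I * (((c + τ / 2 : ℝ) : ℂ) + y * I) / τ) =
        s * (2 * Real.pi * I * (((c - τ / 2 : ℝ) : ℂ) + y * I) / τ) + s * (2 * Real.pi * I) := by
      push_cast; field_simp; ring
    rw [this, exp_add]
    rcases hs with rfl | rfl
    · simp
    · rw [neg_one_mul (2 * Real.pi * I : ℂ), exp_neg, exp_two_pi_mul_I]; simp
  rw [hper, sub_self]

/-- The reflection formula of the kernel, which is therefore close to `-1` far above the nodes. -/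
lemma trapKernel_eq_neg_one_sub {z : ℂ} (hz : exp (2 * Real.pi * I * z / τ) ≠ 1) :
    trapKernel τ z = -1 - (exp (-(2 * Real.pi * I * z / τ)) - 1)⁻¹ := by
  have h1 := exp_ne_zero (2 * Real.pi * I * z / τ)
  rw [trapKernel, exp_neg]
  set w := exp (2 * Real.pi * I * z / τ)
  have h2 : w - 1 ≠ 0 := sub_ne_zero.2 hz
  have h3 : w⁻¹ - 1 ≠ 0 := by
    intro h; apply hz; rw [sub_eq_zero, inv_eq_one] at h; exact h
  have h4 : w⁻¹ - 1 = -(w - 1) * w⁻¹ := by field_simp; ring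
  rw [h4, mul_inv, inv_inv, inv_neg]
  field_simp
  ring

lemma exp_node_ne_one_of_im (hτ : 0 < τ) (x : ℝ) {y : ℝ} (hy : y ≠ 0) :
    exp (2 * Real.pi * I * (x + y * I) / τ) ≠ 1 := by
  intro h
  obtain ⟨k, hk⟩ := (exp_node_eq_one_iff hτ _).1 h
  have := congrArg im hk
  simp at this
  exact hy this

lemma exp_node_half (hτ : 0 < τ) (k : ℤ) (y : ℝ) :
    exp (2 * Real.pi * I * (((k + 1 / 2) * τ : ℝ) + y * I) / τ) =
      -((Real.exp (-(2 * Real.pi * y / τ)) : ℝ) : ℂ) := by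
  have hτ' : (τ : ℂ) ≠ 0 := ofReal_ne_zero.2 hτ.ne'
  have : 2 * Real.pi * I * (((k + 1 / 2) * τ : ℝ) + y * I) / τ =
      ((-(2 * Real.pi * y / τ) : ℝ) : ℂ) + Real.pi * I + k * (2 * Real.pi * I) := by
    push_cast
    field_simp
    linear_combination (2 * y : ℂ) * I_sq
  rw [this, exp_periodic.int_mul k, exp_add, exp_pi_mul_I, ofReal_exp]
  ring

lemma exp_node_half_ne_one (hτ : 0 < τ) (k : ℤ) (y : ℝ) :
    exp (2 * Real.pi * I * (((k + 1 / 2) * τ : ℝ) + y * I) / τ) ≠ 1 := by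
  rw [exp_node_half hτ]
  intro h
  have h1 := congrArg re h
  rw [neg_re, ofReal_re, one_re] at h1
  have := Real.exp_pos (-(2 * Real.pi * y / τ))
  linarith

/-- The residue theorem on one cell of the trapezoidal rule.  Cauchy's theorem is applied to
`(F - F(k τ)) κ`, whose singularity is removable, and the integrals of the kernel `κ` itself are
evaluated directly. -/
lemma integral_cell (hτ : 0 < τ) {b : ℝ} (hb : 0 < b) (k : ℤ) {F : ℂ → ℂ} {O : Set ℂ}
    (hO : IsOpen O) (hF : DifferentiableOn ℂ F O)
    (hsub : ∀ x ∈ Set.Icc ((k - 1 / 2) * τ) ((k + 1 / 2) * τ), ∀ y ∈ Set.Icc (-b) b,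
      (x + y * I : ℂ) ∈ O) :
    (∫ x in ((k - 1 / 2) * τ)..((k + 1 / 2) * τ),
        F (x + (-b : ℝ) * I) * trapKernel τ (x + (-b : ℝ) * I)) -
      (∫ x in ((k - 1 / 2) * τ)..((k + 1 / 2) * τ), F (x + b * I) * trapKernel τ (x + b * I)) +
      I * (∫ y in (-b)..b, F (((k + 1 / 2) * τ : ℝ) + y * I) *
        trapKernel τ (((k + 1 / 2) * τ : ℝ) + y * I)) -
      I * (∫ y in (-b)..b, F (((k - 1 / 2) * τ : ℝ) + y * I) *
        trapKernel τ (((k - 1 / 2) * τ : ℝ) + y * I)) = τ * F (k * τ) := by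
  have hτ' : (τ : ℂ) ≠ 0 := ofReal_ne_zero.2 hτ.ne'
  have hbb : -b ≤ b := by linarith
  set xl : ℝ := (k - 1 / 2) * τ with hxl
  set xr : ℝ := (k + 1 / 2) * τ with hxr
  have hlr : xl ≤ xr := by rw [hxl, hxr]; nlinarith
  set c : ℂ := k * τ with hc
  have hcO : c ∈ O := by
    have := hsub (k * τ) ⟨by rw [hxl]; nlinarith, by rw [hxr]; nlinarith⟩ 0 ⟨by linarith, hb.le⟩
    simpa [hc] using this
  set e : ℂ → ℂ := fun z => exp (2 * Real.pi * I * z / τ) with he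
  have hec : e c = 1 := (exp_node_eq_one_iff hτ c).2 ⟨k, rfl⟩
  have hed : Differentiable ℂ e := fun z => (hasDerivAt_exp_node z).differentiableAt
  have hSd : Differentiable ℂ (dslope e c) := by
    rw [← differentiableOn_univ]
    exact (differentiableOn_dslope univ_mem).2 hed.differentiableOn
  have hDd : DifferentiableOn ℂ (dslope F c) O := (differentiableOn_dslope (hO.mem_nhds hcO)).2 hF
  have hS0 : ∀ x ∈ Set.Icc xl xr, ∀ y : ℝ, dslope e c (x + y * I) ≠ 0 := by
    intro x hx y h0
    have h1 := sub_smul_dslope e c (x + y * I)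
    rw [h0, smul_zero, hec, eq_comm, sub_eq_zero] at h1
    obtain ⟨l, hl⟩ := (exp_node_eq_one_iff hτ _).1 h1
    have hre := congrArg re hl
    simp at hre
    have hkl : l = k := by
      rw [hre] at hx
      have h2 : (k:ℝ) - 1 / 2 ≤ l := le_of_mul_le_mul_right hx.1 hτ
      have h3 : (l:ℝ) ≤ k + 1 / 2 := le_of_mul_le_mul_right hx.2 hτ
      have h4 : (k:ℝ) < l + 1 := by linarith
      have h5 : (l:ℝ) < k + 1 := by linarith
      have h6 : k < l + 1 := by exact_mod_cast h4
      have h7 : l < k + 1 := by exact_mod_cast h5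
      omega
    rw [hl, hkl, ← hc, dslope_same, (hasDerivAt_exp_node c).deriv] at h0
    exact mul_ne_zero (div_ne_zero two_pi_I_ne_zero hτ') (exp_ne_zero _) h0
  -- `(F - F c) κ` extends holomorphically to the cell
  have hG : DifferentiableOn ℂ (fun z => dslope F c z / dslope e c z)
      (Set.uIcc xl xr ×ℂ Set.uIcc (-b) b) := by
    intro z hz
    rw [Set.uIcc_of_le hlr, Set.uIcc_of_le hbb] at hz
    have h1 := hz.1
    have h2 := hz.2
    have hzO : z ∈ O := by simpa using hsub z.re h1 z.im h2
    have hz0 : dslope e c z ≠ 0 := by simpa using hS0 z.re h1 z.im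
    exact ((hDd.differentiableAt (hO.mem_nhds hzO)).div (hSd z) hz0).differentiableWithinAt
  have hGeq : ∀ z, e z ≠ 1 → dslope F c z / dslope e c z =
      F z * trapKernel τ z - F c * trapKernel τ z := by
    intro z hz
    have hzc : z - c ≠ 0 := by
      intro h; rw [sub_eq_zero.1 h] at hz; exact hz hec
    have h1 := sub_smul_dslope F c z
    have h2 := sub_smul_dslope e c z
    rw [smul_eq_mul] at h1 h2
    rw [hec] at h2
    have h3 : e z - 1 ≠ 0 := sub_ne_zero.2 hz
    have h4 : dslope e c z ≠ 0 := by
      intro h; rw [h, mul_zero] at h2; exact h3 h2.symm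
    rw [trapKernel, ← sub_mul, ← h1]
    change _ = _ * (e z - 1)⁻¹
    rw [← h2]
    field_simp
  have hCauchy := integral_boundary_rect_eq_zero_of_differentiableOn
    (fun z => dslope F c z / dslope e c z) (xl + (-b : ℝ) * I) (xr + b * I) (by simpa using hG)
  simp only [add_re, ofReal_re, mul_re, I_re, mul_zero, ofReal_im, I_im, mul_one, sub_self,
    add_zero, add_im, mul_im, zero_add, smul_eq_mul] at hCauchy
  -- the integrals of `F κ` and of `κ` along the four sides
  have hneb : ∀ x : ℝ, e (x + (-b : ℝ) * I) ≠ 1 := fun x =>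
    exp_node_ne_one_of_im hτ x (by linarith)
  have hnet : ∀ x : ℝ, e (x + b * I) ≠ 1 := fun x => exp_node_ne_one_of_im hτ x hb.ne'
  have hner : ∀ y : ℝ, e (xr + y * I) ≠ 1 := fun y => exp_node_half_ne_one hτ k y
  have hnel : ∀ y : ℝ, e (xl + y * I) ≠ 1 := by
    intro y
    have := exp_node_half_ne_one hτ (k - 1) y
    have hx : ((k - 1 : ℤ) + 1 / 2 : ℝ) * τ = xl := by rw [hxl]; push_cast; ring
    rwa [hx] at this
  have hside : ∀ (g : ℝ → ℂ) (p q : ℝ), p ≤ q → Continuous g → (∀ t, e (g t) ≠ 1) →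
      (∀ t ∈ Set.Icc p q, g t ∈ O) →
      ∫ t in p..q, dslope F c (g t) / dslope e c (g t) =
        (∫ t in p..q, F (g t) * trapKernel τ (g t)) - F c * ∫ t in p..q, trapKernel τ (g t) := by
    intro g p q hpq hg hg1 hgO
    have hκ : Continuous (fun t => trapKernel τ (g t)) := continuous_iff_continuousAt.2 fun t =>
      ContinuousAt.comp (f := g) (continuousAt_trapKernel (hg1 t)) hg.continuousAt
    have hFc : ContinuousOn (fun t => F (g t)) (Set.uIcc p q) := by
      rw [Set.uIcc_of_le hpq]
      exact hF.continuousOn.comp hg.continuousOn hgO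
    rw [← intervalIntegral.integral_const_mul, ← intervalIntegral.integral_sub]
    · exact intervalIntegral.integral_congr fun t _ => hGeq _ (hg1 t)
    · exact (hFc.mul hκ.continuousOn).intervalIntegrable
    · exact (continuous_const.mul hκ).intervalIntegrable _ _
  rw [hside (fun x => x + (-b : ℝ) * I) xl xr hlr (by fun_prop) hneb
      (fun x hx => hsub x hx _ ⟨le_rfl, hbb⟩),
    hside (fun x => x + b * I) xl xr hlr (by fun_prop) hnet
      (fun x hx => hsub x hx _ ⟨hbb, le_rfl⟩),
    hside (fun y => xr + y * I) (-b) b hbb (by fun_prop) hner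
      (fun y hy => hsub xr ⟨hlr, le_rfl⟩ y hy),
    hside (fun y => xl + y * I) (-b) b hbb (by fun_prop) hnel
      (fun y hy => hsub xl ⟨le_rfl, hlr⟩ y hy)] at hCauchy
  have hxlr : xl = k * τ - τ / 2 ∧ xr = k * τ + τ / 2 := by
    constructor
    · rw [hxl]; ring
    · rw [hxr]; ring
  have hpos : 0 < 2 * Real.pi * b / τ := by positivity
  have hbot : ∫ x in xl..xr, trapKernel τ (x + (-b : ℝ) * I) = 0 := by
    rw [hxlr.1, hxlr.2]
    have := integral_period_eq_zero hτ (y := -b) (k * τ) (-1) (Or.inr rfl) (by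
      intro x
      rw [neg_one_mul, exp_neg, norm_inv, norm_exp_node]
      refine inv_lt_one_of_one_lt₀ (Real.one_lt_exp_iff.2 ?_)
      have : -(2 * Real.pi * -b / τ) = 2 * Real.pi * b / τ := by ring
      rwa [this])
    simpa [trapKernel] using this
  have htop : ∫ x in xl..xr, trapKernel τ (x + b * I) = -τ := by
    have h1 : ∫ x in xl..xr, trapKernel τ (x + b * I) = ∫ x in xl..xr, ((-1 : ℂ) -
        (exp (-(1 * (2 * Real.pi * I * (x + b * I) / τ))) - 1)⁻¹) := by
      refine intervalIntegral.integral_congr fun x _ => ?_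
      simp only [one_mul]
      exact trapKernel_eq_neg_one_sub (hnet x)
    have hlt : ∀ x : ℝ, ‖exp (1 * (2 * Real.pi * I * (x + b * I) / τ))‖ < 1 := by
      intro x
      rw [one_mul, norm_exp_node]
      exact Real.exp_lt_one_iff.2 (by linarith)
    have h2 := integral_period_eq_zero hτ (k * τ) 1 (Or.inl rfl) hlt
    rw [← hxlr.1, ← hxlr.2] at h2
    rw [h1, intervalIntegral.integral_sub, h2, intervalIntegral.integral_const, sub_zero]
    · rw [hxlr.1, hxlr.2]
      simp
    · exact intervalIntegrable_const
    · refine Continuous.intervalIntegrable (Continuous.inv₀ (by fun_prop) fun x h => ?_) _ _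
      have h3 := hlt x
      rw [← inv_inv (exp (1 * (2 * Real.pi * I * (x + b * I) / τ))), ← exp_neg,
        sub_eq_zero.1 h] at h3
      simp at h3
  have hsides : ∫ y in (-b)..b, trapKernel τ (xr + y * I) =
      ∫ y in (-b)..b, trapKernel τ (xl + y * I) := by
    refine intervalIntegral.integral_congr fun y _ => ?_
    have : (xr : ℂ) + y * I = (xl + y * I) + τ := by
      rw [hxlr.1, hxlr.2]; push_cast; ring
    simp only [trapKernel]
    rw [this, exp_add_period hτ]
  rw [hbot, htop, hsides] at hCauchy
  linear_combination hCauchy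

end Trapezoid

end

/-! ### The error of the trapezoidal rule -/

noncomputable section

section TrapezoidError

open Complex MeasureTheory

variable {τ : ℝ}

lemma norm_inv_sub_one_le {w : ℂ} {u : ℝ} (hu : 0 < u) (hw : ‖w‖ = Real.exp u) :
    ‖(w - 1)⁻¹‖ ≤ (Real.exp u - 1)⁻¹ := by
  rw [norm_inv]
  have h1 : 1 < Real.exp u := Real.one_lt_exp_iff.2 hu
  have h2 := norm_sub_norm_le w 1
  rw [hw, norm_one] at h2
  exact inv_anti₀ (by linarith) h2

lemma integral_exp_neg_mul_le {ω b : ℝ} (hω : 0 < ω) :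
    ∫ y in (0:ℝ)..b, Real.exp (-(ω * y)) ≤ ω⁻¹ := by
  have h1 : ∀ y ∈ Set.uIcc 0 b, HasDerivAt (fun y => -ω⁻¹ * Real.exp (-(ω * y)))
      (Real.exp (-(ω * y))) y := by
    intro y _
    have h2 := (((hasDerivAt_id y).const_mul ω).neg.exp).const_mul (-ω⁻¹)
    refine h2.congr_deriv ?_
    simp only [id, mul_one, Pi.neg_apply]
    field_simp
  rw [intervalIntegral.integral_eq_sub_of_hasDerivAt h1
    ((by fun_prop : Continuous fun y => Real.exp (-(ω * y))).intervalIntegrable _ _)]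
  have := mul_pos (inv_pos.2 hω) (Real.exp_pos (-(ω * b)))
  simp
  linarith

/-- On a vertical line halfway between two nodes the kernel is `-1 / (exp (-ω y) + 1)` with
`ω = 2 π / τ`.  Corrected by `1` in the upper half, it is at most `exp (-ω |y|)` in modulus. -/
lemma norm_integral_side_le {ω b B : ℝ} (hω : 0 < ω) (hb : 0 < b) {g : ℝ → ℂ}
    (hg : ContinuousOn g (Set.Icc (-b) b)) (hB : ∀ y ∈ Set.Icc (-b) b, ‖g y‖ ≤ B) :
    ‖(∫ y in (-b)..b, g y * (-((Real.exp (-(ω * y)) : ℝ) : ℂ) - 1)⁻¹) + ∫ y in (0:ℝ)..b, g y‖ ≤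
      2 * B * ω⁻¹ := by
  have hB0 : 0 ≤ B := (norm_nonneg _).trans (hB 0 ⟨by linarith, hb.le⟩)
  have hreal : ∀ y : ℝ, (-((Real.exp (-(ω * y)) : ℝ) : ℂ) - 1)⁻¹ =
      ((-(Real.exp (-(ω * y)) + 1)⁻¹ : ℝ) : ℂ) := by
    intro y
    rw [ofReal_neg, ofReal_inv, ofReal_add, ofReal_one, ← inv_neg]
    congr 1; ring
  have hκ : Continuous (fun y : ℝ => ((-(Real.exp (-(ω * y)) + 1)⁻¹ : ℝ) : ℂ)) := by
    refine continuous_ofReal.comp (Continuous.neg (Continuous.inv₀ (by fun_prop) fun y => ?_))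
    positivity
  simp only [hreal]
  have hm : (0:ℝ) ∈ Set.Icc (-b) b := ⟨by linarith, hb.le⟩
  have hs1 : Set.uIcc (-b) 0 ⊆ Set.Icc (-b) b := by
    rw [Set.uIcc_of_le (by linarith)]; exact Set.Icc_subset_Icc le_rfl hb.le
  have hs2 : Set.uIcc 0 b ⊆ Set.Icc (-b) b := by
    rw [Set.uIcc_of_le hb.le]; exact Set.Icc_subset_Icc (by linarith) le_rfl
  have hi1 : IntervalIntegrable (fun y => g y * ((-(Real.exp (-(ω * y)) + 1)⁻¹ : ℝ) : ℂ)) volume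
      (-b) 0 := ((hg.mono hs1).mul hκ.continuousOn).intervalIntegrable
  have hi2 : IntervalIntegrable (fun y => g y * ((-(Real.exp (-(ω * y)) + 1)⁻¹ : ℝ) : ℂ)) volume
      0 b := ((hg.mono hs2).mul hκ.continuousOn).intervalIntegrable
  have hi3 : IntervalIntegrable g volume 0 b := (hg.mono hs2).intervalIntegrable
  rw [← intervalIntegral.integral_add_adjacent_intervals hi1 hi2, add_assoc,
    ← intervalIntegral.integral_add hi2 hi3]
  have hexpint : ∀ p q : ℝ, IntervalIntegrable (fun y => B * Real.exp (-(ω * y))) volume p q :=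
    fun p q => (by fun_prop : Continuous fun y => B * Real.exp (-(ω * y))).intervalIntegrable _ _
  have hexpint' : ∀ p q : ℝ, IntervalIntegrable (fun y => B * Real.exp (ω * y)) volume p q :=
    fun p q => (by fun_prop : Continuous fun y => B * Real.exp (ω * y)).intervalIntegrable _ _
  have hup : ‖∫ y in (0:ℝ)..b, (g y * ((-(Real.exp (-(ω * y)) + 1)⁻¹ : ℝ) : ℂ) + g y)‖ ≤
      B * ω⁻¹ := by
    refine (intervalIntegral.norm_integral_le_of_norm_le hb.le
      (g := fun y => B * Real.exp (-(ω * y))) (Eventually.of_forall fun y hy => ?_)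
      (hexpint _ _)).trans ?_
    · have hE := Real.exp_pos (-(ω * y))
      have h1 : g y * ((-(Real.exp (-(ω * y)) + 1)⁻¹ : ℝ) : ℂ) + g y =
          g y * ((Real.exp (-(ω * y)) * (Real.exp (-(ω * y)) + 1)⁻¹ : ℝ) : ℂ) := by
        have : Real.exp (-(ω * y)) * (Real.exp (-(ω * y)) + 1)⁻¹ =
            1 - (Real.exp (-(ω * y)) + 1)⁻¹ := by field_simp; ring
        rw [this]; push_cast; ring
      rw [h1, norm_mul, norm_real, Real.norm_of_nonneg (by positivity)]
      refine mul_le_mul (hB y ⟨by linarith [hy.1], hy.2⟩) ?_ (by positivity) hB0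
      refine mul_le_of_le_one_right hE.le (inv_le_one_of_one_le₀ (by linarith))
    · rw [intervalIntegral.integral_const_mul]
      exact mul_le_mul_of_nonneg_left (integral_exp_neg_mul_le hω) hB0
  have hlow : ‖∫ y in (-b)..0, g y * ((-(Real.exp (-(ω * y)) + 1)⁻¹ : ℝ) : ℂ)‖ ≤ B * ω⁻¹ := by
    refine (intervalIntegral.norm_integral_le_of_norm_le (by linarith)
      (g := fun y => B * Real.exp (ω * y)) (Eventually.of_forall fun y hy => ?_)
      (hexpint' _ _)).trans ?_
    · have hE := Real.exp_pos (-(ω * y))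
      rw [norm_mul, norm_real, norm_neg, Real.norm_of_nonneg (by positivity)]
      refine mul_le_mul (hB y ⟨hy.1.le, by linarith [hy.2]⟩) ?_ (by positivity) hB0
      rw [← inv_inv (Real.exp (ω * y)), ← Real.exp_neg]
      exact inv_anti₀ hE (by linarith)
    · rw [intervalIntegral.integral_const_mul]
      refine mul_le_mul_of_nonneg_left ?_ hB0
      have h1 := intervalIntegral.integral_comp_neg (a := -b) (b := 0)
        (fun y => Real.exp (-(ω * y)))
      simp only [mul_neg, neg_neg, neg_zero] at h1
      rw [h1]
      exact integral_exp_neg_mul_le hω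
  refine (norm_add_le _ _).trans ?_
  linarith

/-- **Error of the trapezoidal rule** on a finite interval for a function that is holomorphic near a
rectangle around the interval.  The interval ends half a step beyond the outermost nodes, where the
kernel is bounded on the vertical lines; the ends then contribute only a multiple of `τ`. -/
theorem norm_integral_sub_trapezoid_le (hτ : 0 < τ) {b : ℝ} (hb : 0 < b) (L : ℕ) {X : ℝ}
    (hX : X = (L + 1 / 2) * τ) {F : ℂ → ℂ} {O : Set ℂ} (hO : IsOpen O)
    (hF : DifferentiableOn ℂ F O)
    (hsub : ∀ x ∈ Set.Icc (-X) X, ∀ y ∈ Set.Icc (-b) b, (x + y * I : ℂ) ∈ O) {B B' : ℝ}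
    (hB : ∀ x ∈ Set.Icc (-X) X, ‖F (x + b * I)‖ ≤ B ∧ ‖F (x + (-b : ℝ) * I)‖ ≤ B)
    (hB' : ∀ y ∈ Set.Icc (-b) b, ‖F (X + y * I)‖ ≤ B' ∧ ‖F ((-X : ℝ) + y * I)‖ ≤ B') :
    ‖(∫ x in (-X)..X, F x) - τ * ∑ k ∈ Finset.Icc (-(L : ℤ)) L, F (k * τ)‖ ≤
      4 * X * B * (Real.exp (2 * Real.pi * b / τ) - 1)⁻¹ + τ * B' := by
  have hbb : -b ≤ b := by linarith
  have hX0 : 0 < X := by rw [hX]; positivity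
  have hXX : -X ≤ X := by linarith
  set x : ℕ → ℝ := fun j => (((j : ℤ) - L : ℤ) - 1 / 2) * τ with hx
  have hx1 : ∀ j, x (j + 1) = (((j : ℤ) - L : ℤ) + 1 / 2) * τ := by
    intro j; simp only [hx]; push_cast; ring
  have hx0 : x 0 = -X := by simp only [hx, hX]; push_cast; ring
  have hxn : x (2 * L + 1) = X := by simp only [hx, hX]; push_cast; ring
  have hmono : Monotone x := by
    refine monotone_nat_of_le_succ fun j => ?_
    rw [hx1]; simp only [hx]
    exact mul_le_mul_of_nonneg_right (by linarith) hτ.le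
  have hmem : ∀ j, j ≤ 2 * L + 1 → x j ∈ Set.Icc (-X) X := fun j hj =>
    ⟨by rw [← hx0]; exact hmono (Nat.zero_le _), by rw [← hxn]; exact hmono hj⟩
  -- continuity of the integrands
  have hline : ∀ y ∈ Set.Icc (-b) b, ContinuousOn (fun t : ℝ => F (t + y * I)) (Set.Icc (-X) X) :=
    fun y hy => hF.continuousOn.comp (by fun_prop) fun t ht => hsub t ht y hy
  have hvert : ∀ t ∈ Set.Icc (-X) X, ContinuousOn (fun y : ℝ => F (t + y * I)) (Set.Icc (-b) b) :=
    fun t ht => hF.continuousOn.comp (by fun_prop) fun y hy => hsub t ht y hy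
  have hκline : ∀ y : ℝ, y ≠ 0 → Continuous (fun t : ℝ => trapKernel τ (t + y * I)) := fun y hy =>
    continuous_iff_continuousAt.2 fun t => ContinuousAt.comp (f := fun t : ℝ => (t : ℂ) + y * I)
      (continuousAt_trapKernel (exp_node_ne_one_of_im hτ t hy)) (by fun_prop)
  have hbmem : b ∈ Set.Icc (-b) b := ⟨hbb, le_rfl⟩
  have hbmem' : -b ∈ Set.Icc (-b) b := ⟨le_rfl, hbb⟩
  have hint : ∀ y ∈ Set.Icc (-b) b, y ≠ 0 → ∀ p ∈ Set.Icc (-X) X, ∀ q ∈ Set.Icc (-X) X,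
      IntervalIntegrable (fun t : ℝ => F (t + y * I) * trapKernel τ (t + y * I)) volume p q :=
    fun y hy hy0 p hp q hq => (((hline y hy).mono (Set.uIcc_subset_Icc hp hq)).mul
      (hκline y hy0).continuousOn).intervalIntegrable
  -- sum of the cell identities
  set V : ℝ → ℂ := fun t => ∫ y in (-b)..b, F (t + y * I) * trapKernel τ (t + y * I) with hV
  have hcell : ∀ j ∈ Finset.range (2 * L + 1),
      (τ : ℂ) * F (((j : ℤ) - L : ℤ) * τ) =
      (∫ t in (x j)..(x (j + 1)), F (t + (-b : ℝ) * I) * trapKernel τ (t + (-b : ℝ) * I)) -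
      (∫ t in (x j)..(x (j + 1)), F (t + b * I) * trapKernel τ (t + b * I)) +
      (I * V (x (j + 1)) - I * V (x j)) := by
    intro j hj
    have hj' := Finset.mem_range.1 hj
    have h := integral_cell hτ hb ((j : ℤ) - L) hO hF (fun t ht y hy => hsub t ?_ y hy)
    · rw [hx1, ← h]; ring
    · have h1 : t ∈ Set.Icc (x j) (x (j + 1)) := by rw [hx1]; exact ht
      exact ⟨(hmem j (by omega)).1.trans h1.1, h1.2.trans (hmem (j + 1) (by omega)).2⟩
  have hsum : (τ : ℂ) * ∑ k ∈ Finset.Icc (-(L : ℤ)) L, F (k * τ) =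
      (∫ t in (-X)..X, F (t + (-b : ℝ) * I) * trapKernel τ (t + (-b : ℝ) * I)) -
      (∫ t in (-X)..X, F (t + b * I) * trapKernel τ (t + b * I)) + (I * V X - I * V (-X)) := by
    have h1 : ∑ k ∈ Finset.Icc (-(L : ℤ)) L, F (k * τ) =
        ∑ j ∈ Finset.range (2 * L + 1), F (((j : ℤ) - L : ℤ) * τ) := by
      refine Finset.sum_nbij' (fun k => (k + L).toNat) (fun j => (j : ℤ) - L) ?_ ?_ ?_ ?_ ?_
      · intro k hk; rw [Finset.mem_Icc] at hk; rw [Finset.mem_range]; omega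
      · intro j hj; rw [Finset.mem_range] at hj; rw [Finset.mem_Icc]; omega
      · intro k hk; rw [Finset.mem_Icc] at hk; omega
      · intro j hj; omega
      · intro k hk
        rw [Finset.mem_Icc] at hk
        have : (((k + L).toNat : ℤ) - L) = k := by omega
        rw [this]
    rw [h1, Finset.mul_sum, Finset.sum_congr rfl hcell, Finset.sum_add_distrib,
      Finset.sum_sub_distrib, Finset.sum_range_sub (fun j => I * V (x j)),
      intervalIntegral.sum_integral_adjacent_intervals fun j hj => hint (-b) hbmem' (by linarith)
        _ (hmem j (by omega)) _ (hmem (j + 1) (by omega)),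
      intervalIntegral.sum_integral_adjacent_intervals fun j hj => hint b hbmem hb.ne'
        _ (hmem j (by omega)) _ (hmem (j + 1) (by omega)), hx0, hxn]
  -- shift of the integral to the upper side
  have hshift : (∫ t in (-X)..X, F t) - (∫ t in (-X)..X, F (t + b * I)) +
      I * (∫ y in (0:ℝ)..b, F (X + y * I)) - I * (∫ y in (0:ℝ)..b, F ((-X : ℝ) + y * I)) = 0 := by
    have h1 := integral_boundary_rect_eq_zero_of_differentiableOn F ((-X : ℝ) : ℂ) (X + b * I) (by
      intro z hz
      have h2 := hz.1
      have h3 := hz.2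
      simp only [ofReal_re, add_re, mul_re, I_re, mul_zero, ofReal_im, I_im, mul_one, sub_self,
        add_zero, Set.mem_preimage, add_im, mul_im, zero_add] at h2 h3
      rw [Set.uIcc_of_le hXX] at h2
      rw [Set.uIcc_of_le hb.le] at h3
      have hz : z ∈ O := by
        simpa using hsub z.re h2 z.im ⟨by linarith [h3.1], h3.2⟩
      exact (hF.differentiableAt (hO.mem_nhds hz)).differentiableWithinAt)
    simpa using h1
  -- the kernel on the horizontal sides
  have hu : 0 < 2 * Real.pi * b / τ := by positivity
  set Q : ℝ := (Real.exp (2 * Real.pi * b / τ) - 1)⁻¹ with hQ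
  have hQ0 : 0 ≤ Q := inv_nonneg.2 (by linarith [Real.one_lt_exp_iff.2 hu])
  have hbot : ‖∫ t in (-X)..X, F (t + (-b : ℝ) * I) * trapKernel τ (t + (-b : ℝ) * I)‖ ≤
      2 * X * B * Q := by
    refine (intervalIntegral.norm_integral_le_of_norm_le_const (C := B * Q) fun t ht => ?_).trans ?_
    · rw [Set.uIoc_of_le hXX] at ht
      have ht' := Set.Ioc_subset_Icc_self ht
      rw [norm_mul]
      refine mul_le_mul (hB t ht').2 (norm_inv_sub_one_le hu ?_) (norm_nonneg _)
        ((norm_nonneg _).trans (hB t ht').2)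
      rw [norm_exp_node]; congr 1; ring
    · rw [abs_of_nonneg (by linarith)]; apply le_of_eq; ring
  have htop : ‖(∫ t in (-X)..X, F (t + b * I) * trapKernel τ (t + b * I)) +
      ∫ t in (-X)..X, F (t + b * I)‖ ≤ 2 * X * B * Q := by
    have hmX : X ∈ Set.Icc (-X) X := ⟨hXX, le_rfl⟩
    have hmX' : -X ∈ Set.Icc (-X) X := ⟨le_rfl, hXX⟩
    rw [← intervalIntegral.integral_add (hint b hbmem hb.ne' _ hmX' _ hmX)
      (((hline b hbmem).mono (Set.uIcc_subset_Icc hmX' hmX)).intervalIntegrable)]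
    refine (intervalIntegral.norm_integral_le_of_norm_le_const (C := B * Q) fun t ht => ?_).trans ?_
    · rw [Set.uIoc_of_le hXX] at ht
      have ht' := Set.Ioc_subset_Icc_self ht
      have h1 : F (t + b * I) * trapKernel τ (t + b * I) + F (t + b * I) =
          -(F (t + b * I) * (exp (-(2 * Real.pi * I * (t + b * I) / τ)) - 1)⁻¹) := by
        rw [trapKernel_eq_neg_one_sub (exp_node_ne_one_of_im hτ t hb.ne')]; ring
      rw [h1, norm_neg, norm_mul]
      refine mul_le_mul (hB t ht').1 (norm_inv_sub_one_le hu ?_) (norm_nonneg _)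
        ((norm_nonneg _).trans (hB t ht').1)
      rw [exp_neg, norm_inv, norm_exp_node, Real.exp_neg, inv_inv]
    · rw [abs_of_nonneg (by linarith)]; apply le_of_eq; ring
  -- the vertical sides
  have hω : 0 < 2 * Real.pi / τ := by positivity
  have hside : ∀ (P : ℝ) (k : ℤ), P = (k + 1 / 2) * τ → P ∈ Set.Icc (-X) X →
      (∀ y ∈ Set.Icc (-b) b, ‖F (P + y * I)‖ ≤ B') →
      ‖V P + ∫ y in (0:ℝ)..b, F (P + y * I)‖ ≤ τ / 2 * B' := by
    intro P k hP hPm hPB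
    have h1 := norm_integral_side_le hω hb (hvert P hPm) hPB
    have h2 : V P = ∫ y in (-b)..b, F (P + y * I) *
        (-((Real.exp (-(2 * Real.pi / τ * y)) : ℝ) : ℂ) - 1)⁻¹ := by
      refine intervalIntegral.integral_congr fun y _ => ?_
      simp only [trapKernel]
      rw [hP, exp_node_half hτ]
      congr 6; ring
    rw [h2]
    refine h1.trans ?_
    have hB0 : 0 ≤ B' := (norm_nonneg _).trans (hPB 0 ⟨by linarith, hb.le⟩)
    have h3 : (2 * Real.pi / τ)⁻¹ ≤ τ / 4 := by
      rw [inv_div, div_le_div_iff₀ (by positivity) (by norm_num)]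
      nlinarith [Real.pi_gt_three]
    nlinarith
  have hR := hside X L (by rw [hX]; push_cast; ring) ⟨hXX, le_rfl⟩ fun y hy => (hB' y hy).1
  have hL := hside (-X) (-(L : ℤ) - 1) (by rw [hX]; push_cast; ring) ⟨le_rfl, hXX⟩
    fun y hy => (hB' y hy).2
  have hfinal : (∫ t in (-X)..X, F t) - τ * ∑ k ∈ Finset.Icc (-(L : ℤ)) L, F (k * τ) =
      (-(∫ t in (-X)..X, F (t + (-b : ℝ) * I) * trapKernel τ (t + (-b : ℝ) * I)) +
      ((∫ t in (-X)..X, F (t + b * I) * trapKernel τ (t + b * I)) +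
      ∫ t in (-X)..X, F (t + b * I))) +
      (-(I * (V X + ∫ y in (0:ℝ)..b, F (X + y * I))) +
      I * (V (-X) + ∫ y in (0:ℝ)..b, F ((-X : ℝ) + y * I))) := by
    rw [hsum]
    linear_combination hshift
  rw [hfinal]
  refine (norm_add_le _ _).trans ((add_le_add (norm_add_le _ _) (norm_add_le _ _)).trans ?_)
  rw [norm_neg, norm_neg, norm_mul, norm_mul, norm_I, one_mul, one_mul]
  linarith

end TrapezoidError

end

/-! ### Contour representation of the weights -/

noncomputable section

section Sector

/-- The sector as a sublevel set, which avoids the argument function. -/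
lemma mem_sector_iff {δ : ℝ} (h0 : 0 < δ) (h1 : δ < Real.pi / 2) {l : ℂ} :
    l ∈ sector δ ↔ 0 < l.re + Real.cos δ * ‖l‖ := by
  by_cases hl : l = 0
  · simp [sector, hl]
  have hn : 0 < ‖l‖ := norm_pos_iff.2 hl
  have h2 : |l.arg| < Real.pi - δ ↔ Real.cos (Real.pi - δ) < Real.cos |l.arg| :=
    (Real.strictAntiOn_cos.lt_iff_gt ⟨by linarith, by linarith⟩
      ⟨abs_nonneg _, Complex.abs_arg_le_pi l⟩).symm
  rw [sector, Set.mem_ofPred_eq, h2, Real.cos_abs, Complex.cos_arg hl, Real.cos_pi_sub,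
    lt_div_iff₀ hn]
  constructor
  · rintro ⟨-, h⟩; linarith
  · intro h; exact ⟨hl, by linarith⟩

variable {δ : ℝ}

lemma isOpen_sector (h0 : 0 < δ) (h1 : δ < Real.pi / 2) : IsOpen (sector δ) := by
  have : sector δ = {l : ℂ | 0 < l.re + Real.cos δ * ‖l‖} := Set.ext fun l => mem_sector_iff h0 h1
  rw [this]
  exact isOpen_lt continuous_const (by fun_prop)

lemma cos_pos_of_lt (h0 : 0 < δ) (h1 : δ < Real.pi / 2) : 0 < Real.cos δ :=
  Real.cos_pos_of_mem_Ioo ⟨by linarith, h1⟩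

lemma cos_lt_one_of_lt (h0 : 0 < δ) (h1 : δ < Real.pi / 2) : Real.cos δ < 1 := by
  have := Real.cos_lt_cos_of_nonneg_of_le_pi_div_two le_rfl h1.le h0
  rwa [Real.cos_zero] at this

lemma mem_sector_of_re_pos (h0 : 0 < δ) (h1 : δ < Real.pi / 2) {l : ℂ} (hl : 0 < l.re) :
    l ∈ sector δ := by
  rw [mem_sector_iff h0 h1]
  have := mul_nonneg (cos_pos_of_lt h0 h1).le (norm_nonneg l)
  linarith

lemma add_mem_sector (h0 : 0 < δ) (h1 : δ < Real.pi / 2) {l : ℂ} (hl : l ∈ sector δ) {t : ℝ}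
    (ht : 0 ≤ t) : l + t ∈ sector δ := by
  rw [mem_sector_iff h0 h1] at hl ⊢
  have h2 := norm_sub_norm_le l (-(t : ℂ))
  rw [sub_neg_eq_add, norm_neg, Complex.norm_real, Real.norm_of_nonneg ht] at h2
  have h3 := mul_le_mul_of_nonneg_left h2 (cos_pos_of_lt h0 h1).le
  have h4 := cos_lt_one_of_lt h0 h1
  simp only [Complex.add_re, Complex.ofReal_re]
  nlinarith

lemma smul_mem_sector (h0 : 0 < δ) (h1 : δ < Real.pi / 2) {l : ℂ} (hl : l ∈ sector δ) {t : ℝ}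
    (ht : 0 < t) : t * l ∈ sector δ := by
  rw [mem_sector_iff h0 h1] at hl ⊢
  rw [norm_mul, Complex.norm_real, Real.norm_of_nonneg ht.le, Complex.re_ofReal_mul]
  nlinarith

lemma conj_mem_sector (h0 : 0 < δ) (h1 : δ < Real.pi / 2) {l : ℂ} (hl : l ∈ sector δ) :
    (starRingEnd ℂ) l ∈ sector δ := by
  rw [mem_sector_iff h0 h1] at hl ⊢
  rwa [Complex.conj_re, Complex.norm_conj]

/-- The sector is star-shaped about `1`. -/
lemma sector_star (h0 : 0 < δ) (h1 : δ < Real.pi / 2) :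
    ∀ z ∈ sector δ, ∀ t ∈ Set.Icc (0:ℝ) 1, (1 : ℂ) + t * (z - 1) ∈ sector δ := by
  intro z hz t ht
  rcases eq_or_lt_of_le ht.1 with h | h
  · rw [← h]
    exact mem_sector_of_re_pos h0 h1 (by simp)
  · have := add_mem_sector h0 h1 (smul_mem_sector h0 h1 hz h) (sub_nonneg.2 ht.2)
    convert this using 1
    push_cast; ring

/-- Moving away from the real axis on a vertical line stays in the sector. -/
lemma mem_sector_of_vertical (h0 : 0 < δ) (h1 : δ < Real.pi / 2) {l m : ℂ} (hl : l ∈ sector δ)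
    (hre : m.re = l.re) (him : |l.im| ≤ |m.im|) : m ∈ sector δ := by
  rw [mem_sector_iff h0 h1] at hl ⊢
  have h2 : ‖l‖ ≤ ‖m‖ := by
    rw [Complex.norm_eq_sqrt_sq_add_sq, Complex.norm_eq_sqrt_sq_add_sq, hre]
    exact Real.sqrt_le_sqrt (by have := sq_le_sq.2 him; linarith)
  have h3 := mul_le_mul_of_nonneg_left h2 (cos_pos_of_lt h0 h1).le
  rw [hre]; linarith

end Sector

section BoxContour

open Complex

/-- The closed contour consisting of an arc `γ` from `conj p` to `p`, the vertical segments above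
`p` and below `conj p` up to height `T`, and the remaining three sides of the box
`[Re p, T] × [-T, T]`. -/
def boxContour (γ : Arc) (T : ℝ) : Fin 6 → Arc :=
  ![γ,
    Arc.segment γ.target (γ.target.re + T * I),
    Arc.segment (γ.target.re + T * I) (T + T * I),
    Arc.segment (T + T * I) (T - T * I),
    Arc.segment (T - T * I) (γ.target.re - T * I),
    Arc.segment (γ.target.re - T * I) γ.source]

variable {γ : Arc} {T r δ : ℝ}

lemma chainIntegral_boxContour (f : ℂ → ℂ) : chainIntegral (boxContour γ T) f =
    γ.integral f + (Arc.segment γ.target (γ.target.re + T * I)).integral f +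
      (Arc.segment (γ.target.re + T * I) (T + T * I)).integral f +
      (Arc.segment (T + T * I) (T - T * I)).integral f +
      (Arc.segment (T - T * I) (γ.target.re - T * I)).integral f +
      (Arc.segment (γ.target.re - T * I) γ.source).integral f := by
  simp [chainIntegral, Fin.sum_univ_six, boxContour]

lemma chainTrace_boxContour : chainTrace (boxContour γ T) =
    γ.trace ∪ (Arc.segment γ.target (γ.target.re + T * I)).trace ∪
      (Arc.segment (γ.target.re + T * I) (T + T * I)).trace ∪
      (Arc.segment (T + T * I) (T - T * I)).trace ∪
      (Arc.segment (T - T * I) (γ.target.re - T * I)).trace ∪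
      (Arc.segment (γ.target.re - T * I) γ.source).trace := by
  ext z
  simp only [chainTrace, Set.mem_iUnion, Set.mem_union]
  constructor
  · rintro ⟨i, hi⟩
    fin_cases i <;> simp [boxContour] at hi <;> simp [hi]
  · rintro (((((h | h) | h) | h) | h) | h)
    exacts [⟨0, h⟩, ⟨1, h⟩, ⟨2, h⟩, ⟨3, h⟩, ⟨4, h⟩, ⟨5, h⟩]

lemma mem_trace_upper {z : ℂ} (hp : γ.target.im ≤ T)
    (hz : z ∈ (Arc.segment γ.target (γ.target.re + T * I)).trace) :
    z.re = γ.target.re ∧ γ.target.im ≤ z.im := by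
  obtain ⟨t, ht, rfl⟩ := hz
  simp only [Arc.segment_lo, Arc.segment_hi] at ht
  simp only [Arc.segment_toFun]
  constructor
  · simp
  · simp; nlinarith [ht.1]

lemma mem_trace_lower {z : ℂ} (hp : γ.target.im ≤ T) (hs : γ.source = (starRingEnd ℂ) γ.target)
    (hz : z ∈ (Arc.segment (γ.target.re - T * I) γ.source).trace) :
    z.re = γ.target.re ∧ z.im ≤ -γ.target.im := by
  obtain ⟨t, ht, rfl⟩ := hz
  simp only [Arc.segment_lo, Arc.segment_hi] at ht
  simp only [Arc.segment_toFun, hs]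
  constructor
  · simp
  · simp; nlinarith [ht.2]

lemma mem_trace_top {z : ℂ} (hz : z ∈ (Arc.segment (γ.target.re + T * I) (T + T * I)).trace) :
    ∃ t ∈ Set.Icc (0:ℝ) 1, z = γ.target.re + T * I + (t * (T - γ.target.re) : ℝ) := by
  obtain ⟨t, ht, rfl⟩ := hz
  refine ⟨t, ht, ?_⟩
  simp only [Arc.segment_toFun]; push_cast; ring

lemma mem_trace_bottom {z : ℂ} (hz : z ∈ (Arc.segment (T - T * I) (γ.target.re - T * I)).trace) :
    ∃ t ∈ Set.Icc (0:ℝ) 1, z = γ.target.re - T * I + (t * (T - γ.target.re) : ℝ) := by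
  obtain ⟨t, ht, rfl⟩ := hz
  simp only [Arc.segment_lo, Arc.segment_hi] at ht
  refine ⟨1 - t, ⟨by linarith [ht.2], by linarith [ht.1]⟩, ?_⟩
  simp only [Arc.segment_toFun]; push_cast; ring

lemma mem_trace_right {z : ℂ} (hz : z ∈ (Arc.segment (T + T * I) (T - T * I)).trace) :
    z.re = T := by
  obtain ⟨t, ht, rfl⟩ := hz
  simp [Arc.segment_toFun]

/-- A point of the box contour lies either on the left part, or outside the disc of radius `T`. -/
lemma re_lt_or_le_norm (hp : γ.target.im ≤ T) (hT : 0 < T)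
    (hs : γ.source = (starRingEnd ℂ) γ.target) (hγ : ∀ z ∈ γ.trace, z.re < r) (hr : γ.target.re < r)
    {z : ℂ} (hz : z ∈ chainTrace (boxContour γ T)) : z.re < r ∨ T ≤ ‖z‖ := by
  rw [chainTrace_boxContour] at hz
  have him : |z.im| = T → T ≤ ‖z‖ := fun h => h ▸ abs_im_le_norm z
  rcases hz with ((((h | h) | h) | h) | h) | h
  · exact Or.inl (hγ z h)
  · left; rw [(mem_trace_upper hp h).1]; exact hr
  · right
    obtain ⟨t, -, rfl⟩ := mem_trace_top h
    apply him; simp [abs_of_pos hT]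
  · right
    refine le_trans ?_ (abs_re_le_norm z)
    rw [mem_trace_right h]; exact le_abs_self T
  · right
    obtain ⟨t, -, rfl⟩ := mem_trace_bottom h
    apply him; simp [abs_of_pos hT]
  · left; rw [(mem_trace_lower hp hs h).1]; exact hr

lemma log_neg_of_im_pos {z : ℂ} (hz : 0 < z.im) : log (-z) = log z - Real.pi * I := by
  rw [log, log, norm_neg, arg_neg_eq_arg_sub_pi_of_im_pos hz]
  push_cast; ring

lemma log_neg_of_im_neg {z : ℂ} (hz : z.im < 0) : log (-z) = log z + Real.pi * I := by
  rw [log, log, norm_neg, arg_neg_eq_arg_add_pi_of_im_neg hz]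
  push_cast; ring

/-- The box contour winds once around the part of the disc of radius `T` to the right of the line
`Re w = r`, if `γ` stays to the left of that line. -/
theorem encloses_boxContour (h0 : 0 < δ) (h1 : δ < Real.pi / 2) (hr : 0 < r)
    (hs : γ.source = (starRingEnd ℂ) γ.target) (hp0 : 0 ≤ γ.target.im) (hp : γ.target.im ≤ T)
    (hrT : r < T) (hγ : ∀ z ∈ γ.trace, z.re < r) (hγδ : γ.trace ⊆ sector δ) :
    Encloses (boxContour γ T) (sector δ) {w | r ≤ w.re ∧ ‖w‖ < T} := by
  have hT : 0 < T := hr.trans hrT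
  have htar : γ.target ∈ γ.trace := Arc.mem_trace ⟨γ.le, le_rfl⟩
  have hpr : γ.target.re < r := hγ _ htar
  have hpδ : γ.target ∈ sector δ := hγδ htar
  have hsplit := fun (f : ℂ → ℂ) => chainIntegral_boxContour (γ := γ) (T := T) f
  have hmem : ∀ {z : ℂ}, z ∈ chainTrace (boxContour γ T) ↔ _ := fun {z} => by
    rw [chainTrace_boxContour]
  have hTL : (γ.target.re + T * I : ℂ) ∈ sector δ := by
    refine mem_sector_of_vertical h0 h1 hpδ (by simp) ?_
    simp only [add_im, ofReal_im, mul_im, ofReal_re, I_im, mul_one, I_re, mul_zero, add_zero,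
      zero_add]
    rwa [abs_of_nonneg hp0, abs_of_pos hT]
  have hBL : (γ.target.re - T * I : ℂ) ∈ sector δ := by
    have := conj_mem_sector h0 h1 hTL
    simpa [sub_eq_add_neg] using this
  refine ⟨isOpen_sector h0 h1, fun w hw => mem_sector_of_re_pos h0 h1 (hr.trans_le hw.1),
    ?_, ?_, ?_,
    fun f hf => StarConvex.exists_primitive (isOpen_sector h0 h1) (sector_star h0 h1) hf, ?_⟩
  · intro z hz
    rw [hmem] at hz
    rcases hz with ((((h | h) | h) | h) | h) | h
    · exact hγδ h
    · have h2 := mem_trace_upper hp h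
      refine mem_sector_of_vertical h0 h1 hpδ h2.1 ?_
      rw [abs_of_nonneg hp0]; exact h2.2.trans (le_abs_self _)
    · obtain ⟨t, ht, rfl⟩ := mem_trace_top h
      exact add_mem_sector h0 h1 hTL (mul_nonneg ht.1 (by linarith))
    · exact mem_sector_of_re_pos h0 h1 (by rw [mem_trace_right h]; exact hT)
    · obtain ⟨t, ht, rfl⟩ := mem_trace_bottom h
      exact add_mem_sector h0 h1 hBL (mul_nonneg ht.1 (by linarith))
    · have h2 := mem_trace_lower hp hs h
      refine mem_sector_of_vertical h0 h1 hpδ h2.1 ?_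
      rw [abs_of_nonneg hp0]
      have := neg_le_abs z.im
      linarith [h2.2]
  · rintro z hz ⟨h2, h3⟩
    rcases re_lt_or_le_norm hp hT hs hγ hpr hz with h4 | h4 <;> linarith
  · intro F f hF hf
    have h2 : ∀ S : Arc, S.trace ⊆ chainTrace (boxContour γ T) →
        S.integral f = F S.target - F S.source := fun S hS =>
      Arc.integral_eq_sub (fun z hz => hF z (hS hz)) (hf.mono hS)
    have s0 : γ.trace ⊆ chainTrace (boxContour γ T) :=
      trace_subset_chainTrace (C := boxContour γ T) 0
    have s1 : (Arc.segment γ.target (γ.target.re + T * I)).trace ⊆ chainTrace (boxContour γ T) :=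
      trace_subset_chainTrace (C := boxContour γ T) 1
    have s2 : (Arc.segment (γ.target.re + T * I) (T + T * I)).trace ⊆
      chainTrace (boxContour γ T) := trace_subset_chainTrace (C := boxContour γ T) 2
    have s3 : (Arc.segment (T + T * I) (T - T * I)).trace ⊆ chainTrace (boxContour γ T) :=
      trace_subset_chainTrace (C := boxContour γ T) 3
    have s4 : (Arc.segment (T - T * I) (γ.target.re - T * I)).trace ⊆
      chainTrace (boxContour γ T) := trace_subset_chainTrace (C := boxContour γ T) 4
    have s5 : (Arc.segment (γ.target.re - T * I) γ.source).trace ⊆ chainTrace (boxContour γ T) :=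
      trace_subset_chainTrace (C := boxContour γ T) 5
    rw [hsplit, h2 _ s0, h2 _ s1, h2 _ s2, h2 _ s3, h2 _ s4, h2 _ s5]
    simp only [Arc.segment_source, Arc.segment_target]
    ring
  · rintro w ⟨hwr, hwT⟩
    have him := abs_le.1 (abs_im_le_norm w)
    have hre := abs_le.1 (abs_re_le_norm w)
    -- `log (w - z)` is a primitive to the left of `w`
    have hleft : ∀ S : Arc, (∀ z ∈ S.trace, z.re < r) →
        S.integral (fun z => (z - w)⁻¹) = log (-(S.target - w)) - log (-(S.source - w)) := by
      intro S hS
      have hlt : ∀ z ∈ S.trace, 0 < (-(z - w)).re := fun z hz => by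
        have := hS z hz; simp; linarith
      refine Arc.integral_eq_sub (F := fun z => log (-(z - w))) (fun z hz => ?_) ?_
      · have h3 := (((hasDerivAt_id z).sub_const w).neg).clog (Or.inl (hlt z hz))
        refine h3.congr_deriv ?_
        change -1 / (-(z - w)) = _
        rw [neg_div_neg_eq, one_div]
      · refine ContinuousOn.inv₀ (by fun_prop) fun z hz h4 => ?_
        have := hlt z hz
        rw [h4] at this; simp at this
    have hlog : ∀ S : Arc, (∀ z ∈ S.trace, z - w ∈ slitPlane) →
        S.integral (fun z => (z - w)⁻¹) = log (S.target - w) - log (S.source - w) := by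
      intro S hS
      refine Arc.integral_eq_sub (F := fun z => log (z - w)) (fun z hz => ?_) ?_
      · have h3 := ((hasDerivAt_id z).sub_const w).clog (hS z hz)
        refine h3.congr_deriv ?_
        simp
      · exact ContinuousOn.inv₀ (by fun_prop) fun z hz h4 => slitPlane_ne_zero (hS z hz) h4
    have h2 : 0 < ((γ.target.re + T * I : ℂ) - w).im := by simp; linarith
    have h3 : ((γ.target.re - T * I : ℂ) - w).im < 0 := by simp; linarith
    rw [hsplit, hleft γ hγ, hleft (Arc.segment γ.target (γ.target.re + T * I))
        (fun z hz => by rw [(mem_trace_upper hp hz).1]; exact hpr),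
      hleft (Arc.segment (γ.target.re - T * I) γ.source)
        (fun z hz => by rw [(mem_trace_lower hp hs hz).1]; exact hpr),
      hlog (Arc.segment (γ.target.re + T * I) (T + T * I)),
      hlog (Arc.segment (T + T * I) (T - T * I)),
      hlog (Arc.segment (T - T * I) (γ.target.re - T * I))]
    · simp only [Arc.segment_source, Arc.segment_target]
      rw [log_neg_of_im_pos h2, log_neg_of_im_neg h3]
      ring
    · intro z hz
      obtain ⟨t, -, rfl⟩ := mem_trace_bottom hz
      right; simp; linarith
    · intro z hz
      left; rw [sub_re, mem_trace_right hz]; linarith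
    · intro z hz
      obtain ⟨t, -, rfl⟩ := mem_trace_top hz
      right; simp; linarith

end BoxContour

namespace RKMethod

open Matrix

variable {s : ℕ} {M : RKMethod s}

lemma differentiableAt_resOne {z : ℂ} (hz : (1 - z • M.Ac).det ≠ 0) (i : Fin (s + 1)) :
    DifferentiableAt ℂ (fun z => M.resOne z i) z := by
  simp only [resOne, mulVec, dotProduct, mul_one]
  exact DifferentiableAt.fun_sum fun j _ => differentiableAt_res hz i j

lemma differentiableAt_bRes {z : ℂ} (hz : (1 - z • M.Ac).det ≠ 0) (i : Fin (s + 1)) :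
    DifferentiableAt ℂ (fun z => M.bRes z i) z := by
  simp only [bRes, vecMul, dotProduct]
  exact DifferentiableAt.fun_sum fun j _ =>
    (differentiableAt_const _).mul (differentiableAt_res hz j i)

lemma differentiableAt_Ecoeff {z : ℂ} (hz : (1 - z • M.Ac).det ≠ 0) (i j : Fin (s + 1)) (k : ℕ) :
    DifferentiableAt ℂ (fun z => M.Ecoeff z i j k) z := by
  cases k with
  | zero =>
    simp only [Ecoeff, mul_apply]
    exact DifferentiableAt.fun_sum fun l _ =>
      (differentiableAt_const _).mul (differentiableAt_res hz l j)
  | succ k =>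
    simp only [Ecoeff]
    exact ((differentiableAt_r hz).pow k).mul
      ((differentiableAt_resOne hz i).mul (differentiableAt_bRes hz j))

/-- **Contour representation of the convolution weights.**  For small `ζ`, a point `l` with
`Re (h l) ≤ ρ` or `|h l| ≥ h T` is not an eigenvalue of `Δ(ζ) / h`, so that the contour encloses the
spectrum.  Cauchy's formula gives `K(Δ(ζ) / h)` as an integral of `K(l) (Δ(ζ) - h l)⁻¹`, which is
expanded in powers of `ζ` under the integral sign. -/
theorem weight_eq_chainIntegral (hM : M.Admissible) {ρ : ℝ} (hρ : M.IsStripWidth ρ) {δ : ℝ}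
    (h0 : 0 < δ) (h1 : δ < Real.pi / 2) {K : ℂ → ℝ → ℂ} {d h : ℝ} (hh : 0 < h)
    (hK : DifferentiableOn ℂ (fun l => K l d) (sector δ)) {γ : Arc} {T : ℝ}
    (hs : γ.source = (starRingEnd ℂ) γ.target) (hp0 : 0 ≤ γ.target.im) (hp : γ.target.im ≤ T)
    (hrT : ρ / h < T) (hγ : ∀ z ∈ γ.trace, z.re < ρ / h) (hγδ : γ.trace ⊆ sector δ)
    (hdet : ∀ z : ℂ, h * T ≤ ‖z‖ → (1 - z • M.Ac).det ≠ 0) (n : ℕ) (j : Fin (s + 1)) :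
    M.weight K d h n j = h / (2 * Real.pi * Complex.I) *
      chainIntegral (boxContour γ T) (fun l => K l d * M.e n (h * l) j) := by
  have hr : 0 < ρ / h := div_pos hρ.1 hh
  have hT : 0 < T := hr.trans hrT
  have hC := encloses_boxContour h0 h1 hr hs hp0 hp hrT hγ hγδ
  have hh' : (h : ℂ) ≠ 0 := Complex.ofReal_ne_zero.2 hh.ne'
  -- the closed region without singularities
  set S : Set ℂ := {z | z.re ≤ ρ} ∪ {z | h * T ≤ ‖z‖} with hS
  have hSclosed : IsClosed S :=
    (isClosed_re_le ρ).union (isClosed_le continuous_const continuous_norm)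
  have hSdet : ∀ z ∈ S, (1 - z • M.Ac).det ≠ 0 := by
    rintro z (hz | hz)
    exacts [det_ne_zero_of_re_le hM hρ hz, hdet z hz]
  obtain ⟨B, hB1, hB⟩ := exists_norm_le hM hSclosed hSdet
  have hBle : ∀ z : ℂ, B * (1 + ‖z‖)⁻¹ ≤ B := fun z =>
    mul_le_of_le_one_right (by linarith) (inv_le_one_of_one_le₀ (by linarith [norm_nonneg z]))
  have htar : γ.target ∈ γ.trace := Arc.mem_trace ⟨γ.le, le_rfl⟩
  have hmemS : ∀ z ∈ chainTrace (boxContour γ T), (h : ℂ) * z ∈ S := by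
    intro z hz
    rcases re_lt_or_le_norm hp hT hs hγ (hγ _ htar) hz with h2 | h2
    · left
      rw [Set.mem_ofPred_eq, Complex.re_ofReal_mul]
      rw [lt_div_iff₀ hh] at h2; linarith
    · right
      rw [Set.mem_ofPred_eq, norm_mul, Complex.norm_real, Real.norm_of_nonneg hh.le]
      exact mul_le_mul_of_nonneg_left h2 hh.le
  have hEc : ∀ i k, ContinuousOn (fun z => M.Ecoeff (h * z) i j k)
      (chainTrace (boxContour γ T)) := by
    intro i k z hz
    have h2 := (differentiableAt_Ecoeff (hSdet _ (hmemS z hz)) i j k).continuousAt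
    exact (ContinuousAt.comp (f := fun z : ℂ => h * z) h2 (by fun_prop)).continuousWithinAt
  have hKc : ContinuousOn (fun l => K l d) (chainTrace (boxContour γ T)) :=
    hK.continuousOn.mono hC.trace_subset
  obtain ⟨BK, hBK⟩ := isCompact_chainTrace.exists_bound_of_continuousOn hKc
  obtain ⟨B0, hB0⟩ := isCompact_chainTrace.exists_bound_of_continuousOn (hEc (Fin.last s) 0)
  have htc : γ.target ∈ chainTrace (boxContour γ T) :=
    trace_subset_chainTrace (C := boxContour γ T) 0 htar
  have hBK0 : 0 ≤ BK := (norm_nonneg _).trans (hBK _ htc)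
  have hB00 : 0 ≤ B0 := (norm_nonneg _).trans (hB0 _ htc)
  have hEbound : ∀ k, ∀ z ∈ chainTrace (boxContour γ T),
      ‖M.Ecoeff (h * z) (Fin.last s) j k‖ ≤ (B0 + B ^ 2) * B ^ k := by
    intro k z hz
    obtain ⟨hb1, hb2⟩ := hB _ (hmemS z hz)
    cases k with
    | zero =>
      refine (hB0 z hz).trans ?_
      rw [pow_zero, mul_one]
      nlinarith
    | succ k =>
      simp only [Ecoeff, norm_mul, norm_pow]
      have e1 := hb1.trans (hBle _)
      have e2 := (hb2 (Fin.last s)).1.trans (hBle _)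
      have e3 := (hb2 j).2.trans (hBle _)
      have hBp : (0:ℝ) ≤ B := by linarith
      calc ‖M.r (h * z)‖ ^ k * (‖M.resOne (h * z) (Fin.last s)‖ * ‖M.bRes (h * z) j‖)
          ≤ B ^ k * (B * B) := by gcongr
        _ = B ^ 2 * B ^ k := by ring
        _ ≤ (B0 + B ^ 2) * B ^ (k + 1) := by
          have : B ^ k ≤ B ^ (k + 1) := pow_le_pow_right₀ hB1 (by omega)
          have h5 : B ^ 2 ≤ B0 + B ^ 2 := by linarith
          gcongr
  obtain ⟨ε, hε, hX⟩ := Metric.eventually_nhds_iff.1 (eventually_det_deltaInv_ne_zero hM)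
  have hBpos : 0 < B := by linarith
  have hmain : ∀ ζ : ℂ, ‖ζ‖ < min ε (1 / (2 * B)) →
      HasSum (fun k => h / (2 * Real.pi * Complex.I) * chainIntegral (boxContour γ T)
        (fun l => K l d * M.Ecoeff (h * l) (Fin.last s) j k) * ζ ^ k)
        (matrixFunction (fun l => K l d) ((h : ℂ)⁻¹ • M.Delta ζ) (Fin.last s) j) := by
    intro ζ hζ
    have hζ1 : (M.deltaInv ζ).det ≠ 0 := hX (by simpa using hζ.trans_le (min_le_left _ _))
    have hζ2 : ‖ζ‖ * B < 1 / 2 := by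
      have := hζ.trans_le (min_le_right _ _)
      rw [lt_div_iff₀ (by positivity)] at this
      linarith
    have hζne : ζ ≠ 1 := by
      rintro rfl
      rw [norm_one] at hζ2; linarith
    have hζr : ∀ z ∈ S, ‖ζ * M.r z‖ < 1 := by
      intro z hz
      rw [norm_mul]
      have h2 := (hB z hz).1.trans (hBle z)
      have := mul_le_mul_of_nonneg_left h2 (norm_nonneg ζ)
      linarith
    have hζr' : ∀ z ∈ S, ζ * M.r z ≠ 1 := by
      intro z hz h2
      have := hζr z hz
      rw [h2, norm_one] at this; exact lt_irrefl _ this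
    have hfac : ∀ l : ℂ, l • (1 : Matrix (Fin (s + 1)) (Fin (s + 1)) ℂ) - (h : ℂ)⁻¹ • M.Delta ζ =
        (-(h : ℂ)⁻¹) • (M.Delta ζ - (h * l) • 1) := by
      intro l
      rw [smul_sub, smul_smul, neg_mul, inv_mul_cancel_left₀ hh', neg_smul, neg_smul]
      abel
    have hspec : ∀ l ∈ ((h : ℂ)⁻¹ • M.Delta ζ).charpoly.roots,
        l ∈ {w : ℂ | ρ / h ≤ w.re ∧ ‖w‖ < T} := by
      intro l hl
      rw [Polynomial.mem_roots (Matrix.charpoly_monic _).ne_zero, Polynomial.IsRoot, eval_charpoly,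
        Matrix.scalar_apply, ← Matrix.smul_one_eq_diagonal, hfac, det_smul] at hl
      have hz : (h : ℂ) * l ∉ S := by
        intro hz
        have h2 := det_Delta_sub_ne_zero (hSdet _ hz) hζne (hζr' _ hz) hζ1
        exact (mul_ne_zero (pow_ne_zero _ (neg_ne_zero.2 (inv_ne_zero hh'))) h2) hl
      have h2 : ¬ ((h : ℂ) * l).re ≤ ρ := fun h3 => hz (Or.inl h3)
      have h3 : ¬ h * T ≤ ‖(h : ℂ) * l‖ := fun h3 => hz (Or.inr h3)
      rw [Complex.re_ofReal_mul, not_le] at h2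
      rw [norm_mul, Complex.norm_real, Real.norm_of_nonneg hh.le, not_le] at h3
      refine ⟨?_, lt_of_mul_lt_mul_left h3 hh.le⟩
      rw [div_le_iff₀ hh]; linarith
    have hcauchy := hC.integral_mul_resolvent hspec hK (Fin.last s) j
    have hinv : ∀ l ∈ chainTrace (boxContour γ T),
        K l d * (l • (1 : Matrix (Fin (s + 1)) (Fin (s + 1)) ℂ) - (h : ℂ)⁻¹ • M.Delta ζ)⁻¹
          (Fin.last s) j =
        (-(h : ℂ)) * (K l d * (M.Delta ζ - (h * l) • 1)⁻¹ (Fin.last s) j) := by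
      intro l hl
      have hz := hmemS l hl
      have h2 := det_Delta_sub_ne_zero (hSdet _ hz) hζne (hζr' _ hz) hζ1
      have h3 : (l • (1 : Matrix (Fin (s + 1)) (Fin (s + 1)) ℂ) - (h : ℂ)⁻¹ • M.Delta ζ)⁻¹ =
          (-(h : ℂ)) • (M.Delta ζ - (h * l) • 1)⁻¹ := by
        apply inv_eq_right_inv
        rw [hfac, Matrix.mul_smul, Matrix.smul_mul, smul_smul,
          mul_nonsing_inv _ (isUnit_iff_ne_zero.2 h2), neg_mul_neg, mul_inv_cancel₀ hh', one_smul]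
      rw [h3, Matrix.smul_apply, smul_eq_mul]
      ring
    rw [chainIntegral_congr hinv, chainIntegral_const_mul] at hcauchy
    have hval : matrixFunction (fun l => K l d) ((h : ℂ)⁻¹ • M.Delta ζ) (Fin.last s) j =
        h / (2 * Real.pi * Complex.I) * chainIntegral (boxContour γ T)
          (fun l => K l d * (M.Delta ζ - (h * l) • 1)⁻¹ (Fin.last s) j) := by
      have h2 := Complex.two_pi_I_ne_zero
      rw [div_mul_eq_mul_div, eq_div_iff h2]
      linear_combination hcauchy
    rw [hval]
    have hsum := hasSum_chainIntegral (C := boxContour γ T)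
      (F := fun k l => ζ ^ k * (K l d * M.Ecoeff (h * l) (Fin.last s) j k))
      (f := fun l => K l d * (M.Delta ζ - (h * l) • 1)⁻¹ (Fin.last s) j)
      (u := fun k => BK * (B0 + B ^ 2) * (‖ζ‖ * B) ^ k)
      (fun k => continuousOn_const.mul (hKc.mul (hEc _ k)))
      ((summable_geometric_of_lt_one (by positivity) (by linarith)).mul_left _) ?_ ?_
    · simp only [chainIntegral_const_mul] at hsum
      refine (hsum.mul_left (h / (2 * Real.pi * Complex.I))).congr_fun ?_
      intro k; ring
    · intro k l hl
      rw [norm_mul, norm_mul, norm_pow]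
      calc ‖ζ‖ ^ k * (‖K l d‖ * ‖M.Ecoeff (h * l) (Fin.last s) j k‖)
          ≤ ‖ζ‖ ^ k * (BK * ((B0 + B ^ 2) * B ^ k)) := by
            have := hBK l hl
            have := hEbound k l hl
            gcongr
        _ = _ := by rw [mul_pow]; ring
    · intro l hl
      have hz := hmemS l hl
      refine ((hasSum_Delta_sub_inv (hSdet _ hz) hζne (hζr _ hz) hζ1 (Fin.last s) j).mul_left
        (K l d)).congr_fun ?_
      intro k; ring
  have hcoef := iteratedDeriv_div_factorial_of_hasSum (lt_min hε (by positivity)) hmain n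
  have hw : M.weight K d h n j = iteratedDeriv n (fun ζ => matrixFunction (fun l => K l d)
    ((h : ℂ)⁻¹ • M.Delta ζ) (Fin.last s) j) 0 / (n.factorial : ℂ) := rfl
  rw [hw, hcoef]
  congr 1
  refine chainIntegral_congr fun l hl => ?_
  have : M.e n (h * l) j = M.Ecoeff (h * l) (Fin.last s) j n :=
    E_apply hM (hSdet _ (hmemS l hl)) n (Fin.last s) j
  rw [this]

end RKMethod

end

/-! ### The hyperbola and vertical rays -/

noncomputable section

section Hyperbola

open Complex

variable {α : ℝ}

lemma hyperbola_apply (x y : ℝ) : hyperbola α (x + y * I) =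
    ((1 - Real.sin (α + y) * Real.cosh x : ℝ) : ℂ) +
      ((Real.cos (α + y) * Real.sinh x : ℝ) : ℂ) * I := by
  have h1 : (α : ℂ) - I * (x + y * I) = (α + y : ℝ) - x * I := by
    push_cast; linear_combination -(y : ℂ) * I_sq
  rw [hyperbola, h1, Complex.sin_sub, Complex.sin_mul_I, Complex.cos_mul_I]
  push_cast
  ring

lemma hyperbola_re (x y : ℝ) :
    (hyperbola α (x + y * I)).re = 1 - Real.sin (α + y) * Real.cosh x := by
  rw [hyperbola_apply]; simp [-ofReal_sin, -ofReal_cos, -ofReal_sinh, -ofReal_cosh]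

lemma hyperbola_im (x y : ℝ) :
    (hyperbola α (x + y * I)).im = Real.cos (α + y) * Real.sinh x := by
  rw [hyperbola_apply]; simp [-ofReal_sin, -ofReal_cos, -ofReal_sinh, -ofReal_cosh]

lemma norm_hyperbola (x y : ℝ) :
    ‖hyperbola α (x + y * I)‖ = Real.cosh x - Real.sin (α + y) := by
  have h1 : 0 ≤ Real.cosh x - Real.sin (α + y) := by
    linarith [Real.one_le_cosh x, Real.sin_le_one (α + y)]
  rw [norm_eq_sqrt_sq_add_sq, hyperbola_re, hyperbola_im, ← Real.sqrt_sq h1]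
  congr 1
  have h2 := Real.sin_sq_add_cos_sq (α + y)
  have h3 := Real.cosh_sq x
  rw [mul_pow, Real.cos_sq']
  nlinarith [Real.cosh_sq x]

lemma hasDerivAt_hyperbola (z : ℂ) :
    HasDerivAt (hyperbola α) (I * cos (α - I * z)) z := by
  have h1 : HasDerivAt (fun z : ℂ => (α : ℂ) - I * z) (-I) z := by
    simpa using ((hasDerivAt_id z).const_mul I).const_sub (α : ℂ)
  refine (h1.csin.const_sub 1).congr_deriv ?_
  ring

lemma deriv_hyperbola (z : ℂ) : deriv (hyperbola α) z = I * cos (α - I * z) :=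
  (hasDerivAt_hyperbola z).deriv

lemma norm_deriv_hyperbola_le (x y : ℝ) :
    ‖deriv (hyperbola α) (x + y * I)‖ ≤ Real.cosh x := by
  have h1 : (α : ℂ) - I * (x + y * I) = (α + y : ℝ) - x * I := by
    push_cast; linear_combination -(y : ℂ) * I_sq
  have h2 : cos ((α + y : ℝ) - x * I) = ((Real.cos (α + y) * Real.cosh x : ℝ) : ℂ) +
      ((Real.sin (α + y) * Real.sinh x : ℝ) : ℂ) * I := by
    rw [Complex.cos_sub, Complex.sin_mul_I, Complex.cos_mul_I]
    push_cast
    ring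
  have hc := Real.cosh_pos x
  rw [deriv_hyperbola, norm_mul, norm_I, one_mul, h1, h2, norm_add_mul_I]
  refine Real.sqrt_le_iff.2 ⟨hc.le, ?_⟩
  have h3 := Real.sin_sq_add_cos_sq (α + y)
  have h4 := Real.cosh_sq x
  nlinarith [sq_nonneg (Real.sin (α + y)), sq_nonneg (Real.sinh x)]

lemma hyperbola_mem_sector {δ : ℝ} (h0 : 0 < δ) (h1 : δ < Real.pi / 2) {x y : ℝ}
    (hy0 : 0 ≤ Real.sin (α + y)) (hy : Real.sin (α + y) < Real.cos δ) :
    hyperbola α (x + y * I) ∈ sector δ := by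
  rw [mem_sector_iff h0 h1, hyperbola_re, norm_hyperbola]
  have h2 := Real.one_le_cosh x
  have h3 := cos_lt_one_of_lt h0 h1
  have h4 := cos_pos_of_lt h0 h1
  nlinarith

/-- The arc `x ↦ ν φ(x)`, `|x| ≤ X`, on the dilated hyperbola. -/
def hyperbolaArc (α ν X : ℝ) (hX : 0 ≤ X) : Arc where
  toFun x := ν * hyperbola α x
  vel x := ν * (I * cos (α - I * x))
  lo := -X
  hi := X
  le := by linarith
  hasDerivAt x := by
    have := (hasDerivAt_hyperbola (α := α) (x : ℂ)).comp_ofReal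
    exact this.const_mul (ν : ℂ)
  continuous_vel := by fun_prop

lemma hyperbola_ofReal (x : ℝ) : hyperbola α x = hyperbola α (x + (0:ℝ) * I) := by simp

lemma hyperbolaArc_source (ν X : ℝ) (hX : 0 ≤ X) : (hyperbolaArc α ν X hX).source =
    (starRingEnd ℂ) (hyperbolaArc α ν X hX).target := by
  have h1 : (hyperbolaArc α ν X hX).source = ν * hyperbola α ((-X : ℝ) : ℂ) := rfl
  have h2 : (hyperbolaArc α ν X hX).target = ν * hyperbola α (X : ℂ) := rfl
  rw [h1, h2, hyperbola_ofReal, hyperbola_ofReal X, hyperbola_apply, hyperbola_apply, map_mul,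
    conj_ofReal, map_add, map_mul, conj_ofReal, conj_ofReal, conj_I, Real.cosh_neg, Real.sinh_neg]
  push_cast
  ring

end Hyperbola

section Ray

lemma Arc.integral_segment_reverse (p q : ℂ) (f : ℂ → ℂ) :
    (Arc.segment q p).integral f = -(Arc.segment p q).integral f := by
  have h := intervalIntegral.integral_comp_sub_left (a := 0) (b := 1)
    (fun t : ℝ => f (p + t * (q - p)) * (q - p)) 1
  simp only [sub_self, sub_zero] at h
  simp only [Arc.integral, Arc.segment_lo, Arc.segment_hi, Arc.segment_toFun, Arc.segment_vel]
  rw [← h, ← intervalIntegral.integral_neg]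
  refine intervalIntegral.integral_congr fun t _ => ?_
  have : p + ((1 - t : ℝ) : ℂ) * (q - p) = q + t * (p - q) := by push_cast; ring
  simp only [this]
  ring

/-- The integral of a function decaying like `|z| ^ (-p)`, `p > 1`, along a vertical ray.  The
bound does not depend on the upper end of the ray.  It comes from comparing `|x₀ + i y|` with
`|x₀| + |y|`, whose powers have explicit primitives. -/
lemma norm_integral_vertical_le {x₀ η T B p : ℝ} (hp : 1 < p) (hη : 0 ≤ η) (hηT : η ≤ T)
    (hx : x₀ ≠ 0) (hB : 0 ≤ B) (s : ℝ) (hs : s = 1 ∨ s = -1) {f : ℂ → ℂ}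
    (hb : ∀ y, η ≤ y → ‖f (x₀ + (s * y : ℝ) * Complex.I)‖ ≤
      B * ‖(x₀ + (s * y : ℝ) * Complex.I : ℂ)‖ ^ (-p)) :
    ‖(Arc.segment (x₀ + (s * η : ℝ) * Complex.I) (x₀ + (s * T : ℝ) * Complex.I)).integral f‖ ≤
      B * (2 ^ p / (p - 1)) * ‖(x₀ + (s * η : ℝ) * Complex.I : ℂ)‖ ^ (1 - p) := by
  have hs1 : |s| = 1 := by rcases hs with rfl | rfl <;> simp
  have hx0 : 0 < |x₀| := abs_pos.2 hx
  have hp0 : 0 < p - 1 := by linarith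
  have hnorm : ∀ y : ℝ, 0 ≤ y → (|x₀| + y) / 2 ≤ ‖(x₀ + (s * y : ℝ) * Complex.I : ℂ)‖ := by
    intro y hy
    have h1 := Complex.abs_re_le_norm (x₀ + (s * y : ℝ) * Complex.I : ℂ)
    have h2 := Complex.abs_im_le_norm (x₀ + (s * y : ℝ) * Complex.I : ℂ)
    simp [abs_mul, hs1, abs_of_nonneg hy] at h1 h2
    push_cast
    linarith
  have hnorm2 : ‖(x₀ + (s * η : ℝ) * Complex.I : ℂ)‖ ≤ |x₀| + η := by
    refine (norm_add_le _ _).trans ?_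
    simp [hs1, abs_of_nonneg hη]
  have hA : 0 < |x₀| + η := by linarith
  have hΔ : 0 ≤ T - η := by linarith
  have hpos : ∀ t ∈ Set.Icc (0:ℝ) 1, 0 < |x₀| + η + t * (T - η) := fun t ht => by
    have := mul_nonneg ht.1 hΔ; linarith
  have hcont : ContinuousOn (fun t : ℝ => B * 2 ^ p *
      ((|x₀| + η + t * (T - η)) ^ (-p) * (T - η))) (Set.uIcc 0 1) := by
    rw [Set.uIcc_of_le zero_le_one]
    refine continuousOn_const.mul (ContinuousOn.mul (ContinuousOn.rpow_const (by fun_prop)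
      fun t ht => Or.inl (hpos t ht).ne') continuousOn_const)
  have h1 : ‖(Arc.segment (x₀ + (s * η : ℝ) * Complex.I)
      (x₀ + (s * T : ℝ) * Complex.I)).integral f‖ ≤
      ∫ t in (0:ℝ)..1, B * 2 ^ p * ((|x₀| + η + t * (T - η)) ^ (-p) * (T - η)) := by
    refine intervalIntegral.norm_integral_le_of_norm_le zero_le_one
      (Eventually.of_forall fun t ht => ?_) hcont.intervalIntegrable
    have ht' := Set.Ioc_subset_Icc_self ht
    have hy : η ≤ η + t * (T - η) := by have := mul_nonneg ht'.1 hΔ; linarith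
    have hpt : (x₀ + (s * η : ℝ) * Complex.I + t * ((x₀ + (s * T : ℝ) * Complex.I) -
        (x₀ + (s * η : ℝ) * Complex.I)) : ℂ) =
        x₀ + (s * (η + t * (T - η)) : ℝ) * Complex.I := by push_cast; ring
    have hvel : ‖((x₀ + (s * T : ℝ) * Complex.I) - (x₀ + (s * η : ℝ) * Complex.I) : ℂ)‖ =
        T - η := by
      have : ((x₀ + (s * T : ℝ) * Complex.I) - (x₀ + (s * η : ℝ) * Complex.I) : ℂ) =
          ((s * (T - η) : ℝ) : ℂ) * Complex.I := by push_cast; ring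
      rw [this, norm_mul, Complex.norm_I, mul_one, Complex.norm_real, Real.norm_eq_abs, abs_mul,
        hs1, one_mul, abs_of_nonneg hΔ]
    rw [norm_mul, Arc.segment_toFun, Arc.segment_vel, hpt, hvel, ← mul_assoc]
    refine mul_le_mul_of_nonneg_right ((hb _ hy).trans ?_) hΔ
    rw [mul_assoc]
    refine mul_le_mul_of_nonneg_left ?_ hB
    have h2 := hnorm (η + t * (T - η)) (hη.trans hy)
    rw [← add_assoc] at h2
    have h3 := Real.rpow_le_rpow_of_nonpos (half_pos (hpos t ht')) h2 (by linarith : -p ≤ 0)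
    refine h3.trans (le_of_eq ?_)
    rw [Real.div_rpow (hpos t ht').le (by norm_num), Real.rpow_neg (by norm_num : (0:ℝ) ≤ 2)]
    field_simp
  refine h1.trans ?_
  have h2 : ∀ t ∈ Set.uIcc (0:ℝ) 1, HasDerivAt
      (fun t => B * 2 ^ p * (-(p - 1)⁻¹ * (|x₀| + η + t * (T - η)) ^ (1 - p)))
      (B * 2 ^ p * ((|x₀| + η + t * (T - η)) ^ (-p) * (T - η))) t := by
    intro t ht
    rw [Set.uIcc_of_le zero_le_one] at ht
    have h3 : HasDerivAt (fun t => |x₀| + η + t * (T - η)) (T - η) t := by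
      simpa using ((hasDerivAt_id t).mul_const (T - η)).const_add (|x₀| + η)
    have h4 := ((h3.rpow_const (p := 1 - p) (Or.inl (hpos t ht).ne')).const_mul
      (-(p - 1)⁻¹)).const_mul (B * 2 ^ p)
    refine h4.congr_deriv ?_
    have : (1 - p - 1 : ℝ) = -p := by ring
    rw [this]
    field_simp
    ring
  rw [intervalIntegral.integral_eq_sub_of_hasDerivAt h2 hcont.intervalIntegrable]
  have h5 : 0 ≤ (|x₀| + η + 1 * (T - η)) ^ (1 - p) := Real.rpow_nonneg (hpos 1 (by simp)).le _
  have h6 : (|x₀| + η) ^ (1 - p) ≤ ‖(x₀ + (s * η : ℝ) * Complex.I : ℂ)‖ ^ (1 - p) := by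
    refine Real.rpow_le_rpow_of_nonpos ?_ hnorm2 (by linarith)
    exact (half_pos hA).trans_le (hnorm η hη)
  have h7 : 0 ≤ B * 2 ^ p * (p - 1)⁻¹ := by positivity
  have h8 := mul_le_mul_of_nonneg_left h6 h7
  have h9 := mul_nonneg h7 h5
  rw [zero_mul, add_zero]
  calc _ = B * 2 ^ p * (p - 1)⁻¹ * (|x₀| + η) ^ (1 - p) -
      B * 2 ^ p * (p - 1)⁻¹ * (|x₀| + η + 1 * (T - η)) ^ (1 - p) := by ring
    _ ≤ B * 2 ^ p * (p - 1)⁻¹ * ‖(x₀ + (s * η : ℝ) * Complex.I : ℂ)‖ ^ (1 - p) := by linarith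
    _ = _ := by ring

/-- Two quantities of comparable size have comparable powers, of either sign. -/
lemma rpow_le_of_comparable {c t v : ℝ} (hc : 0 < c) (ht : 0 < t) (h1 : c * t ≤ v) (h2 : v ≤ t)
    (μ : ℝ) : v ^ μ ≤ (1 + c ^ μ) * t ^ μ := by
  have hv : 0 < v := (mul_pos hc ht).trans_le h1
  have hcμ : 0 < c ^ μ := Real.rpow_pos_of_pos hc μ
  have htμ : 0 < t ^ μ := Real.rpow_pos_of_pos ht μ
  rcases le_total 0 μ with hμ | hμ
  · have := Real.rpow_le_rpow hv.le h2 hμ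
    nlinarith
  · have := Real.rpow_le_rpow_of_nonpos (mul_pos hc ht) h1 hμ
    rw [Real.mul_rpow hc.le ht.le] at this
    nlinarith

end Ray

namespace RKMethod

open Matrix

variable {s : ℕ} {M : RKMethod s}

lemma differentiableAt_e (hM : M.Admissible) {ρ : ℝ} (hρ : M.IsStripWidth ρ) {z : ℂ}
    (hz : z.re < ρ) (n : ℕ) (j : Fin (s + 1)) : DifferentiableAt ℂ (fun z => M.e n z j) z := by
  have h1 := differentiableAt_Ecoeff (det_ne_zero_of_re_le hM hρ hz.le) (Fin.last s) j n
  refine h1.congr_of_eventuallyEq ?_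
  have h2 : {w : ℂ | w.re < ρ} ∈ 𝓝 z :=
    (isOpen_lt Complex.continuous_re continuous_const).mem_nhds hz
  filter_upwards [h2] with w hw
  exact E_apply hM (det_ne_zero_of_re_le hM hρ (le_of_lt hw)) n (Fin.last s) j

/-- At infinity, `eₙ(z) = O(|z|⁻⁽ⁿ⁺¹⁾)`. -/
lemma exists_norm_e_far_le (hM : M.Admissible) {n : ℕ} (hn : 1 ≤ n) :
    ∃ R C : ℝ, 0 < C ∧ ∀ z : ℂ, R ≤ ‖z‖ → (1 - z • M.Ac).det ≠ 0 ∧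
      ∀ j, ‖M.e n z j‖ ≤ C * ((1 + ‖z‖)⁻¹) ^ (n + 1) := by
  have h1 := (res_cocompact hM).1
  rw [← Metric.cobounded_eq_cocompact] at h1
  obtain ⟨R, -, hR⟩ := (Filter.hasBasis_cobounded_norm (E := ℂ)).eventually_iff.1 h1
  obtain ⟨C, hC, hb⟩ := exists_norm_le hM (S := {z : ℂ | R ≤ ‖z‖})
    (isClosed_le continuous_const continuous_norm) (fun z hz => hR hz)
  obtain ⟨k, rfl⟩ : ∃ k, n = k + 1 := ⟨n - 1, by omega⟩
  refine ⟨R, C ^ (k + 2), by positivity, fun z hz => ⟨hR hz, fun j => ?_⟩⟩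
  obtain ⟨hr, h2⟩ := hb z hz
  have he : M.e (k + 1) z j = M.r z ^ k * (M.resOne z (Fin.last s) * M.bRes z j) :=
    E_apply hM (hR hz) (k + 1) (Fin.last s) j
  rw [he, norm_mul, norm_mul, norm_pow]
  have hp := (h2 (Fin.last s)).1
  have hq := (h2 j).2
  have hC0 : 0 < C := by linarith
  set y : ℝ := (1 + ‖z‖)⁻¹ with hy
  have hy0 : 0 < y := by positivity
  calc ‖M.r z‖ ^ k * (‖M.resOne z (Fin.last s)‖ * ‖M.bRes z j‖)
      ≤ (C * y) ^ k * ((C * y) * (C * y)) := by gcongr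
    _ = _ := by ring

end RKMethod

end

/-! ### Truncation of the contour -/

noncomputable section

section Closing

/-- Closing a symmetric arc by two vertical rays: if the integrand decays along the rays and at
infinity, then the integral over the box contour differs from that over the arc by the two ray
integrals, up to a quantity that vanishes as the box grows. -/
lemma norm_chainIntegral_boxContour_sub_le {γ : Arc} {δ R T B p Q q : ℝ} {G : ℂ → ℂ}
    (h0 : 0 < δ) (h1 : δ < Real.pi / 2) (hs : γ.source = (starRingEnd ℂ) γ.target)
    (hre : γ.target.re < 0) (him : 0 ≤ γ.target.im) (hδ : γ.target ∈ sector δ)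
    (hp : 1 < p) (hB : 0 ≤ B)
    (hray : ∀ z : ℂ, z.re = γ.target.re → γ.target.im ≤ |z.im| → ‖G z‖ ≤ B * ‖z‖ ^ (-p))
    (hq : 0 ≤ q) (hQ : 0 ≤ Q)
    (hfar : ∀ z ∈ sector δ, γ.target.re ≤ z.re → R ≤ ‖z‖ → ‖G z‖ ≤ Q * ‖z‖ ^ (-q))
    (hT : 0 < T) (hT1 : γ.target.im ≤ T) (hT2 : -γ.target.re ≤ T) (hT3 : R ≤ T) :
    ‖chainIntegral (boxContour γ T) G - γ.integral G‖ ≤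
      2 * (B * (2 ^ p / (p - 1)) * ‖γ.target‖ ^ (1 - p)) + 6 * (Q * T ^ (-q) * T) := by
  rw [chainIntegral_boxContour]
  set x₀ := γ.target.re with hx₀
  set η := γ.target.im with hη
  have ht : γ.target = x₀ + ((1 * η : ℝ) : ℂ) * Complex.I := by
    apply Complex.ext <;> simp [hx₀, hη]
  have hsr : γ.source = x₀ + ((-1 * η : ℝ) : ℂ) * Complex.I := by
    rw [hs]; apply Complex.ext <;> simp [hx₀, hη]
  have hnt : ‖γ.source‖ = ‖γ.target‖ := by rw [hs, Complex.norm_conj]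
  have hup : ‖(Arc.segment γ.target (x₀ + T * Complex.I)).integral G‖ ≤
      B * (2 ^ p / (p - 1)) * ‖γ.target‖ ^ (1 - p) := by
    have := norm_integral_vertical_le hp him hT1 hre.ne hB 1 (Or.inl rfl) (f := G)
      fun y hy => hray _ (by simp) (by simpa using hy.trans (le_abs_self y))
    rw [← ht] at this
    simpa using this
  have hlow : ‖(Arc.segment (x₀ - T * Complex.I) γ.source).integral G‖ ≤
      B * (2 ^ p / (p - 1)) * ‖γ.target‖ ^ (1 - p) := by
    have := norm_integral_vertical_le hp him hT1 hre.ne hB (-1) (Or.inr rfl) (f := G)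
      fun y hy => hray _ (by simp) (by simpa using hy.trans (le_abs_self y))
    rw [← hsr, hnt, ← norm_neg, ← Arc.integral_segment_reverse] at this
    have h2 : (x₀ + ((-1 * T : ℝ) : ℂ) * Complex.I : ℂ) = x₀ - T * Complex.I := by
      push_cast; ring
    rwa [h2] at this
  have hTL : (x₀ + T * Complex.I : ℂ) ∈ sector δ := by
    refine mem_sector_of_vertical h0 h1 hδ (by simp [hx₀]) ?_
    rw [← hη, abs_of_nonneg him]; simpa [abs_of_pos hT] using hT1
  have hBL : (x₀ - T * Complex.I : ℂ) ∈ sector δ := by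
    refine mem_sector_of_vertical h0 h1 hδ (by simp [hx₀]) ?_
    rw [← hη, abs_of_nonneg him]; simpa [abs_of_pos hT] using hT1
  have hval : ∀ z ∈ sector δ, x₀ ≤ z.re → T ≤ ‖z‖ → ‖G z‖ ≤ Q * T ^ (-q) := by
    intro z hz hzr hzT
    refine (hfar z hz hzr (hT3.trans hzT)).trans ?_
    exact mul_le_mul_of_nonneg_left (Real.rpow_le_rpow_of_nonpos hT hzT (by linarith)) hQ
  have hQT : 0 ≤ Q * T ^ (-q) := mul_nonneg hQ (Real.rpow_nonneg hT.le _)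
  have hw : 0 ≤ T - x₀ := by linarith
  have htop : ‖(Arc.segment (x₀ + T * Complex.I) (T + T * Complex.I)).integral G‖ ≤
      Q * T ^ (-q) * (2 * T) := by
    refine (Arc.norm_integral_segment_le fun t ht => hval _ ?_ ?_ ?_).trans
      (mul_le_mul_of_nonneg_left ?_ hQT)
    · have := add_mem_sector h0 h1 hTL (mul_nonneg ht.1 hw)
      convert this using 1; push_cast; ring
    · have := mul_nonneg ht.1 hw
      simp; linarith
    · refine le_trans ?_ (Complex.abs_im_le_norm _)
      simp [abs_of_pos hT]
    · rw [show (T + T * Complex.I - (x₀ + T * Complex.I) : ℂ) = ((T - x₀ : ℝ) : ℂ) by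
        push_cast; ring, Complex.norm_real, Real.norm_of_nonneg hw]
      linarith
  have hbot : ‖(Arc.segment (T - T * Complex.I) (x₀ - T * Complex.I)).integral G‖ ≤
      Q * T ^ (-q) * (2 * T) := by
    refine (Arc.norm_integral_segment_le fun t ht => hval _ ?_ ?_ ?_).trans
      (mul_le_mul_of_nonneg_left ?_ hQT)
    · have := add_mem_sector h0 h1 hBL (mul_nonneg (sub_nonneg.2 ht.2) hw)
      convert this using 1; push_cast; ring
    · have := mul_nonneg (sub_nonneg.2 ht.2) hw
      simp; linarith
    · refine le_trans ?_ (Complex.abs_im_le_norm _)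
      simp [abs_of_pos hT]
    · rw [show (x₀ - T * Complex.I - (T - T * Complex.I) : ℂ) = ((-(T - x₀) : ℝ) : ℂ) by
        push_cast; ring, Complex.norm_real, norm_neg, Real.norm_of_nonneg hw]
      linarith
  have hright : ‖(Arc.segment (T + T * Complex.I) (T - T * Complex.I)).integral G‖ ≤
      Q * T ^ (-q) * (2 * T) := by
    refine (Arc.norm_integral_segment_le fun t ht => hval _ ?_ ?_ ?_).trans
      (mul_le_mul_of_nonneg_left ?_ hQT)
    · exact mem_sector_of_re_pos h0 h1 (by simpa using hT)
    · simp; linarith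
    · refine le_trans (le_abs_self T) (le_trans (le_of_eq ?_) (Complex.abs_re_le_norm _))
      simp
    · rw [show (T - T * Complex.I - (T + T * Complex.I) : ℂ) = ((-(2 * T) : ℝ) : ℂ) * Complex.I by
        push_cast; ring, norm_mul, Complex.norm_I, Complex.norm_real, norm_neg,
        Real.norm_of_nonneg (by linarith), mul_one]
  have htri : ∀ a u v w x y : ℂ, ‖(a + u + v + w + x + y) - a‖ ≤ ‖u‖ + ‖v‖ + ‖w‖ + ‖x‖ + ‖y‖ := by
    intro a u v w x y
    rw [show a + u + v + w + x + y - a = u + v + w + x + y by ring]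
    exact (norm_add_le _ _).trans (add_le_add_left norm_add₄_le _)
  refine (htri _ _ _ _ _ _).trans ?_
  linarith

end Closing

section KernelBounds

variable {δ d Cd μ : ℝ} {K : ℂ → ℝ → ℂ}

lemma norm_kernel_le (hKb : ∀ l ∈ sector δ, ‖Complex.exp (l * d) * K l d‖ ≤ Cd * ‖l‖ ^ μ) {l : ℂ}
    (hl : l ∈ sector δ) : ‖K l d‖ ≤ Cd * ‖l‖ ^ μ * Real.exp (-(d * l.re)) := by
  have h := hKb l hl
  rw [norm_mul, Complex.norm_exp, Complex.re_mul_ofReal] at h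
  rw [Real.exp_neg, ← div_eq_mul_inv, le_div_iff₀ (Real.exp_pos _)]
  rw [mul_comm d]; linarith

lemma kernel_const_nonneg (h0 : 0 < δ) (h1 : δ < Real.pi / 2)
    (hKb : ∀ l ∈ sector δ, ‖Complex.exp (l * d) * K l d‖ ≤ Cd * ‖l‖ ^ μ) : 0 ≤ Cd := by
  have := hKb 1 (mem_sector_of_re_pos h0 h1 (by simp))
  rw [norm_one, Real.one_rpow, mul_one] at this
  exact (norm_nonneg _).trans this

namespace RKMethod

variable {s : ℕ} {M : RKMethod s} {h t₀ D ξ ρ C₁ : ℝ} {m n : ℕ}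

/-- To the left of the imaginary axis, the decay `|r| ≤ exp (γ Re z)` of the stability function
outweighs the growth `exp (-d Re λ)` of the kernel, since `d ≤ D γ t₀`.  The missing factors of `r`
cost at most `exp (κ γ ξ)`. -/
lemma norm_kernel_mul_e_le_left (hM : M.Admissible)
    (hKb : ∀ l ∈ sector δ, ‖Complex.exp (l * d) * K l d‖ ≤ Cd * ‖l‖ ^ μ) (hCd : 0 ≤ Cd)
    (hC₁ : 0 ≤ C₁) (hh : 0 < h) (hγ : 0 ≤ M.gam ξ) (hd : d ≤ D * M.gam ξ * t₀)
    (hn : t₀ ≤ n * h) (hκ : M.loss m ≤ n) {l : ℂ} (hl : l ∈ sector δ) (hξ : -ξ ≤ h * l.re)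
    (hl0 : l.re ≤ 0) {w : ℂ}
    (he : ‖w‖ ≤ C₁ * ‖M.r (h * l)‖ ^ (n - M.loss m) * ((1 + ‖(h * l : ℂ)‖)⁻¹) ^ (m + 1)) :
    ‖K l d * w‖ ≤ Cd * C₁ * Real.exp (M.loss m * (M.gam ξ * ξ)) *
      Real.exp (M.gam ξ * (1 - D) * t₀ * l.re) * (‖l‖ ^ μ * ((1 + h * ‖l‖)⁻¹) ^ (m + 1)) := by
  have hre : (h * l : ℂ).re = h * l.re := Complex.re_ofReal_mul _ _
  have hnorm : ‖(h * l : ℂ)‖ = h * ‖l‖ := by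
    rw [norm_mul, Complex.norm_real, Real.norm_of_nonneg hh.le]
  have hr := norm_r_le_exp_gam hM (ξ := ξ) (z := h * l) (by rw [hre]; exact hξ)
    (by rw [hre]; exact mul_nonpos_of_nonneg_of_nonpos hh.le hl0)
  rw [hre] at hr
  rw [hnorm] at he
  have hr2 : ‖M.r (h * l)‖ ^ (n - M.loss m) ≤
      Real.exp (((n : ℝ) - M.loss m) * (M.gam ξ * (h * l.re))) := by
    refine (pow_le_pow_left₀ (norm_nonneg _) hr _).trans (le_of_eq ?_)
    rw [← Real.exp_nat_mul, Nat.cast_sub hκ]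
  have hexp : Real.exp (-(d * l.re)) * Real.exp (((n : ℝ) - M.loss m) * (M.gam ξ * (h * l.re))) ≤
      Real.exp (M.loss m * (M.gam ξ * ξ)) * Real.exp (M.gam ξ * (1 - D) * t₀ * l.re) := by
    rw [← Real.exp_add, ← Real.exp_add]
    refine Real.exp_le_exp.2 ?_
    have e1 : (D * M.gam ξ * t₀ - d) * l.re ≤ 0 :=
      mul_nonpos_of_nonneg_of_nonpos (by linarith) hl0
    have e2 : M.gam ξ * (n * h - t₀) * l.re ≤ 0 :=
      mul_nonpos_of_nonneg_of_nonpos (mul_nonneg hγ (by linarith)) hl0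
    have e3 : 0 ≤ M.loss m * M.gam ξ * (ξ + h * l.re) := by
      have : 0 ≤ ξ + h * l.re := by linarith
      positivity
    linarith
  have hlμ : 0 ≤ ‖l‖ ^ μ := Real.rpow_nonneg (norm_nonneg _) _
  have hy : 0 ≤ (1 + h * ‖l‖)⁻¹ := by positivity
  rw [norm_mul]
  calc ‖K l d‖ * ‖w‖ ≤ (Cd * ‖l‖ ^ μ * Real.exp (-(d * l.re))) *
        (C₁ * Real.exp (((n : ℝ) - M.loss m) * (M.gam ξ * (h * l.re))) *
          ((1 + h * ‖l‖)⁻¹) ^ (m + 1)) := by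
        refine mul_le_mul (norm_kernel_le hKb hl) (he.trans ?_) (norm_nonneg _) (by positivity)
        gcongr
    _ = Cd * C₁ * (Real.exp (-(d * l.re)) *
        Real.exp (((n : ℝ) - M.loss m) * (M.gam ξ * (h * l.re)))) *
        (‖l‖ ^ μ * ((1 + h * ‖l‖)⁻¹) ^ (m + 1)) := by ring
    _ ≤ Cd * C₁ * (Real.exp (M.loss m * (M.gam ξ * ξ)) *
        Real.exp (M.gam ξ * (1 - D) * t₀ * l.re)) *
        (‖l‖ ^ μ * ((1 + h * ‖l‖)⁻¹) ^ (m + 1)) := by gcongr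
    _ = _ := by ring

/-- To the right of the imaginary axis the kernel is harmless, and `|r| ≤ exp (2 Re z)`. -/
lemma norm_kernel_mul_e_le_right (hρ : M.IsStripWidth ρ)
    (hKb : ∀ l ∈ sector δ, ‖Complex.exp (l * d) * K l d‖ ≤ Cd * ‖l‖ ^ μ) (hCd : 0 ≤ Cd)
    (hd : 0 ≤ d) (hC₁ : 0 ≤ C₁) (hh : 0 < h) {l : ℂ} (hl : l ∈ sector δ) (hl0 : 0 ≤ l.re)
    (hlρ : h * l.re ≤ ρ) {w : ℂ}
    (he : ‖w‖ ≤ C₁ * ‖M.r (h * l)‖ ^ (n - M.loss m) * ((1 + ‖(h * l : ℂ)‖)⁻¹) ^ (m + 1)) :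
    ‖K l d * w‖ ≤ Cd * C₁ * Real.exp (2 * (n * h) * l.re) *
      (‖l‖ ^ μ * ((1 + h * ‖l‖)⁻¹) ^ (m + 1)) := by
  have hre : (h * l : ℂ).re = h * l.re := Complex.re_ofReal_mul _ _
  have hnorm : ‖(h * l : ℂ)‖ = h * ‖l‖ := by
    rw [norm_mul, Complex.norm_real, Real.norm_of_nonneg hh.le]
  have hx : 0 ≤ h * l.re := mul_nonneg hh.le hl0
  have hr := (hρ.2 (h * l) (by rwa [hre]) (by rwa [hre])).2
  have h2re : (2 * (h * l) : ℂ).re = 2 * (h * l.re) := by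
    rw [← hre]; simp
  rw [Complex.norm_exp, h2re] at hr
  rw [hnorm] at he
  have hr2 : ‖M.r (h * l)‖ ^ (n - M.loss m) ≤ Real.exp (2 * (n * h) * l.re) := by
    refine (pow_le_pow_left₀ (norm_nonneg _) hr _).trans ?_
    refine (pow_le_pow_right₀ (Real.one_le_exp (by linarith)) (Nat.sub_le n _)).trans
      (le_of_eq ?_)
    rw [← Real.exp_nat_mul]; congr 1; ring
  have hlμ : 0 ≤ ‖l‖ ^ μ := Real.rpow_nonneg (norm_nonneg _) _
  have hk : ‖K l d‖ ≤ Cd * ‖l‖ ^ μ := by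
    refine (norm_kernel_le hKb hl).trans (mul_le_of_le_one_right (by positivity) ?_)
    exact Real.exp_le_one_iff.2 (neg_nonpos.2 (mul_nonneg hd hl0))
  have hy : 0 ≤ (1 + h * ‖l‖)⁻¹ := by positivity
  rw [norm_mul]
  calc ‖K l d‖ * ‖w‖ ≤ (Cd * ‖l‖ ^ μ) *
        (C₁ * Real.exp (2 * (n * h) * l.re) * ((1 + h * ‖l‖)⁻¹) ^ (m + 1)) := by
        refine mul_le_mul hk (he.trans ?_) (norm_nonneg _) (by positivity)
        gcongr
    _ = _ := by ring

/-- The weight is a contour integral over the arc `γ`, up to the contributions of the two vertical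
rays at its ends: the far sides of the box contour disappear as the box grows, because
`K eₙ = O(|λ| ^ (μ - n - 1))` to the right of the end points of the arc and `μ < n`. -/
lemma norm_weight_sub_arc_integral_le (hM : M.Admissible) (hρ : M.IsStripWidth ρ) (h0 : 0 < δ)
    (h1 : δ < Real.pi / 2) (hh : 0 < h) (hK : DifferentiableOn ℂ (fun l => K l d) (sector δ))
    (hKb : ∀ l ∈ sector δ, ‖Complex.exp (l * d) * K l d‖ ≤ Cd * ‖l‖ ^ μ) (hd : 0 ≤ d)
    (hn : 1 ≤ n) (hμ : μ < n) {γ : Arc} (hs : γ.source = (starRingEnd ℂ) γ.target)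
    (hre : γ.target.re < 0) (him : 0 ≤ γ.target.im)
    (hγ : ∀ z ∈ γ.trace, z.re < ρ / h) (hγδ : γ.trace ⊆ sector δ) {B p : ℝ} (hp : 1 < p)
    (hB : 0 ≤ B) (j : Fin (s + 1))
    (hray : ∀ z ∈ sector δ, z.re = γ.target.re → ‖K z d * M.e n (h * z) j‖ ≤ B * ‖z‖ ^ (-p)) :
    ‖M.weight K d h n j -
      h / (2 * Real.pi * Complex.I) * γ.integral (fun l => K l d * M.e n (h * l) j)‖ ≤
      h / (2 * Real.pi) * (2 * (B * (2 ^ p / (p - 1)) * ‖γ.target‖ ^ (1 - p))) := by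
  obtain ⟨R, C, hC, hfar⟩ := exists_norm_e_far_le hM hn
  have hCd := kernel_const_nonneg h0 h1 hKb
  have hδ : γ.target ∈ sector δ := hγδ (Arc.mem_trace (Set.right_mem_Icc.2 γ.le))
  set x₀ := γ.target.re with hx₀
  set Q : ℝ := Cd * Real.exp (-(d * x₀)) * (C * (h⁻¹) ^ (n + 1)) with hQ
  have hQ0 : 0 ≤ Q := by positivity
  have hnorm : ∀ z : ℂ, ‖(h * z : ℂ)‖ = h * ‖z‖ := fun z => by
    rw [norm_mul, Complex.norm_real, Real.norm_of_nonneg hh.le]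
  have hfarG : ∀ z ∈ sector δ, x₀ ≤ z.re → R / h ≤ ‖z‖ →
      ‖K z d * M.e n (h * z) j‖ ≤ Q * ‖z‖ ^ (-((n : ℝ) + 1 - μ)) := by
    intro z hz hzr hzR
    have hzn : 0 < ‖z‖ := norm_pos_iff.2 hz.1
    have e1 := norm_kernel_le hKb hz
    have e2 := (hfar (h * z) (by rw [hnorm, mul_comm]; exact (div_le_iff₀ hh).1 hzR)).2 j
    rw [hnorm] at e2
    have e3 : Real.exp (-(d * z.re)) ≤ Real.exp (-(d * x₀)) :=
      Real.exp_le_exp.2 (neg_le_neg (mul_le_mul_of_nonneg_left hzr hd))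
    have e4 : (1 + h * ‖z‖)⁻¹ ≤ h⁻¹ * ‖z‖⁻¹ := by
      rw [← mul_inv]; exact inv_anti₀ (by positivity) (by linarith)
    have hlμ : 0 ≤ ‖z‖ ^ μ := Real.rpow_nonneg (norm_nonneg _) _
    rw [norm_mul]
    calc ‖K z d‖ * ‖M.e n (h * z) j‖
        ≤ (Cd * ‖z‖ ^ μ * Real.exp (-(d * x₀))) * (C * (h⁻¹ * ‖z‖⁻¹) ^ (n + 1)) := by
          refine mul_le_mul (e1.trans ?_) (e2.trans ?_) (norm_nonneg _) (by positivity)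
          · gcongr
          · gcongr
      _ = Q * (‖z‖ ^ μ * (‖z‖ ^ (n + 1))⁻¹) := by rw [hQ, mul_pow, inv_pow ‖z‖]; ring
      _ = _ := by
          congr 1
          rw [← Real.rpow_natCast, ← Real.rpow_neg hzn.le, ← Real.rpow_add hzn]
          congr 1; push_cast; ring
  have hq : 0 < (n : ℝ) - μ := by linarith
  have hlim : Tendsto (fun T : ℝ => h / (2 * Real.pi) *
      (2 * (B * (2 ^ p / (p - 1)) * ‖γ.target‖ ^ (1 - p)) + 6 * (Q * T ^ (-((n : ℝ) - μ)))))
      atTop (𝓝 (h / (2 * Real.pi) *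
        (2 * (B * (2 ^ p / (p - 1)) * ‖γ.target‖ ^ (1 - p)) + 6 * (Q * 0)))) :=
    ((((tendsto_rpow_neg_atTop hq).const_mul Q).const_mul 6).const_add _).const_mul _
  rw [mul_zero, mul_zero, add_zero] at hlim
  refine ge_of_tendsto hlim ?_
  filter_upwards [eventually_gt_atTop (ρ / h), eventually_ge_atTop γ.target.im,
    eventually_ge_atTop (-x₀), eventually_ge_atTop (R / h)] with T hT1 hT2 hT3 hT4
  have hT : 0 < T := (div_pos hρ.1 hh).trans hT1
  rw [weight_eq_chainIntegral hM hρ h0 h1 hh hK hs him hT2 hT1 hγ hγδ (fun z hz => (hfar z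
    (le_trans (by rw [mul_comm]; exact (div_le_iff₀ hh).1 hT4) hz)).1) n j, ← mul_sub, norm_mul]
  have hc : ‖(h / (2 * Real.pi * Complex.I) : ℂ)‖ = h / (2 * Real.pi) := by
    simp [abs_of_pos hh, abs_of_pos Real.pi_pos]
  rw [hc]
  refine mul_le_mul_of_nonneg_left ?_ (by positivity)
  have key := norm_chainIntegral_boxContour_sub_le (G := fun l => K l d * M.e n (h * l) j)
    (q := (n : ℝ) + 1 - μ) h0 h1 hs hre him hδ hp hB
    (fun z hz1 hz2 => hray z (mem_sector_of_vertical h0 h1 hδ hz1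
      (by rwa [abs_of_nonneg him])) hz1) (by linarith) hQ0 hfarG hT hT2 hT3 hT4
  refine key.trans (le_of_eq ?_)
  rw [mul_assoc Q, ← Real.rpow_add_one hT.ne']
  congr 4; ring

end RKMethod

end KernelBounds

end

/-! ### Size of the integrand -/

noncomputable section

section Size

variable {α σ ν X μ x y : ℝ}

lemma scaled_cosh_le_norm (hν : 0 < ν) (hy0 : 0 ≤ Real.sin (α + y)) (hy : Real.sin (α + y) ≤ σ) :
    (1 - σ) * (ν * Real.cosh x) ≤ ‖(ν * hyperbola α (x + y * Complex.I) : ℂ)‖ := by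
  rw [norm_mul, Complex.norm_real, Real.norm_of_nonneg hν.le, norm_hyperbola]
  have h1 := Real.one_le_cosh x
  have h2 : (1 - σ) * Real.cosh x ≤ Real.cosh x - Real.sin (α + y) := by nlinarith
  calc _ = ν * ((1 - σ) * Real.cosh x) := by ring
    _ ≤ _ := mul_le_mul_of_nonneg_left h2 hν.le

lemma norm_le_scaled_cosh (hν : 0 < ν) (hy0 : 0 ≤ Real.sin (α + y)) :
    ‖(ν * hyperbola α (x + y * Complex.I) : ℂ)‖ ≤ ν * Real.cosh x := by
  rw [norm_mul, Complex.norm_real, Real.norm_of_nonneg hν.le, norm_hyperbola]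
  exact mul_le_mul_of_nonneg_left (by linarith) hν.le

/-- Along the hyperbola, `|λ| ^ μ` times the bound `cosh x` of the derivative of `φ` is at most a
multiple of `max 1 (cosh X ^ (1 + μ))`, whatever the sign of `1 + μ`. -/
lemma cosh_mul_norm_rpow_le (hν : 0 < ν) (hσ : σ < 1) (hy0 : 0 ≤ Real.sin (α + y))
    (hy : Real.sin (α + y) ≤ σ) (hx : |x| ≤ X) :
    Real.cosh x * ‖(ν * hyperbola α (x + y * Complex.I) : ℂ)‖ ^ μ ≤
      (1 + (1 - σ) ^ μ) * ν ^ μ * max 1 (Real.cosh X ^ (1 + μ)) := by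
  have hc : 0 < 1 - σ := by linarith
  have h1 := Real.cosh_pos x
  have h2 := rpow_le_of_comparable hc (mul_pos hν h1) (scaled_cosh_le_norm hν hy0 hy)
    (norm_le_scaled_cosh hν hy0) μ
  have h3 : Real.cosh x ≤ Real.cosh X := by
    rw [Real.cosh_le_cosh]; exact hx.trans (le_abs_self X)
  have h4 : Real.cosh x ^ (1 + μ) ≤ max 1 (Real.cosh X ^ (1 + μ)) := by
    rcases le_total 0 (1 + μ) with h | h
    · exact le_max_of_le_right (Real.rpow_le_rpow h1.le h3 h)
    · exact le_max_of_le_left (Real.rpow_le_one_of_one_le_of_nonpos (Real.one_le_cosh x) h)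
  have h5 : 0 ≤ (1 + (1 - σ) ^ μ) * ν ^ μ := by
    have := Real.rpow_nonneg hc.le μ
    have := Real.rpow_nonneg hν.le μ
    positivity
  calc _ ≤ Real.cosh x * ((1 + (1 - σ) ^ μ) * (ν * Real.cosh x) ^ μ) :=
        mul_le_mul_of_nonneg_left h2 h1.le
    _ = (1 + (1 - σ) ^ μ) * ν ^ μ * Real.cosh x ^ (1 + μ) := by
        rw [Real.mul_rpow hν.le h1.le, Real.rpow_add h1, Real.rpow_one]; ring
    _ ≤ _ := mul_le_mul_of_nonneg_left h4 h5

end Size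

namespace RKMethod

variable {s : ℕ} {M : RKMethod s} {K : ℂ → ℝ → ℂ} {d h α ν X σ μ x y : ℝ} {n m : ℕ}

/-- A bound for `K eₙ` at a point of the hyperbola turns into one for the integrand. -/
lemma norm_integrand_apply_le (hh : 0 < h) (hν : 0 < ν) (hσ : σ < 1)
    (hy0 : 0 ≤ Real.sin (α + y)) (hy : Real.sin (α + y) ≤ σ) (hx : |x| ≤ X) {P w : ℝ} (hP : 0 ≤ P)
    (hw : 0 ≤ w) (j : Fin (s + 1)) {l : ℂ} (hl : l = ν * hyperbola α (x + y * Complex.I))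
    (hG : ‖K l d * M.e n (h * l) j‖ ≤ P * (‖l‖ ^ μ * w)) :
    ‖M.integrand K d h n α ν (x + y * Complex.I) j‖ ≤
      P * (1 + (1 - σ) ^ μ) * (ν ^ (1 + μ) * max 1 (Real.cosh X ^ (1 + μ))) * (h / 2 * w) := by
  have h1 := cosh_mul_norm_rpow_le (μ := μ) hν hσ hy0 hy hx
  rw [← hl] at h1
  have h2 := norm_deriv_hyperbola_le (α := α) x y
  have hc := Real.cosh_pos x
  have hint : M.integrand K d h n α ν (x + y * Complex.I) j =
      (ν * h : ℂ) / (2 * Real.pi * Complex.I) * deriv (hyperbola α) (x + y * Complex.I) *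
        (K l d * M.e n (h * l) j) := by
    rw [integrand, ← hl, Pi.smul_apply, smul_eq_mul, mul_comm l]; ring
  have hn : ‖((ν * h : ℂ) / (2 * Real.pi * Complex.I))‖ = ν * h / (2 * Real.pi) := by
    simp [abs_of_pos hh, abs_of_pos hν, abs_of_pos Real.pi_pos]
  -- the factor `1 / 2` absorbs that the two horizontal lines together have length `4 X`
  have h3 : ν * h / (2 * Real.pi) ≤ ν * h / 2 := by
    refine div_le_div_of_nonneg_left (by positivity) (by norm_num) ?_
    linarith [Real.pi_gt_three]
  rw [hint, norm_mul, norm_mul, hn]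
  calc _ ≤ ν * h / 2 * Real.cosh x * (P * (‖l‖ ^ μ * w)) := by gcongr
    _ = ν * h / 2 * P * w * (Real.cosh x * ‖l‖ ^ μ) := by ring
    _ ≤ ν * h / 2 * P * w * ((1 + (1 - σ) ^ μ) * ν ^ μ * max 1 (Real.cosh X ^ (1 + μ))) := by
        gcongr
    _ = _ := by rw [Real.rpow_add hν, Real.rpow_one]; ring

/-- The contour integral over the hyperbola arc is the integral of the integrand. -/
lemma arc_integral_eq_integral_integrand (hX : 0 ≤ X) (j : Fin (s + 1)) :
    h / (2 * Real.pi * Complex.I) *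
        (hyperbolaArc α ν X hX).integral (fun l => K l d * M.e n (h * l) j) =
      ∫ x in (-X)..X, M.integrand K d h n α ν x j := by
  have h1 : (hyperbolaArc α ν X hX).integral (fun l => K l d * M.e n (h * l) j) =
      ∫ x in (-X)..X, K (ν * hyperbola α x) d * M.e n (h * (ν * hyperbola α x)) j *
        (ν * (Complex.I * Complex.cos (α - Complex.I * x))) := rfl
  rw [h1, ← intervalIntegral.integral_const_mul]
  refine intervalIntegral.integral_congr fun x _ => ?_
  rw [integrand, Pi.smul_apply, smul_eq_mul, deriv_hyperbola, mul_comm (ν * hyperbola α x : ℂ) h]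
  ring

lemma inv_one_add_pow_le {t : ℝ} (ht : 0 < t) : ((1 + t)⁻¹) ^ (m + 1) ≤ (t ^ m)⁻¹ := by
  rw [inv_pow]
  refine inv_anti₀ (by positivity) ?_
  calc t ^ m ≤ (1 + t) ^ m := pow_le_pow_left₀ ht.le (by linarith) m
    _ ≤ (1 + t) ^ (m + 1) := pow_le_pow_right₀ (by linarith) (Nat.le_succ m)

/-- The size of the contribution of the two vertical rays, starting from the bound provided by
`norm_weight_sub_arc_integral_le` with `p = m + 1 - μ`. -/
lemma ray_contribution_le (hh : 0 < h) (hν : 0 < ν) (hσ : σ < 1) (hμ : μ < m)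
    (hα0 : 0 ≤ Real.sin α) (hα : Real.sin α ≤ σ) {a : ℝ} (ha : 0 ≤ a) (haX : a ≤ X) {P : ℝ}
    (hP : 0 ≤ P) :
    h / (2 * Real.pi) * (2 * (P * (h⁻¹) ^ (m + 1) *
      (2 ^ ((m : ℝ) + 1 - μ) / ((m : ℝ) + 1 - μ - 1)) *
        ‖(ν * hyperbola α X : ℂ)‖ ^ (1 - ((m : ℝ) + 1 - μ)))) ≤
      P * (1 + (1 - σ) ^ μ) * (ν ^ (1 + μ) * max 1 (Real.cosh X ^ (1 + μ))) *
        (((1 - σ) ^ m)⁻¹ * (2 ^ ((m : ℝ) + 1 - μ) / (m - μ)) *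
          (1 / ν * ((h * ν * Real.cosh a) ^ m)⁻¹)) := by
  have hX : 0 ≤ X := ha.trans haX
  have hc : 0 < 1 - σ := by linarith
  have hy : Real.sin (α + 0) = Real.sin α := by rw [add_zero]
  have hsize := cosh_mul_norm_rpow_le (μ := μ) (x := X) (y := 0) hν hσ (hy.symm ▸ hα0)
    (hy.symm ▸ hα) (abs_of_nonneg hX).le
  have hlow := scaled_cosh_le_norm (x := X) (y := 0) hν (hy.symm ▸ hα0) (hy.symm ▸ hα)
  rw [← hyperbola_ofReal] at hsize hlow
  set N := ‖(ν * hyperbola α X : ℂ)‖ with hN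
  have hca := Real.cosh_pos a
  have hcc : Real.cosh a ≤ Real.cosh X := by
    rw [Real.cosh_le_cosh, abs_of_nonneg ha, abs_of_nonneg hX]; exact haX
  have hlow2 : (1 - σ) * (ν * Real.cosh a) ≤ N := le_trans (by gcongr) hlow
  have hN0 : 0 < N := lt_of_lt_of_le (by positivity) hlow2
  have hNμ : 0 ≤ N ^ μ := Real.rpow_nonneg hN0.le _
  have h1 : N ^ (1 - ((m : ℝ) + 1 - μ)) ≤
      (1 + (1 - σ) ^ μ) * ν ^ μ * max 1 (Real.cosh X ^ (1 + μ)) *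
        (((1 - σ) * (ν * Real.cosh a)) ^ m)⁻¹ := by
    have e1 : N ^ (1 - ((m : ℝ) + 1 - μ)) = N ^ μ * (N ^ m)⁻¹ := by
      rw [← Real.rpow_natCast N m, ← Real.rpow_neg hN0.le, ← Real.rpow_add hN0]
      congr 1; ring
    rw [e1]
    have e2 : N ^ μ ≤ Real.cosh X * N ^ μ := le_mul_of_one_le_left hNμ (Real.one_le_cosh X)
    refine mul_le_mul (e2.trans hsize) (inv_anti₀ (by positivity) ?_) (by positivity) ?_
    · exact pow_le_pow_left₀ (by positivity) hlow2 m
    · exact (mul_nonneg (Real.cosh_pos X).le hNμ).trans hsize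
  have hm : 0 < (m : ℝ) - μ := by linarith
  have hm' : (m : ℝ) + 1 - μ - 1 = m - μ := by ring
  rw [hm']
  set q : ℝ := 2 ^ ((m : ℝ) + 1 - μ) / ((m : ℝ) - μ) with hq
  have hq0 : 0 ≤ q := by positivity
  have hpi : h / (2 * Real.pi) * 2 ≤ h := by
    rw [div_mul_eq_mul_div, div_le_iff₀ (by positivity)]
    nlinarith [Real.pi_gt_three]
  have hr0 : 0 ≤ N ^ (1 - ((m : ℝ) + 1 - μ)) := Real.rpow_nonneg hN0.le _
  calc _ = (h / (2 * Real.pi) * 2) *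
        (P * (h⁻¹) ^ (m + 1) * q * N ^ (1 - ((m : ℝ) + 1 - μ))) := by ring
    _ ≤ h * (P * (h⁻¹) ^ (m + 1) * q * ((1 + (1 - σ) ^ μ) * ν ^ μ *
        max 1 (Real.cosh X ^ (1 + μ)) * (((1 - σ) * (ν * Real.cosh a)) ^ m)⁻¹)) := by
        gcongr
    _ = _ := by
        rw [Real.rpow_add hν, Real.rpow_one, mul_pow, mul_pow (h * ν), mul_pow h, mul_pow ν,
          mul_inv, mul_inv, mul_inv, mul_inv, pow_succ, inv_pow]
        field_simp

end RKMethod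

end

/-! ### The quadrature error -/

noncomputable section

namespace RKMethod

variable {s : ℕ} {M : RKMethod s}

lemma loss_le {m n : ℕ} (hm : m ≤ n) (hn : 1 ≤ n) : M.loss m ≤ n := by
  unfold loss; split_ifs
  · exact hm
  · exact max_le hm hn

lemma differentiableOn_integrand (hM : M.Admissible) {ρ : ℝ} (hρ : M.IsStripWidth ρ) {δ : ℝ}
    {K : ℂ → ℝ → ℂ} {d : ℝ} (hK : DifferentiableOn ℂ (fun l => K l d) (sector δ))
    (hsec : IsOpen (sector δ)) (h α ν : ℝ) (n : ℕ) (j : Fin (s + 1)) :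
    DifferentiableOn ℂ (fun z => M.integrand K d h n α ν z j)
      {z | (ν * hyperbola α z : ℂ) ∈ sector δ ∧ (ν * hyperbola α z * h : ℂ).re < ρ} := by
  rintro z ⟨h1, h2⟩
  refine DifferentiableAt.differentiableWithinAt ?_
  have hφ : DifferentiableAt ℂ (fun z => (ν * hyperbola α z : ℂ)) z :=
    (hasDerivAt_hyperbola z).differentiableAt.const_mul _
  have e1 : DifferentiableAt ℂ (fun z => K (ν * hyperbola α z) d) z :=
    DifferentiableAt.comp (g := fun l => K l d) z (hK.differentiableAt (hsec.mem_nhds h1)) hφ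
  have e2 : DifferentiableAt ℂ (fun z => M.e n (ν * hyperbola α z * h) j) z :=
    DifferentiableAt.comp (g := fun z => M.e n z j) z (differentiableAt_e hM hρ h2 n j)
      (hφ.mul_const _)
  have e3 : DifferentiableAt ℂ (deriv (hyperbola α)) z := by
    have : deriv (hyperbola α) = fun z => Complex.I * Complex.cos (α - Complex.I * z) :=
      funext fun z => deriv_hyperbola z
    rw [this]; fun_prop
  have := ((e1.const_mul ((ν * h : ℂ) / (2 * Real.pi * Complex.I))).mul e3).mul e2
  exact this

lemma isOpen_integrand_domain {δ : ℝ} (hsec : IsOpen (sector δ)) (h α ν ρ : ℝ) :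
    IsOpen {z : ℂ | (ν * hyperbola α z : ℂ) ∈ sector δ ∧ (ν * hyperbola α z * h : ℂ).re < ρ} := by
  have hφ : Continuous fun z : ℂ => (ν * hyperbola α z : ℂ) :=
    continuous_const.mul (continuous_iff_continuousAt.2 fun z =>
      (hasDerivAt_hyperbola z).continuousAt)
  exact (hsec.preimage hφ).inter
    (isOpen_lt (Complex.continuous_re.comp (hφ.mul continuous_const)) continuous_const)

set_option maxHeartbeats 400000 in
/-- The bound for a single component of the quadrature error.  The hyperbola is truncated at
`X = a + τ / 2`, the right end of the last cell of the quadrature rule.  The choice of `a` and `ν`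
enters through `hE1` and `hE2`: it makes the discretisation error (growth `exp (2 T ν)` on the
right of the imaginary axis times `exp (-2 π b / τ)`) and the truncation error (decay at the ends
of the hyperbola) the same quantity `E`. -/
lemma norm_weight_sub_quadrature_apply_le (hM : M.Admissible) {ρ : ℝ} (hρ : M.IsStripWidth ρ)
    {μ : ℝ} {m n : ℕ} (hμm : μ < m) {C₁ : ℝ} (hC₁ : 0 < C₁)
    (he : ∀ z : ℂ, z.re ≤ ρ → ∀ n : ℕ, m ≤ n → 1 ≤ n → ∀ j,
      ‖M.e n z j‖ ≤ C₁ * ‖M.r z‖ ^ (n - M.loss m) * ((1 + ‖z‖)⁻¹) ^ (m + 1))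
    {δ α b : ℝ} (h0 : 0 < δ) (h1 : δ < Real.pi / 2) (hb : 0 < b) (hbα : b < α)
    (hbδ : α + b < Real.pi / 2 - δ) {K : ℂ → ℝ → ℂ} {d Cd : ℝ} (hd : 0 < d)
    (hK : DifferentiableOn ℂ (fun l => K l d) (sector δ))
    (hKb : ∀ l ∈ sector δ, ‖Complex.exp (l * d) * K l d‖ ≤ Cd * ‖l‖ ^ μ)
    {t₀ D T h ν ξ a τ u E : ℝ} {L : ℕ} (hh : 0 < h) (hν : 0 < ν) (ha : 0 < a)
    (hτ : 0 < τ) (hτL : τ = a / L) (hL : 1 ≤ L)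
    (hγ : 0 ≤ M.gam ξ) (hξ0 : 0 ≤ ξ)
    (hξ : ∀ y ∈ Set.Icc (-b) b,
      -ξ ≤ h * (ν * (1 - Real.sin (α + y) * Real.cosh (a + τ / 2))))
    (hνρ : h * ν * (1 - Real.sin (α - b)) < ρ) (hmn : m ≤ n) (hn1 : 1 ≤ n)
    (hn : t₀ ≤ n * h) (hnT : n * h ≤ T) (hdD : d ≤ D * M.gam ξ * t₀)
    (hD : D < 1) (ht₀ : 0 < t₀) (ha1 : 1 ≤ Real.sin (α - b) * Real.cosh a)
    (hu : u = 2 * Real.pi * b / τ)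
    (hE1 : Real.exp (2 * T * ν) * Real.exp (-u) = E)
    (hE2 : Real.exp (M.gam ξ * (1 - D) * t₀ *
      (ν * (1 - Real.sin (α - b) * Real.cosh a))) = E)
    (j : Fin (s + 1)) :
    ‖M.weight K d h n j - M.quadrature K d h n α ν a L j‖ ≤
      Cd * C₁ * (1 + (1 - Real.sin (α + b)) ^ μ) *
        (ν ^ (1 + μ) * max 1 (Real.cosh (a + τ / 2) ^ (1 + μ))) *
        (h * (2 * a + τ) / (1 - Real.exp (-u)) +
          ((1 - Real.sin (α + b)) ^ m)⁻¹ * (h * τ) * ((h * ν * Real.cosh a) ^ m)⁻¹ +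
          ((1 - Real.sin (α + b)) ^ m)⁻¹ * (2 ^ ((m : ℝ) + 1 - μ) / (m - μ)) *
            (1 / ν * ((h * ν * Real.cosh a) ^ m)⁻¹)) *
        Real.exp (M.loss m * (M.gam ξ * ξ)) * E := by
  have hpi := Real.pi_pos
  have hκ : M.loss m ≤ n := loss_le hmn hn1
  have hCd := kernel_const_nonneg h0 h1 hKb
  set X := a + τ / 2 with hX
  set σ := Real.sin (α + b) with hσdef
  have hX0 : 0 < X := by positivity
  have hLpos : (0 : ℝ) < L := by exact_mod_cast hL
  -- the sine on the strip
  have hsinlow : ∀ y ∈ Set.Icc (-b) b, Real.sin (α - b) ≤ Real.sin (α + y) := fun y hy =>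
    Real.sin_le_sin_of_le_of_le_pi_div_two (by linarith) (by linarith [hy.2]) (by linarith [hy.1])
  have hsinup : ∀ y ∈ Set.Icc (-b) b, Real.sin (α + y) ≤ σ := fun y hy =>
    Real.sin_le_sin_of_le_of_le_pi_div_two (by linarith [hy.1]) (by linarith) (by linarith [hy.2])
  have hsa : 0 < Real.sin (α - b) := Real.sin_pos_of_pos_of_lt_pi (by linarith) (by linarith)
  have hσδ : σ < Real.cos δ := by
    rw [← Real.sin_pi_div_two_sub]
    exact Real.sin_lt_sin_of_lt_of_le_pi_div_two (by linarith) (by linarith) (by linarith)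
  have hσ1 : σ < 1 := hσδ.trans_le (Real.cos_le_one δ)
  have hy0 : ∀ y ∈ Set.Icc (-b) b, 0 ≤ Real.sin (α + y) := fun y hy =>
    hsa.le.trans (hsinlow y hy)
  have hcc : 0 < 1 - σ := by linarith
  -- the points of the strip
  have hsec : ∀ x y : ℝ, y ∈ Set.Icc (-b) b →
      (ν * hyperbola α (x + y * Complex.I) : ℂ) ∈ sector δ := fun x y hy =>
    smul_mem_sector h0 h1 (hyperbola_mem_sector h0 h1 (hy0 y hy) ((hsinup y hy).trans_lt hσδ)) hν
  have hre : ∀ x y : ℝ, (ν * hyperbola α (x + y * Complex.I) : ℂ).re =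
      ν * (1 - Real.sin (α + y) * Real.cosh x) := fun x y => by
    rw [Complex.re_ofReal_mul, hyperbola_re]
  have hre_up : ∀ x y : ℝ, y ∈ Set.Icc (-b) b →
      ν * (1 - Real.sin (α + y) * Real.cosh x) ≤ ν * (1 - Real.sin (α - b)) := fun x y hy => by
    have e1 := Real.one_le_cosh x
    have e2 := hsinlow y hy
    refine mul_le_mul_of_nonneg_left ?_ hν.le
    nlinarith
  have hre_low : ∀ x y : ℝ, |x| ≤ X → y ∈ Set.Icc (-b) b →
      -ξ ≤ h * (ν * (1 - Real.sin (α + y) * Real.cosh x)) := fun x y hx hy => by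
    refine (hξ y hy).trans ?_
    have e1 : Real.cosh x ≤ Real.cosh X := by
      rw [Real.cosh_le_cosh]; exact hx.trans (le_abs_self X)
    have e2 := mul_le_mul_of_nonneg_left e1 (hy0 y hy)
    gcongr
  have hreρ : ∀ x y : ℝ, y ∈ Set.Icc (-b) b →
      h * (ν * (1 - Real.sin (α + y) * Real.cosh x)) < ρ := fun x y hy => by
    have := mul_le_mul_of_nonneg_left (hre_up x y hy) hh.le
    linarith
  have hE0 : 0 ≤ E := by rw [← hE2]; positivity
  have hγD : 0 ≤ M.gam ξ * (1 - D) * t₀ := by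
    have : 0 ≤ 1 - D := by linarith
    positivity
  have heL : ∀ l : ℂ, h * l.re ≤ ρ →
      ‖M.e n (h * l) j‖ ≤ C₁ * ‖M.r (h * l)‖ ^ (n - M.loss m) *
        ((1 + ‖(h * l : ℂ)‖)⁻¹) ^ (m + 1) := fun l hl =>
    he _ (by rwa [Complex.re_ofReal_mul]) n hmn hn1 j
  set P := Cd * C₁ * Real.exp (M.loss m * (M.gam ξ * ξ)) with hP
  have hP0 : 0 ≤ P := by positivity
  have hT0 : 0 ≤ T := by linarith
  have hexp1 : 1 ≤ Real.exp (2 * T * ν) := Real.one_le_exp (by positivity)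
  have hexp2 : 1 ≤ Real.exp (M.loss m * (M.gam ξ * ξ)) := Real.one_le_exp (by positivity)
  -- the integrand on the boundary of the rectangle
  have hhor : ∀ x ∈ Set.Icc (-X) X, ∀ y ∈ Set.Icc (-b) b,
      ‖M.integrand K d h n α ν (x + y * Complex.I) j‖ ≤
        P * Real.exp (2 * T * ν) * (1 + (1 - σ) ^ μ) *
          (ν ^ (1 + μ) * max 1 (Real.cosh X ^ (1 + μ))) * (h / 2 * 1) := by
    intro x hx y hy
    have hx' : |x| ≤ X := abs_le.2 hx
    refine norm_integrand_apply_le hh hν hσ1 (hy0 y hy) (hsinup y hy) hx' (by positivity)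
      zero_le_one j rfl ?_
    set l : ℂ := ν * hyperbola α (x + y * Complex.I) with hl
    have hlre : l.re = ν * (1 - Real.sin (α + y) * Real.cosh x) := hre x y
    have hlμ : 0 ≤ ‖l‖ ^ μ := Real.rpow_nonneg (norm_nonneg _) _
    have hone : ((1 + h * ‖l‖)⁻¹) ^ (m + 1) ≤ 1 :=
      pow_le_one₀ (by positivity)
        (inv_le_one_of_one_le₀ (by linarith [mul_nonneg hh.le (norm_nonneg l)]))
    have hel := heL l (by rw [hlre]; exact (hreρ x y hy).le)
    rcases le_total l.re 0 with hneg | hpos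
    · refine (norm_kernel_mul_e_le_left hM hKb hCd hC₁.le hh hγ hdD hn hκ (hsec x y hy)
        (by rw [← hl, hlre]; exact hre_low x y hx' hy) hneg hel).trans ?_
      have : Real.exp (M.gam ξ * (1 - D) * t₀ * l.re) ≤ Real.exp (2 * T * ν) :=
        (Real.exp_le_one_iff.2 (mul_nonpos_of_nonneg_of_nonpos hγD hneg)).trans hexp1
      gcongr
    · refine (norm_kernel_mul_e_le_right hρ hKb hCd hd.le hC₁.le hh (hsec x y hy) hpos
        (by rw [← hl, hlre]; exact (hreρ x y hy).le) hel).trans ?_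
      have e1 : l.re ≤ ν := by
        rw [hlre]
        refine mul_le_of_le_one_right hν.le ?_
        linarith [mul_nonneg (hy0 y hy) (Real.cosh_pos x).le]
      have e2 : Real.exp (2 * (n * h) * l.re) ≤ Real.exp (2 * T * ν) := by
        refine Real.exp_le_exp.2 ?_
        gcongr
      have e3 : Cd * C₁ ≤ P := le_mul_of_one_le_right (by positivity) hexp2
      gcongr
  have hcoshX : Real.cosh a ≤ Real.cosh X := by
    rw [Real.cosh_le_cosh, abs_of_pos ha, abs_of_pos hX0]; linarith
  have hend : ∀ y ∈ Set.Icc (-b) b,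
      1 - Real.sin (α + y) * Real.cosh X ≤ 1 - Real.sin (α - b) * Real.cosh a := fun y hy => by
    have := mul_le_mul (hsinlow y hy) hcoshX (Real.cosh_pos a).le (hy0 y hy)
    linarith
  have hexpend : ∀ y ∈ Set.Icc (-b) b, Real.exp (M.gam ξ * (1 - D) * t₀ *
      (ν * (1 - Real.sin (α + y) * Real.cosh X))) ≤ E := fun y hy => by
    rw [← hE2]
    refine Real.exp_le_exp.2 (mul_le_mul_of_nonneg_left ?_ hγD)
    exact mul_le_mul_of_nonneg_left (hend y hy) hν.le
  have hendneg : ∀ y ∈ Set.Icc (-b) b, ν * (1 - Real.sin (α + y) * Real.cosh X) ≤ 0 :=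
    fun y hy => mul_nonpos_of_nonneg_of_nonpos hν.le (by linarith [hend y hy])
  have hver : ∀ x : ℝ, |x| = X → ∀ y ∈ Set.Icc (-b) b,
      ‖M.integrand K d h n α ν (x + y * Complex.I) j‖ ≤
        P * E * (1 + (1 - σ) ^ μ) * (ν ^ (1 + μ) * max 1 (Real.cosh X ^ (1 + μ))) *
          (h / 2 * (((1 - σ) ^ m)⁻¹ * ((h * ν * Real.cosh a) ^ m)⁻¹)) := by
    intro x hx y hy
    have hca := Real.cosh_pos a
    have hcx : Real.cosh x = Real.cosh X := by rw [← Real.cosh_abs, hx]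
    refine norm_integrand_apply_le hh hν hσ1 (hy0 y hy) (hsinup y hy) hx.le (by positivity)
      (by positivity) j rfl ?_
    set l : ℂ := ν * hyperbola α (x + y * Complex.I) with hl
    have hlre : l.re = ν * (1 - Real.sin (α + y) * Real.cosh X) := by rw [← hcx]; exact hre x y
    have hlμ : 0 ≤ ‖l‖ ^ μ := Real.rpow_nonneg (norm_nonneg _) _
    have hlow : (1 - σ) * (ν * Real.cosh a) ≤ ‖l‖ := by
      refine le_trans ?_ (scaled_cosh_le_norm (x := x) hν (hy0 y hy) (hsinup y hy))
      rw [hcx]; gcongr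
    have hl0 : 0 < ‖l‖ := lt_of_lt_of_le (by positivity) hlow
    have hpow : ((1 + h * ‖l‖)⁻¹) ^ (m + 1) ≤ ((1 - σ) ^ m)⁻¹ * ((h * ν * Real.cosh a) ^ m)⁻¹ := by
      refine (inv_one_add_pow_le (mul_pos hh hl0)).trans ?_
      rw [← mul_inv, ← mul_pow]
      refine inv_anti₀ (by positivity) (pow_le_pow_left₀ (by positivity) ?_ m)
      calc _ = h * ((1 - σ) * (ν * Real.cosh a)) := by ring
        _ ≤ _ := by gcongr
    have hel := heL l (by
      rw [hlre]; exact (mul_nonpos_of_nonneg_of_nonpos hh.le (hendneg y hy)).trans hρ.1.le)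
    refine (norm_kernel_mul_e_le_left hM hKb hCd hC₁.le hh hγ hdD hn hκ (hsec x y hy)
      (by rw [← hl, hlre]; exact hξ y hy) (by rw [← hl, hlre]; exact hendneg y hy) hel).trans ?_
    have := hexpend y hy
    rw [← hlre] at this
    gcongr
  -- the trapezoidal rule
  have hX' : X = (L + 1 / 2) * τ := by
    rw [hX, hτL]; field_simp
  have htrap := norm_integral_sub_trapezoid_le hτ hb L hX'
    (isOpen_integrand_domain (isOpen_sector h0 h1) h α ν ρ)
    (differentiableOn_integrand hM hρ hK (isOpen_sector h0 h1) h α ν n j)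
    (fun x _ y hy => ⟨hsec x y hy, by
      rw [mul_comm, Complex.re_ofReal_mul, hre]; exact hreρ x y hy⟩)
    (fun x hx => ⟨hhor x hx b ⟨by linarith, le_rfl⟩, hhor x hx (-b) ⟨le_rfl, by linarith⟩⟩)
    (fun y hy => ⟨hver X (abs_of_pos hX0) y hy, hver (-X) (by rw [abs_neg, abs_of_pos hX0]) y hy⟩)
  have hquad : M.quadrature K d h n α ν a L j =
      τ * ∑ k ∈ Finset.Icc (-(L : ℤ)) L, M.integrand K d h n α ν (k * τ) j := by
    rw [quadrature, Pi.smul_apply, Finset.sum_apply, smul_eq_mul, ← hτL]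
    push_cast; rfl
  -- the vertical rays
  have hz0 : (0 : ℝ) ∈ Set.Icc (-b) b := ⟨by linarith, hb.le⟩
  have htarget : (hyperbolaArc α ν X hX0.le).target = ν * hyperbola α X := rfl
  have htre : (hyperbolaArc α ν X hX0.le).target.re =
      ν * (1 - Real.sin (α + 0) * Real.cosh X) := by
    rw [htarget, hyperbola_ofReal, hre]
  have hgt : 1 < Real.sin (α + 0) * Real.cosh X := by
    have e1 : Real.sin (α - b) < Real.sin (α + 0) :=
      Real.sin_lt_sin_of_lt_of_le_pi_div_two (by linarith) (by linarith) (by linarith)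
    have := mul_lt_mul e1 hcoshX (Real.cosh_pos a) (hy0 0 hz0)
    linarith
  have htre0 : (hyperbolaArc α ν X hX0.le).target.re < 0 := by
    rw [htre]; exact mul_neg_of_pos_of_neg hν (by linarith)
  have htim : 0 ≤ (hyperbolaArc α ν X hX0.le).target.im := by
    rw [htarget, Complex.im_ofReal_mul, hyperbola_ofReal, hyperbola_im]
    have e1 : 0 ≤ Real.cos (α + 0) := Real.cos_nonneg_of_mem_Icc ⟨by linarith, by linarith⟩
    have e2 : 0 ≤ Real.sinh X := Real.sinh_nonneg_iff.2 hX0.le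
    positivity
  have htrace : ∀ z ∈ (hyperbolaArc α ν X hX0.le).trace, ∃ x : ℝ,
      z = ν * hyperbola α (x + (0 : ℝ) * Complex.I) := by
    rintro z ⟨x, -, rfl⟩
    exact ⟨x, by rw [← hyperbola_ofReal]; rfl⟩
  have hp1 : 1 < (m : ℝ) + 1 - μ := by linarith
  have hray : ∀ z ∈ sector δ, z.re = (hyperbolaArc α ν X hX0.le).target.re →
      ‖K z d * M.e n (h * z) j‖ ≤
        P * E * (h⁻¹) ^ (m + 1) * ‖z‖ ^ (-((m : ℝ) + 1 - μ)) := by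
    intro z hz hzr
    have hzn : 0 < ‖z‖ := norm_pos_iff.2 hz.1
    have hzre : z.re = ν * (1 - Real.sin (α + 0) * Real.cosh X) := by rw [hzr, htre]
    have hlμ : 0 ≤ ‖z‖ ^ μ := Real.rpow_nonneg (norm_nonneg _) _
    have hel := heL z (by
      rw [hzre]; exact (mul_nonpos_of_nonneg_of_nonpos hh.le (hendneg 0 hz0)).trans hρ.1.le)
    refine (norm_kernel_mul_e_le_left hM hKb hCd hC₁.le hh hγ hdD hn hκ hz
      (by rw [hzre]; exact hξ 0 hz0) (by rw [hzre]; exact hendneg 0 hz0) hel).trans ?_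
    have e1 := hexpend 0 hz0
    rw [← hzre] at e1
    have e2 : (1 + h * ‖z‖)⁻¹ ≤ h⁻¹ * ‖z‖⁻¹ := by
      rw [← mul_inv]; exact inv_anti₀ (by positivity) (by linarith)
    calc _ ≤ P * E * (‖z‖ ^ μ * (h⁻¹ * ‖z‖⁻¹) ^ (m + 1)) := by gcongr
      _ = P * E * (h⁻¹) ^ (m + 1) * (‖z‖ ^ μ * (‖z‖ ^ (m + 1))⁻¹) := by
          rw [mul_pow, inv_pow ‖z‖]; ring
      _ = _ := by
          congr 1
          rw [← Real.rpow_natCast, ← Real.rpow_neg hzn.le, ← Real.rpow_add hzn]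
          congr 1; push_cast; ring
  have hμn : μ < n := hμm.trans_le (by exact_mod_cast hmn)
  have hdeform := norm_weight_sub_arc_integral_le hM hρ h0 h1 hh hK hKb hd.le hn1 hμn
    (hyperbolaArc_source ν X hX0.le) htre0 htim
    (fun z hz => by
      obtain ⟨x, rfl⟩ := htrace z hz
      rw [hre, lt_div_iff₀ hh, mul_comm]; exact hreρ x 0 hz0)
    (fun z hz => by obtain ⟨x, rfl⟩ := htrace z hz; exact hsec x 0 hz0)
    hp1 (by positivity) j hray
  rw [arc_integral_eq_integral_integrand, htarget] at hdeform
  have hraybound := ray_contribution_le hh hν hσ1 hμm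
    (by simpa using hy0 0 hz0) (by simpa using hsinup 0 hz0) ha.le (by linarith : a ≤ X)
    (mul_nonneg hP0 hE0)
  have hdeform2 := hdeform.trans hraybound
  rw [← hquad, ← hu] at htrap
  have hupos : 0 < u := by rw [hu]; positivity
  have hu1 : Real.exp (-u) < 1 := Real.exp_lt_one_iff.2 (by linarith)
  have huinv : (Real.exp u - 1)⁻¹ = Real.exp (-u) / (1 - Real.exp (-u)) := by
    rw [Real.exp_neg]
    have := Real.exp_pos u
    have : 1 < Real.exp u := Real.one_lt_exp_iff.2 hupos
    have e1 : Real.exp u - 1 ≠ 0 := by linarith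
    have e2 : 1 - (Real.exp u)⁻¹ ≠ 0 := by
      have : (Real.exp u)⁻¹ < 1 := inv_lt_one_of_one_lt₀ this
      linarith
    field_simp
  rw [huinv] at htrap
  have hfirst : 4 * X * (P * Real.exp (2 * T * ν) * (1 + (1 - σ) ^ μ) *
      (ν ^ (1 + μ) * max 1 (Real.cosh X ^ (1 + μ))) * (h / 2 * 1)) *
      (Real.exp (-u) / (1 - Real.exp (-u))) =
      P * (1 + (1 - σ) ^ μ) * (ν ^ (1 + μ) * max 1 (Real.cosh X ^ (1 + μ))) *
        (h * (2 * a + τ) / (1 - Real.exp (-u))) * E := by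
    rw [← hE1, hX]; ring
  rw [hfirst] at htrap
  have hsecond : 0 ≤ P * E * (1 + (1 - σ) ^ μ) * (ν ^ (1 + μ) * max 1 (Real.cosh X ^ (1 + μ))) *
      (h / 2 * (((1 - σ) ^ m)⁻¹ * ((h * ν * Real.cosh a) ^ m)⁻¹)) := by
    have := Real.cosh_pos a
    positivity
  have hsum := norm_sub_le_norm_sub_add_norm_sub (M.weight K d h n j)
    (∫ x in (-X)..X, M.integrand K d h n α ν x j) (M.quadrature K d h n α ν a L j)
  refine (hsum.trans (add_le_add hdeform2 htrap)).trans ?_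
  refine le_of_le_of_eq (add_le_add le_rfl (add_le_add le_rfl
    (le_mul_of_one_le_left (mul_nonneg hτ.le hsecond) one_le_two))) ?_
  rw [hP]
  ring

end RKMethod

end

theorem corollary4p6 {s : ℕ} (M : RKMethod s) (hM : M.Admissible) :
    (∃ ρ : ℝ, M.IsStripWidth ρ) ∧
    ∀ ρ : ℝ, M.IsStripWidth ρ → ∀ μ : ℝ, ∀ m : ℕ, IsLeast {k : ℕ | μ < k} m →
    ∃ C : ℝ → ℝ, (∀ σ, 0 < C σ) ∧
      ∀ (δ α b : ℝ), 0 < δ → δ < Real.pi / 2 → 0 < α → α < Real.pi / 2 - δ →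
        0 < b → b < min α (Real.pi / 2 - (δ + α)) →
      -- the kernel
      ∀ (K : ℂ → ℝ → ℂ) (d Cd : ℝ), 0 < d →
        DifferentiableOn ℂ (fun l => K l d) (sector δ) →
        (∀ l ∈ sector δ, ‖Complex.exp (l * d) * K l d‖ ≤ Cd * ‖l‖ ^ μ) →
      -- the time window, the step size, and the number of quadrature nodes
      ∀ (t₀ Λ D θ h ν₀ ξ a τ ν : ℝ) (L n : ℕ), 0 < t₀ → 1 ≤ Λ → 0 < D → D < 1 →
        0 < θ → θ < 1 → 0 < h → 0 < ν₀ → 1 ≤ L →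
        h * ν₀ * (1 - Real.sin (α - b)) < ρ →
        m ≤ n → t₀ ≤ n * h → n * h ≤ Λ * t₀ →
        d ≤ D * M.gam ξ * t₀ →
      -- the choice of parameters
        ξ = RKMethod.stripParam h ν₀ α b a τ →
        a = Real.arcosh ((M.gam ξ * (1 - D) * θ + 2 * Λ * (1 - θ)) /
              (M.gam ξ * (1 - D) * θ * Real.sin (α - b))) →
        τ = a / L →
        ν = Real.pi * b * L * θ / (Λ * t₀ * a) →
        ν ≤ ν₀ →
      ‖M.weight K d h n - M.quadrature K d h n α ν a L‖ ≤
        C (Real.sin (α + b)) * Cd *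
          (ν ^ (1 + μ) * max 1 (Real.cosh (a + τ / 2) ^ (1 + μ))) *
          (h * (2 * a + τ) / (1 - Real.exp (-(2 * Real.pi * b / τ))) +
            (h * τ + 1 / ν) * ((h * ν * Real.cosh a) ^ m)⁻¹) *
          Real.exp (M.loss m * (M.gam ξ * ξ)) *
          Real.exp (-(2 * Real.pi * b * L * (1 - θ) / a)) := by
  refine ⟨RKMethod.exists_isStripWidth hM, fun ρ hρ μ m hm => ?_⟩
  obtain ⟨C₁, hC₁, he⟩ := RKMethod.exists_norm_e_le hM hρ m
  have hμm : μ < m := hm.1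
  have hq : 0 ≤ (2 : ℝ) ^ ((m : ℝ) + 1 - μ) / (m - μ) := by
    have : 0 < (m : ℝ) - μ := by linarith
    positivity
  refine ⟨fun σ => C₁ * (1 + |1 - σ| ^ μ) *
    (1 + (|1 - σ| ^ m)⁻¹ * (1 + 2 ^ ((m : ℝ) + 1 - μ) / (m - μ))), fun σ => by positivity, ?_⟩
  intro δ α b h0 h1 hα hαδ hb hbmin K d Cd hd hK hKb t₀ Λ D θ h ν₀ ξ a τ ν L n ht₀ hΛ hD0 hD hθ0
    hθ hh hν₀ hL hνρ hmn hn hnT hdD hξ ha hτ hν hνν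
  have hpi := Real.pi_pos
  have hbα : b < α := hbmin.trans_le (min_le_left _ _)
  have hbδ : α + b < Real.pi / 2 - δ := by linarith [hbmin.trans_le (min_le_right _ _)]
  have hCd := kernel_const_nonneg h0 h1 hKb
  have hγ : 0 < M.gam ξ := by
    by_contra hcon
    have : D * t₀ * M.gam ξ ≤ 0 :=
      mul_nonpos_of_nonneg_of_nonpos (by positivity) (not_lt.1 hcon)
    linarith
  have hn1 : 1 ≤ n := by
    rcases Nat.eq_zero_or_pos n with rfl | h
    · simp at hn; linarith
    · exact h
  have hsa : 0 < Real.sin (α - b) := Real.sin_pos_of_pos_of_lt_pi (by linarith) (by linarith)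
  have hσ1 : Real.sin (α + b) < 1 := by
    rw [← Real.sin_pi_div_two]
    exact Real.sin_lt_sin_of_lt_of_le_pi_div_two (by linarith) le_rfl (by linarith)
  have hD1 : 1 - D ≠ 0 := by linarith
  have hg : 0 < M.gam ξ * (1 - D) * θ := by
    have : 0 < 1 - D := by linarith
    positivity
  have hΛθ : 0 < 2 * Λ * (1 - θ) := by
    have : 0 < 1 - θ := by linarith
    positivity
  set c := (M.gam ξ * (1 - D) * θ + 2 * Λ * (1 - θ)) /
    (M.gam ξ * (1 - D) * θ * Real.sin (α - b)) with hc
  have hc1 : 1 < c := by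
    rw [hc, one_lt_div (by positivity)]
    have := mul_le_of_le_one_right hg.le (Real.sin_le_one (α - b))
    linarith
  have ha0 : 0 < a := by rw [ha]; exact Real.arcosh_pos hc1
  have hcosh : Real.cosh a = c := by rw [ha]; exact Real.cosh_arcosh hc1.le
  have hscosh : Real.sin (α - b) * Real.cosh a =
      1 + 2 * Λ * (1 - θ) / (M.gam ξ * (1 - D) * θ) := by
    rw [hcosh, hc]; field_simp
  have hLpos : (0 : ℝ) < L := by exact_mod_cast hL
  have hτ0 : 0 < τ := by rw [hτ]; positivity
  have hΛ0 : 0 < Λ := by linarith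
  have hν0 : 0 < ν := by rw [hν]; positivity
  -- the supremum in the definition of `ξ` is attained on a compact set, hence not a junk value
  set S := (fun y : ℝ => |(hyperbola α ((a + τ / 2 : ℝ) + y * Complex.I)).re|) '' Set.Icc (-b) b
    with hS
  have hbdd : BddAbove S := by
    refine (isCompact_Icc.image ?_).bddAbove
    simp only [hyperbola_re]
    fun_prop
  have hsup : ∀ y ∈ Set.Icc (-b) b,
      |1 - Real.sin (α + y) * Real.cosh (a + τ / 2)| ≤ sSup S := fun y hy => by
    rw [← hyperbola_re]; exact le_csSup hbdd ⟨y, hy, rfl⟩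
  have hS0 : 0 ≤ sSup S := (abs_nonneg _).trans (hsup 0 ⟨by linarith, hb.le⟩)
  have hξS : ξ = h * ν₀ * sSup S := hξ
  have hξ0 : 0 ≤ ξ := by rw [hξS]; positivity
  have hξlow : ∀ y ∈ Set.Icc (-b) b,
      -ξ ≤ h * (ν * (1 - Real.sin (α + y) * Real.cosh (a + τ / 2))) := fun y hy => by
    have e1 := hsup y hy
    have e2 : h * ν * |1 - Real.sin (α + y) * Real.cosh (a + τ / 2)| ≤ ξ := by
      rw [hξS]; gcongr
    have e3 : -(h * ν * |1 - Real.sin (α + y) * Real.cosh (a + τ / 2)|) ≤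
        h * ν * (1 - Real.sin (α + y) * Real.cosh (a + τ / 2)) := by
      rw [← mul_neg]
      exact mul_le_mul_of_nonneg_left (neg_abs_le _) (by positivity)
    linarith
  have hνρ' : h * ν * (1 - Real.sin (α - b)) < ρ := by
    refine lt_of_le_of_lt ?_ hνρ
    have : 0 ≤ 1 - Real.sin (α - b) := by linarith [Real.sin_le_one (α - b)]
    gcongr
  have hE1 : Real.exp (2 * (Λ * t₀) * ν) * Real.exp (-(2 * Real.pi * b / τ)) =
      Real.exp (-(2 * Real.pi * b * L * (1 - θ) / a)) := by
    rw [← Real.exp_add, hν, hτ]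
    congr 1
    field_simp
    ring
  have hE2 : Real.exp (M.gam ξ * (1 - D) * t₀ *
      (ν * (1 - Real.sin (α - b) * Real.cosh a))) =
      Real.exp (-(2 * Real.pi * b * L * (1 - θ) / a)) := by
    rw [hscosh, hν]
    congr 1
    field_simp
    ring
  have hone : 1 ≤ Real.sin (α - b) * Real.cosh a := by
    rw [hscosh]
    have := (div_pos hΛθ hg).le
    linarith
  have hc0 : 0 < 1 - Real.sin (α + b) := by linarith
  simp only [abs_of_pos hc0]
  have hμ' : 0 < (m : ℝ) - μ := by linarith
  have hu1 : 0 < 1 - Real.exp (-(2 * Real.pi * b / τ)) := by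
    have : Real.exp (-(2 * Real.pi * b / τ)) < 1 := by
      have : 0 < 2 * Real.pi * b / τ := by positivity
      exact Real.exp_lt_one_iff.2 (by linarith)
    linarith
  have hca := Real.cosh_pos a
  refine (pi_norm_le_iff_of_nonneg ?_).2 fun j => ?_
  · positivity
  refine (RKMethod.norm_weight_sub_quadrature_apply_le hM hρ hμm hC₁ he h0 h1 hb hbα hbδ hd hK hKb
    hh hν0 ha0 hτ0 hτ hL hγ.le hξ0 hξlow hνρ' hmn hn1 hn hnT hdD hD ht₀ hone rfl hE1 hE2 j).trans ?_
  set q := (2 : ℝ) ^ ((m : ℝ) + 1 - μ) / (m - μ) with hqdef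
  set w := ((1 - Real.sin (α + b)) ^ m)⁻¹ with hw
  have hw0 : 0 ≤ w := by positivity
  set A := h * (2 * a + τ) / (1 - Real.exp (-(2 * Real.pi * b / τ))) with hA
  have hA0 : 0 ≤ A := by positivity
  set B := ((h * ν * Real.cosh a) ^ m)⁻¹ with hB
  have hB0 : 0 ≤ B := by positivity
  have hcomb : A + w * (h * τ) * B + w * q * (1 / ν * B) ≤
      (1 + w * (1 + q)) * (A + (h * τ + 1 / ν) * B) := by
    have e1 : 0 ≤ w * (1 + q) * A := by positivity
    have e2 : 0 ≤ (1 + w * q) * (h * τ) * B := by positivity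
    have e3 : 0 ≤ (1 + w) * (1 / ν) * B := by positivity
    linarith
  calc _ ≤ Cd * C₁ * (1 + (1 - Real.sin (α + b)) ^ μ) *
        (ν ^ (1 + μ) * max 1 (Real.cosh (a + τ / 2) ^ (1 + μ))) *
        ((1 + w * (1 + q)) * (A + (h * τ + 1 / ν) * B)) *
        Real.exp (M.loss m * (M.gam ξ * ξ)) *
        Real.exp (-(2 * Real.pi * b * L * (1 - θ) / a)) := by gcongr
    _ = _ := by ring
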